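/- **The system.** Sorts are $0$ and $\rho\to\sigma$. Individual terms are built by application from variables, $0^{0}$, the successor, the combinators $\Pi^{\rho\to\tau\to\rho}$ and $\Sigma^{(\delta\to\rho\to\tau)\to(\delta\to\rho)\to\delta\to\tau}$, the recursors $\mathrm R^{0\to\rho\to(\rho\to0\to\rho)\to\rho}$, and a constant of sort $0\to0$ without axioms (a parameter). Formulas are built from equations at sort $0$ with $\wedge,\vee,\to$ and $\forall,\exists$ over all sorts; a $\Sigma$-formula uses only equations, $\wedge$, $\vee$ and $\exists$ over sort $0$. For a closed $\Sigma$-formula $S$, $\mathrm{MQC}^+_S$ is natural deduction with proof terms for minimal predicate logic, whose judgements are marked $\vdash$ or $\vdash_S$; the usual rules keep the mark, and there are two further rules: $$\frac{\Gamma\vdash_S p:S}{\Gamma\vdash_\diamond \#p:S}\ (\text{reset}),\qquad \frac{\Gamma,\,k:A\to S\vdash_S p:S}{\Gamma\vdash_S \mathcal S k.p:A}\ (\text{shift}),$$ where $\vdash_\diamond$ is $\vdash$ or $\vdash_S$. $\mathrm{HA}^\omega$ consists of reflexivity, symmetry and transitivity of $=$, $x=y\to x+1=y+1$, $x=y\to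 t[x/z]=t[y/z]$, the defining equations of $\Pi,\Sigma,\mathrm R$ inside any term of sort $0$, and induction for all formulas. $\mathrm{HA}^{\omega+}_S$ is $\mathrm{MQC}^+_S$ with the axioms of $\mathrm{HA}^\omega$ and, for all formulas $A(x,y)$, the unique choice schema $$\forall x^0\exists!y^{\mathsf{bool}}A(x,y)\to\exists\varphi^{0\to\mathsf{bool}}\forall x^0A(x,\varphi x).\tag{AC!$^{0,\mathbb B}$}$$ Here bits are the numbers $0,1$, and quantifiers over bits, bit-streams and functions into the bits are relativized to terms of sort $0$, resp. $0\to 0$, with values $0$ or $1$. Bit-strings are coded bijectively by all natural numbers ($\langle\rangle$ by $0$, and $p*\langle b\rangle$ by $2p+1+b$). For a bit-stream $\alpha$, $\overline\alpha n$ is the string of its first $n$ bits; for a bit-string $p$, $\overline pn$ is its initial segment of length $n$, or $p$ itself if $n>\mathrm{len}(p)$. All these operations are defined by terms. **Open Induction.** Let $\pi$ be a closed term of sort $0\to 0$, read as an enumeration of bit-strings. Put $\alpha\in A:\equiv\exists l\,\exists m\,(\overline\alpha l=\pi(m))$ and $\beta<\alpha:\equiv\exists n(\overline\beta n=\overline\alpha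 n\wedge\beta(n)=0\wedge\alpha(n)=1)$ for bit-streams, and $$x\in B:\equiv\exists k\,\forall q\in\mathbb B^k\,\exists l\,\exists m\,(\overline{x*q}\,l=\pi(m))$$ for bit-strings, where the bounded quantifier is encoded by a primitive recursive term, so that $x\in B$ is the $\Sigma$-formula $\exists k\,\exists N\,(c(x,k,N)=0)$; the term $c(x,k,N)$, in which $\pi$ is used, is $0$ iff for every $q\in\mathbb B^k$ there are $l,m\le N$ with $\overline{x*q}\,l=\pi(m)$. **Theorem.** For every such $\pi$: 1. $\mathrm{HA}^\omega$ over minimal logic, without choice, shift and reset, proves for all $x$ that the $\Sigma$-formula $x\in B$ is equivalent to $\exists k\,\forall q\,(\mathrm{len}(q)=k\to\exists l\,\exists m\,(\overline{x*q}\,l=\pi(m)))$. 2. In $\mathrm{HA}^{\omega+}_S$ with $S:=(\langle\rangle\in B)$, Open Induction on Cantor space $$\forall\alpha\,(\forall\beta<\alpha\,(\beta\in A)\to\alpha\in A)\to\forall\alpha'(\alpha'\in A)$$ is derivable (with the unmarked $\vdash$ and no hypotheses) by a proof term of the form $$\begin{aligned}&\lambda h.\,\tilde\lambda\alpha'.\,\lambda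 e.\ \mathsf{dest}\ \#\big(\mathsf{dest}\ a_C(\tilde\lambda x.\,\mathcal Sk.\,k(\iota_2(\lambda a.\,k(\iota_1a))))\ \mathsf{as}\ (\chi,b)\ \mathsf{in}\\&\quad\mathsf{dest}\ h\,\alpha\,e_\alpha\,u\ \mathsf{as}\ (l,c)\ \mathsf{in}\ \mathsf{dest}\ c\ \mathsf{as}\ (m,d)\ \mathsf{in}\ a_I\,a_0\,a_3\,l\,(0,p_{10})\big)\ \mathsf{as}\ (k',h^5)\ \mathsf{in}\\&\quad\mathsf{dest}\ p_{11}\ \mathsf{as}\ (j',h^6)\ \mathsf{in}\ (\min(k',j'),p_{12}),\end{aligned}$$ $$\begin{aligned}u:=\ &\tilde\lambda\beta.\,\lambda e'.\,\lambda h'.\ \mathsf{dest}\ h'\ \mathsf{as}\ (n,h'')\ \mathsf{in}\ \mathsf{dest}\ a_1(\pi_2(\pi_2h''))\ \mathsf{as}\ (k,h''')\ \mathsf{in}\\&\mathsf{dest}\ p_7\ \mathsf{as}\ (j,h^4)\ \mathsf{in}\ (\min(n+k+1,j),p_8),\end{aligned}$$ where $\iota_i$ are the injections of $\vee$; $\pi_2$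 is the second projection of $\wedge$; $\tilde\lambda$ is $\forall$-introduction; $(t,p)$ is $\exists$-introduction; $\mathsf{dest}\ p\ \mathsf{as}\ (x,a)\ \mathsf{in}\ q$ is $\exists$-elimination; $e,e'$ are the hypotheses that $\alpha',\beta$ are bit-streams; and $\alpha$ is the term $$\dot\lambda n.\,\mathrm R\big(n+1,\langle\rangle,\dot\lambda z.\dot\lambda n'.\,z*\langle\mathsf{if}\ \chi(z*\langle0\rangle)\ \mathsf{then}\ (\mathsf{if}\ \chi(z*\langle1\rangle)\ \mathsf{then}\ 0\ \mathsf{else}\ 1)\ \mathsf{else}\ 0\rangle\big)(n).$$ The remaining letters $a_C,e_\alpha,a_I,a_0,a_3,a_1,p_7,p_8,p_{10},p_{11},p_{12}$ are suitable proof terms. The term $a_C$ can be taken such that, under the hypotheses that $\alpha'$ is a bit-stream and that $A$ is progressive, it is in $\vdash_S$ a proof of $$\forall x(x\in B\vee(x\in B\to S))\to\exists\chi^{\mathsf{bool}^*\to\mathsf{bool}}\,\forall x\big((\chi(x)=1\to x\in B)\wedge(\chi(x)=0\to(x\in B\to S))\big).$$ -/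

import Mathlib

namespace OpenInd

/-! ## Language: finite types, individual terms, formulas -/

/-- The sorts: `nat` is the sort `0`. -/
inductive Ty : Type
  | nat : Ty
  | arr : Ty → Ty → Ty

infixr:60 " ⇒ " => Ty.arr

/-- Typed de Bruijn variables; a context lists the sorts of the free variables. -/
inductive Var : List Ty → Ty → Type
  | z {Γ : List Ty} {σ : Ty} : Var (σ :: Γ) σ
  | s {Γ : List Ty} {σ τ : Ty} : Var Γ σ → Var (τ :: Γ) σ

/-- Individual terms of the arithmetic of finite types. `param` is an uninterpreted constant
of sort `0 → 0`: no axiom mentions it, so it stands for an arbitrary parameter. -/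
inductive Term : List Ty → Ty → Type
  | var {Γ : List Ty} {σ : Ty} : Var Γ σ → Term Γ σ
  | zero {Γ : List Ty} : Term Γ .nat
  | succ {Γ : List Ty} : Term Γ (.nat ⇒ .nat)
  | combK {Γ : List Ty} (ρ τ : Ty) : Term Γ (ρ ⇒ τ ⇒ ρ)
  | combS {Γ : List Ty} (δ ρ τ : Ty) : Term Γ ((δ ⇒ ρ ⇒ τ) ⇒ (δ ⇒ ρ) ⇒ δ ⇒ τ)
  | recR {Γ : List Ty} (ρ : Ty) : Term Γ (.nat ⇒ ρ ⇒ (ρ ⇒ .nat ⇒ ρ) ⇒ ρ)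
  | param {Γ : List Ty} : Term Γ (.nat ⇒ .nat)
  | app {Γ : List Ty} {σ τ : Ty} : Term Γ (σ ⇒ τ) → Term Γ σ → Term Γ τ

infixl:75 " ⬝ " => Term.app

/-- Formulas of minimal logic; the only predicate is equality at sort `0`. -/
inductive Formula : List Ty → Type
  | eq {Γ : List Ty} : Term Γ .nat → Term Γ .nat → Formula Γ
  | and {Γ : List Ty} : Formula Γ → Formula Γ → Formula Γ
  | or {Γ : List Ty} : Formula Γ → Formula Γ → Formula Γ
  | imp {Γ : List Ty} : Formula Γ → Formula Γ → Formula Γ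
  | all {Γ : List Ty} {σ : Ty} : Formula (σ :: Γ) → Formula Γ
  | ex {Γ : List Ty} {σ : Ty} : Formula (σ :: Γ) → Formula Γ

infix:50 " ≐ " => Formula.eq
infixr:35 " ⋏ " => Formula.and
infixr:30 " ⋎ " => Formula.or
infixr:25 " ⟹ " => Formula.imp

/-! ## Renaming and substitution -/

abbrev Ren (Γ Δ : List Ty) : Type := ∀ σ : Ty, Var Γ σ → Var Δ σ

abbrev Sub (Γ Δ : List Ty) : Type := ∀ σ : Ty, Var Γ σ → Term Δ σ

def Ren.lift {Γ Δ : List Ty} (r : Ren Γ Δ) (τ : Ty) : Ren (τ :: Γ) (τ :: Δ)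
  | _, .z => .z
  | _, .s v => .s (r _ v)

def Ren.weak (Γ : List Ty) (τ : Ty) : Ren Γ (τ :: Γ) := fun _ v => .s v

def Ren.empty (Γ : List Ty) : Ren [] Γ := fun _ v => nomatch v

def Term.rename {Γ Δ : List Ty} (r : Ren Γ Δ) : {σ : Ty} → Term Γ σ → Term Δ σ
  | _, .var v => .var (r _ v)
  | _, .zero => .zero
  | _, .succ => .succ
  | _, .combK ρ τ => .combK ρ τ
  | _, .combS δ ρ τ => .combS δ ρ τ
  | _, .recR ρ => .recR ρ
  | _, .param => .param
  | _, .app t u => .app (t.rename r) (u.rename r)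

def Term.weak {Γ : List Ty} {τ σ : Ty} (t : Term Γ σ) : Term (τ :: Γ) σ :=
  t.rename (Ren.weak Γ τ)

/-- A closed term, in an arbitrary context. -/
def Term.closed {σ : Ty} (t : Term [] σ) (Γ : List Ty) : Term Γ σ := t.rename (Ren.empty Γ)

def Sub.lift {Γ Δ : List Ty} (s : Sub Γ Δ) (τ : Ty) : Sub (τ :: Γ) (τ :: Δ)
  | _, .z => .var .z
  | _, .s v => (s _ v).weak

/-- The substitution `s`, extended by `a` for the most recent variable. -/
def Sub.cons {Γ Δ : List Ty} {τ : Ty} (a : Term Δ τ) (s : Sub Γ Δ) : Sub (τ :: Γ) Δ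
  | _, .z => a
  | _, .s v => s _ v

def Term.subst {Γ Δ : List Ty} (s : Sub Γ Δ) : {σ : Ty} → Term Γ σ → Term Δ σ
  | _, .var v => s _ v
  | _, .zero => .zero
  | _, .succ => .succ
  | _, .combK ρ τ => .combK ρ τ
  | _, .combS δ ρ τ => .combS δ ρ τ
  | _, .recR ρ => .recR ρ
  | _, .param => .param
  | _, .app t u => .app (t.subst s) (u.subst s)

/-- `t[a/u]` for the most recent variable `u`. -/
def Term.inst {Γ : List Ty} {τ σ : Ty} (t : Term (τ :: Γ) σ) (a : Term Γ τ) : Term Γ σ :=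
  t.subst (Sub.cons a (fun _ v => .var v))

def Formula.rename : {Γ Δ : List Ty} → Ren Γ Δ → Formula Γ → Formula Δ
  | _, _, r, .eq t u => .eq (t.rename r) (u.rename r)
  | _, _, r, .and A B => .and (A.rename r) (B.rename r)
  | _, _, r, .or A B => .or (A.rename r) (B.rename r)
  | _, _, r, .imp A B => .imp (A.rename r) (B.rename r)
  | _, _, r, .all A => .all (A.rename (r.lift _))
  | _, _, r, .ex A => .ex (A.rename (r.lift _))

def Formula.subst : {Γ Δ : List Ty} → Sub Γ Δ → Formula Γ → Formula Δ
  | _, _, s, .eq t u => .eq (t.subst s) (u.subst s)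
  | _, _, s, .and A B => .and (A.subst s) (B.subst s)
  | _, _, s, .or A B => .or (A.subst s) (B.subst s)
  | _, _, s, .imp A B => .imp (A.subst s) (B.subst s)
  | _, _, s, .all A => .all (A.subst (s.lift _))
  | _, _, s, .ex A => .ex (A.subst (s.lift _))

def Formula.weak {Γ : List Ty} (τ : Ty) (A : Formula Γ) : Formula (τ :: Γ) :=
  A.rename (Ren.weak Γ τ)

def Formula.inst {Γ : List Ty} {τ : Ty} (A : Formula (τ :: Γ)) (a : Term Γ τ) : Formula Γ :=
  A.subst (Sub.cons a (fun _ v => .var v))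

def Formula.iff {Γ : List Ty} (A B : Formula Γ) : Formula Γ := (A ⟹ B) ⋏ (B ⟹ A)

/-- Σ-formulas: built from equations at sort `0` with `∧`, `∨` and `∃` over sort `0`. -/
def Formula.IsSigma : {Γ : List Ty} → Formula Γ → Prop
  | _, .eq _ _ => True
  | _, .and A B => A.IsSigma ∧ B.IsSigma
  | _, .or A B => A.IsSigma ∧ B.IsSigma
  | _, .imp _ _ => False
  | _, .all _ => False
  | _, .ex (σ := σ) A => σ = .nat ∧ A.IsSigma

/-- Closed Σ-formulas. -/
structure SigmaSentence where
  formula : Formula []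
  isSigma : formula.IsSigma

/-- The closed Σ-formula `S`, in an arbitrary context. -/
def SigmaSentence.inCtx (S : SigmaSentence) (Γ : List Ty) : Formula Γ :=
  S.formula.rename (Ren.empty Γ)

/-! ## Proof terms and the calculus with shift and reset -/

/-- Proof terms over free individual variables `Γ`. Proof variables are de Bruijn indices, bound
by `lam`, `shift`, both branches of `case` and the second argument of `exE`; individual variables
are bound by `allI` and by the second argument of `exE`. -/
inductive PTerm : List Ty → Type
  /-- the constant that proves an axiom -/
  | ax {Γ : List Ty} : Formula Γ → PTerm Γ
  | var {Γ : List Ty} : ℕ → PTerm Γ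
  | pair {Γ : List Ty} : PTerm Γ → PTerm Γ → PTerm Γ
  | fst {Γ : List Ty} : PTerm Γ → PTerm Γ
  | snd {Γ : List Ty} : PTerm Γ → PTerm Γ
  | inl {Γ : List Ty} : PTerm Γ → PTerm Γ
  | inr {Γ : List Ty} : PTerm Γ → PTerm Γ
  | case {Γ : List Ty} : PTerm Γ → PTerm Γ → PTerm Γ → PTerm Γ
  | lam {Γ : List Ty} : PTerm Γ → PTerm Γ
  | app {Γ : List Ty} : PTerm Γ → PTerm Γ → PTerm Γ
  | allI {Γ : List Ty} {σ : Ty} : PTerm (σ :: Γ) → PTerm Γ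
  | allE {Γ : List Ty} {σ : Ty} : PTerm Γ → Term Γ σ → PTerm Γ
  | exI {Γ : List Ty} {σ : Ty} : Term Γ σ → PTerm Γ → PTerm Γ
  /-- `exE p q` is: `dest p as (x, a) in q` -/
  | exE {Γ : List Ty} {σ : Ty} : PTerm Γ → PTerm (σ :: Γ) → PTerm Γ
  | reset {Γ : List Ty} : PTerm Γ → PTerm Γ
  | shift {Γ : List Ty} : PTerm Γ → PTerm Γ

/-- A set of axioms; open formulas stand for their universal closures. -/
abbrev Theory : Type := ∀ Γ : List Ty, Formula Γ → Prop

/-- `Derives T C d Δ p A`: the proof term `p` proves `A` from the hypotheses `Δ` and the axioms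
`T`. The marker `d` is `true` for the turnstile `⊢_S` and `false` for the plain turnstile `⊢`.
For `C = some S` this is the multi-sorted logic with delimited control for the closed
Σ-formula `S`; for `C = none` there is neither shift nor reset, and it is
minimal predicate logic. -/
inductive Derives (T : Theory) (C : Option SigmaSentence) :
    {Γ : List Ty} → Bool → List (Formula Γ) → PTerm Γ → Formula Γ → Prop
  | ax {Γ : List Ty} {d : Bool} {Δ : List (Formula Γ)} {A : Formula Γ} :
      T Γ A → Derives T C d Δ (.ax A) A
  | hyp {Γ : List Ty} {d : Bool} {Δ : List (Formula Γ)} {A : Formula Γ} {i : ℕ} :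
      Δ[i]? = some A → Derives T C d Δ (.var i) A
  | andI {Γ : List Ty} {d : Bool} {Δ : List (Formula Γ)} {A B : Formula Γ} {p q : PTerm Γ} :
      Derives T C d Δ p A → Derives T C d Δ q B → Derives T C d Δ (.pair p q) (A ⋏ B)
  | andE₁ {Γ : List Ty} {d : Bool} {Δ : List (Formula Γ)} {A B : Formula Γ} {p : PTerm Γ} :
      Derives T C d Δ p (A ⋏ B) → Derives T C d Δ (.fst p) A
  | andE₂ {Γ : List Ty} {d : Bool} {Δ : List (Formula Γ)} {A B : Formula Γ} {p : PTerm Γ} :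
      Derives T C d Δ p (A ⋏ B) → Derives T C d Δ (.snd p) B
  | orI₁ {Γ : List Ty} {d : Bool} {Δ : List (Formula Γ)} {A B : Formula Γ} {p : PTerm Γ} :
      Derives T C d Δ p A → Derives T C d Δ (.inl p) (A ⋎ B)
  | orI₂ {Γ : List Ty} {d : Bool} {Δ : List (Formula Γ)} {A B : Formula Γ} {p : PTerm Γ} :
      Derives T C d Δ p B → Derives T C d Δ (.inr p) (A ⋎ B)
  | orE {Γ : List Ty} {d : Bool} {Δ : List (Formula Γ)} {A B E : Formula Γ}
      {p q₁ q₂ : PTerm Γ} :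
      Derives T C d Δ p (A ⋎ B) → Derives T C d (A :: Δ) q₁ E → Derives T C d (B :: Δ) q₂ E →
        Derives T C d Δ (.case p q₁ q₂) E
  | impI {Γ : List Ty} {d : Bool} {Δ : List (Formula Γ)} {A B : Formula Γ} {p : PTerm Γ} :
      Derives T C d (A :: Δ) p B → Derives T C d Δ (.lam p) (A ⟹ B)
  | impE {Γ : List Ty} {d : Bool} {Δ : List (Formula Γ)} {A B : Formula Γ} {p q : PTerm Γ} :
      Derives T C d Δ p (A ⟹ B) → Derives T C d Δ q A → Derives T C d Δ (.app p q) B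
  | allI {Γ : List Ty} {d : Bool} {Δ : List (Formula Γ)} {σ : Ty} {A : Formula (σ :: Γ)}
      {p : PTerm (σ :: Γ)} :
      Derives T C d (Δ.map (Formula.weak σ)) p A → Derives T C d Δ (.allI p) (.all A)
  | allE {Γ : List Ty} {d : Bool} {Δ : List (Formula Γ)} {σ : Ty} {A : Formula (σ :: Γ)}
      {p : PTerm Γ} (t : Term Γ σ) :
      Derives T C d Δ p (.all A) → Derives T C d Δ (.allE p t) (A.inst t)
  | exI {Γ : List Ty} {d : Bool} {Δ : List (Formula Γ)} {σ : Ty} {A : Formula (σ :: Γ)}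
      {p : PTerm Γ} (t : Term Γ σ) :
      Derives T C d Δ p (A.inst t) → Derives T C d Δ (.exI t p) (.ex A)
  | exE {Γ : List Ty} {d : Bool} {Δ : List (Formula Γ)} {σ : Ty} {A : Formula (σ :: Γ)}
      {E : Formula Γ} {p : PTerm Γ} {q : PTerm (σ :: Γ)} :
      Derives T C d Δ p (.ex A) →
      Derives T C d (A :: Δ.map (Formula.weak σ)) q (E.weak σ) →
        Derives T C d Δ (.exE p q) E
  | reset {Γ : List Ty} {d : Bool} {Δ : List (Formula Γ)} {p : PTerm Γ} {S : SigmaSentence} :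
      C = some S → Derives T C true Δ p (S.inCtx Γ) → Derives T C d Δ (.reset p) (S.inCtx Γ)
  | shift {Γ : List Ty} {Δ : List (Formula Γ)} {A : Formula Γ} {p : PTerm Γ}
      {S : SigmaSentence} :
      C = some S → Derives T C true ((A ⟹ S.inCtx Γ) :: Δ) p (S.inCtx Γ) →
        Derives T C true Δ (.shift p) A

/-! ## The axioms -/

/-- The `i`-th most recent variables. -/
abbrev v0 {Γ : List Ty} {σ : Ty} : Term (σ :: Γ) σ := .var .z
abbrev v1 {Γ : List Ty} {σ a : Ty} : Term (a :: σ :: Γ) σ := .var (.s .z)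
abbrev v2 {Γ : List Ty} {σ a b : Ty} : Term (a :: b :: σ :: Γ) σ := .var (.s (.s .z))
abbrev v3 {Γ : List Ty} {σ a b c : Ty} : Term (a :: b :: c :: σ :: Γ) σ :=
  .var (.s (.s (.s .z)))
abbrev v4 {Γ : List Ty} {σ a b c d : Ty} : Term (a :: b :: c :: d :: σ :: Γ) σ :=
  .var (.s (.s (.s (.s .z))))
abbrev v5 {Γ : List Ty} {σ a b c d e : Ty} : Term (a :: b :: c :: d :: e :: σ :: Γ) σ :=
  .var (.s (.s (.s (.s (.s .z)))))
abbrev v6 {Γ : List Ty} {σ a b c d e f : Ty} : Term (a :: b :: c :: d :: e :: f :: σ :: Γ) σ :=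
  .var (.s (.s (.s (.s (.s (.s .z))))))

abbrev Term.one {Γ : List Ty} : Term Γ .nat := .succ ⬝ .zero

/-- The axioms of Heyting arithmetic in all finite types. -/
inductive HAω : Theory
  | refl {Γ : List Ty} (a : Term Γ .nat) : HAω Γ (a ≐ a)
  | symm {Γ : List Ty} (a b : Term Γ .nat) : HAω Γ (a ≐ b ⟹ b ≐ a)
  | trans {Γ : List Ty} (a b c : Term Γ .nat) : HAω Γ (a ≐ b ⟹ b ≐ c ⟹ a ≐ c)
  | succ {Γ : List Ty} (a b : Term Γ .nat) : HAω Γ (a ≐ b ⟹ .succ ⬝ a ≐ .succ ⬝ b)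
  | congr {Γ : List Ty} (t : Term (.nat :: Γ) .nat) (a b : Term Γ .nat) :
      HAω Γ (a ≐ b ⟹ t.inst a ≐ t.inst b)
  | combK {Γ : List Ty} {ρ τ : Ty} (t : Term (ρ :: Γ) .nat) (a : Term Γ ρ) (b : Term Γ τ) :
      HAω Γ (t.inst (.combK ρ τ ⬝ a ⬝ b) ≐ t.inst a)
  | combS {Γ : List Ty} {δ ρ τ : Ty} (t : Term (τ :: Γ) .nat) (a : Term Γ (δ ⇒ ρ ⇒ τ))
      (b : Term Γ (δ ⇒ ρ)) (c : Term Γ δ) :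
      HAω Γ (t.inst (.combS δ ρ τ ⬝ a ⬝ b ⬝ c) ≐ t.inst (a ⬝ c ⬝ (b ⬝ c)))
  | recZero {Γ : List Ty} {ρ : Ty} (t : Term (ρ :: Γ) .nat) (b : Term Γ ρ)
      (c : Term Γ (ρ ⇒ .nat ⇒ ρ)) :
      HAω Γ (t.inst (.recR ρ ⬝ .zero ⬝ b ⬝ c) ≐ t.inst b)
  | recSucc {Γ : List Ty} {ρ : Ty} (t : Term (ρ :: Γ) .nat) (a : Term Γ .nat) (b : Term Γ ρ)
      (c : Term Γ (ρ ⇒ .nat ⇒ ρ)) :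
      HAω Γ (t.inst (.recR ρ ⬝ (.succ ⬝ a) ⬝ b ⬝ c) ≐ t.inst (c ⬝ (.recR ρ ⬝ a ⬝ b ⬝ c) ⬝ a))
  | induction {Γ : List Ty} (A : Formula (.nat :: Γ)) :
      HAω Γ (A.inst .zero ⟹
        .all (A ⟹ A.subst (Sub.cons (.succ ⬝ v0) (fun _ v => .var (.s v)))) ⟹ .all A)

/-- `t` is a bit. -/
def isBit {Γ : List Ty} (t : Term Γ .nat) : Formula Γ := (t ≐ .zero) ⋎ (t ≐ .one)

/-- `t` is a function into the bits: `t` has type `0 → bool` (or `bool* → bool`). -/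
def isBitFun {Γ : List Ty} (t : Term Γ (.nat ⇒ .nat)) : Formula Γ :=
  .all (isBit (t.weak ⬝ v0))

/-- Unique choice from numbers to bits for `A(x, y)`; in `A` the variable `y` is the most recent
one and `x` is the next. The formula is
`∀ x, ∃! y ∈ bool, A(x, y) → ∃ φ : 0 → bool, ∀ x, A(x, φ x)`. -/
def uniqueChoice {Γ : List Ty} (A : Formula (.nat :: .nat :: Γ)) : Formula Γ :=
  .all (.ex (isBit v0 ⋏ A ⋏
      .all (isBit v0 ⟹ A.rename ((Ren.weak (.nat :: Γ) .nat).lift .nat) ⟹ v0 ≐ v1))) ⟹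
    .ex (σ := .nat ⇒ .nat) (isBitFun v0 ⋏
      .all (A.subst (Sub.cons (v1 ⬝ v0) (Sub.cons v0 (fun _ v => .var (.s (.s v)))))))

/-- Heyting arithmetic in all finite types with unique choice from numbers to bits. -/
inductive HAωAC : Theory
  | base {Γ : List Ty} {A : Formula Γ} : HAω Γ A → HAωAC Γ A
  | choice {Γ : List Ty} (A : Formula (.nat :: .nat :: Γ)) : HAωAC Γ (uniqueChoice A)

/-! ## Defined operations -/

/-- `t` without the most recent variable, if that variable does not occur in `t`. -/
def Term.strengthen {Γ : List Ty} {σ : Ty} : {τ : Ty} → Term (σ :: Γ) τ → Option (Term Γ τ)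
  | _, .var .z => none
  | _, .var (.s v) => some (.var v)
  | _, .zero => some .zero
  | _, .succ => some .succ
  | _, .combK ρ τ => some (.combK ρ τ)
  | _, .combS δ ρ τ => some (.combS δ ρ τ)
  | _, .recR ρ => some (.recR ρ)
  | _, .param => some .param
  | _, .app t u =>
    match t.strengthen, u.strengthen with
    | some t', some u' => some (.app t' u')
    | _, _ => none

/-- Lambda abstraction, by the usual translation into the combinators: `λ x. x` is `Σ Π Π`,
`λ x. t` is `Π t` if `x` does not occur in `t`, and otherwise `λ x. t u` is
`Σ (λ x. t) (λ x. u)`. -/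
def Term.lam {Γ : List Ty} {σ : Ty} : {τ : Ty} → Term (σ :: Γ) τ → Term Γ (σ ⇒ τ)
  | _, .var .z => .combS σ (σ ⇒ σ) σ ⬝ .combK σ (σ ⇒ σ) ⬝ .combK σ σ
  | _, .var (.s v) => .combK _ σ ⬝ .var v
  | _, .zero => .combK _ σ ⬝ .zero
  | _, .succ => .combK _ σ ⬝ .succ
  | _, .combK ρ τ => .combK _ σ ⬝ .combK ρ τ
  | _, .combS δ ρ τ => .combK _ σ ⬝ .combS δ ρ τ
  | _, .recR ρ => .combK _ σ ⬝ .recR ρ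
  | _, .param => .combK _ σ ⬝ .param
  | _, .app t u =>
    match (Term.app t u).strengthen with
    | some w => .combK _ σ ⬝ w
    | none => .combS σ _ _ ⬝ t.lam ⬝ u.lam

/-- `if c then y else z`, where `0` is false and every successor is true. -/
def ifT {Γ : List Ty} (c y z : Term Γ .nat) : Term Γ .nat :=
  .recR .nat ⬝ c ⬝ z ⬝ (.combK (.nat ⇒ .nat) .nat ⬝ (.combK .nat .nat ⬝ y))

section Operations

variable {Γ : List Ty}

/-- `n ↦ n - 1`, truncated -/
def predT : Term Γ (.nat ⇒ .nat) := .lam (.recR .nat ⬝ v0 ⬝ .zero ⬝ .lam (.lam v0))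

/-- `m, n ↦ m - n`, truncated -/
def monusT : Term Γ (.nat ⇒ .nat ⇒ .nat) :=
  .lam (.lam (.recR .nat ⬝ v0 ⬝ v1 ⬝ .lam (.lam (predT ⬝ v1))))

def addT : Term Γ (.nat ⇒ .nat ⇒ .nat) :=
  .lam (.lam (.recR .nat ⬝ v0 ⬝ v1 ⬝ .lam (.lam (.succ ⬝ v1))))

def mulT : Term Γ (.nat ⇒ .nat ⇒ .nat) :=
  .lam (.lam (.recR .nat ⬝ v0 ⬝ .zero ⬝ .lam (.lam (addT ⬝ v1 ⬝ v3))))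

/-- `min m n = m - (m - n)` -/
def minT : Term Γ (.nat ⇒ .nat ⇒ .nat) := .lam (.lam (monusT ⬝ v1 ⬝ (monusT ⬝ v1 ⬝ v0)))

/-- `|m - n|` -/
def distT : Term Γ (.nat ⇒ .nat ⇒ .nat) :=
  .lam (.lam (addT ⬝ (monusT ⬝ v1 ⬝ v0) ⬝ (monusT ⬝ v0 ⬝ v1)))

/-- the remainder of `n` modulo `2` -/
def parityT : Term Γ (.nat ⇒ .nat) :=
  .lam (.recR .nat ⬝ v0 ⬝ .zero ⬝ .lam (.lam (monusT ⬝ .one ⬝ v1)))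

/-- `n ↦ ⌊n / 2⌋` -/
def halfT : Term Γ (.nat ⇒ .nat) :=
  .lam (.recR .nat ⬝ v0 ⬝ .zero ⬝ .lam (.lam (addT ⬝ v1 ⬝ (parityT ⬝ v0))))

/-! Bit-strings are coded bijectively by the natural numbers: `0` codes the empty string and
`2p + 1 + b` codes `p * ⟨b⟩`. -/

abbrev nilT : Term Γ .nat := .zero

/-- `p, b ↦ p * ⟨b⟩` -/
def snocT : Term Γ (.nat ⇒ .nat ⇒ .nat) := .lam (.lam (.succ ⬝ (addT ⬝ (addT ⬝ v1 ⬝ v1) ⬝ v0)))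

/-- `p * ⟨b⟩ ↦ p` -/
def initT : Term Γ (.nat ⇒ .nat) := .lam (halfT ⬝ (predT ⬝ v0))

/-- `p * ⟨b⟩ ↦ b` -/
def lastT : Term Γ (.nat ⇒ .nat) := .lam (parityT ⬝ (predT ⬝ v0))

/-- Recursion along a bit-string: `fold b f ⟨⟩ = b` and
`fold b f (p * ⟨c⟩) = f (fold b f p) c`. The code of the string is used as a bound for the depth
of the recursion. -/
def foldT : Term Γ (.nat ⇒ (.nat ⇒ .nat ⇒ .nat) ⇒ .nat ⇒ .nat) :=
  .lam (.lam (.lam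
    (.recR (.nat ⇒ .nat) ⬝ v0 ⬝ .lam v3 ⬝
      .lam (.lam (.lam (ifT v0 (v4 ⬝ (v2 ⬝ (initT ⬝ v0)) ⬝ (lastT ⬝ v0)) v5))) ⬝ v0)))

/-- the length of a bit-string -/
def lenT : Term Γ (.nat ⇒ .nat) := foldT ⬝ .zero ⬝ .lam (.lam (.succ ⬝ v1))

/-- `p, q ↦ p * q` -/
def concatT : Term Γ (.nat ⇒ .nat ⇒ .nat) := .lam (foldT ⬝ v0 ⬝ snocT)

/-- `p, n ↦` the initial segment of length `n` of `p`; it is `p` when `n` exceeds the length. -/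
def prefixT : Term Γ (.nat ⇒ .nat ⇒ .nat) :=
  .lam (.lam (foldT ⬝ nilT ⬝
    .lam (.lam (ifT (monusT ⬝ v2 ⬝ (lenT ⬝ v1)) (snocT ⬝ v1 ⬝ v0) v1)) ⬝ v1))

/-- `p, n ↦ p(n)`, the bit with index `n` of `p` -/
def nthT : Term Γ (.nat ⇒ .nat ⇒ .nat) := .lam (.lam (lastT ⬝ (prefixT ⬝ v1 ⬝ (.succ ⬝ v0))))

/-- `α, n ↦ ⟨α(0), …, α(n - 1)⟩` -/
def segT : Term Γ ((.nat ⇒ .nat) ⇒ .nat ⇒ .nat) :=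
  .lam (.lam (.recR .nat ⬝ v0 ⬝ nilT ⬝ .lam (.lam (snocT ⬝ v1 ⬝ (v3 ⬝ v0)))))

/-- `N, f ↦ ∑ i ≤ N, f i` -/
def sumT : Term Γ (.nat ⇒ (.nat ⇒ .nat) ⇒ .nat) :=
  .lam (.lam (.recR .nat ⬝ (.succ ⬝ v1) ⬝ .zero ⬝ .lam (.lam (addT ⬝ v1 ⬝ (v2 ⬝ v0)))))

/-- `N, f ↦ ∏ i ≤ N, f i` -/
def prodT : Term Γ (.nat ⇒ (.nat ⇒ .nat) ⇒ .nat) :=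
  .lam (.lam (.recR .nat ⬝ (.succ ⬝ v1) ⬝ .one ⬝ .lam (.lam (mulT ⬝ v1 ⬝ (v2 ⬝ v0)))))

/-- `coverT π x k N = 0` holds iff for all bit-strings `q` of length `k` there are `l, m ≤ N` such
that the initial segment of length `l` of `x * q` is `π m`. The bounded universal quantifier is a
sum over all codes `q` up to that of `⟨1, …, 1⟩` (of length `k`), weighted by `1 - |len q - k|`;
the bounded existential quantifiers are products. -/
def coverT : Term Γ ((.nat ⇒ .nat) ⇒ .nat ⇒ .nat ⇒ .nat ⇒ .nat) :=
  .lam (.lam (.lam (.lam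
    (sumT ⬝ (segT ⬝ (.combK .nat .nat ⬝ .one) ⬝ v1) ⬝
      .lam (mulT ⬝ (monusT ⬝ .one ⬝ (distT ⬝ (lenT ⬝ v0) ⬝ v2)) ⬝
        (prodT ⬝ v1 ⬝ .lam
          (prodT ⬝ v2 ⬝ .lam
            (distT ⬝ (prefixT ⬝ (concatT ⬝ v5 ⬝ v2) ⬝ v1) ⬝ (v6 ⬝ v0)))))))))

/-- For `χ : bool* → bool`, the bit-stream
`n ↦ R (n + 1) ⟨⟩ (z, n' ↦ z * ⟨if χ(z * ⟨0⟩) then (if χ(z * ⟨1⟩) then 0 else 1) else 0⟩) (n)`. -/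
def alphaT : Term Γ ((.nat ⇒ .nat) ⇒ .nat ⇒ .nat) :=
  .lam (.lam (nthT ⬝
    (.recR .nat ⬝ (.succ ⬝ v0) ⬝ nilT ⬝
      .lam (.lam (snocT ⬝ v1 ⬝
        ifT (v3 ⬝ (snocT ⬝ v1 ⬝ .zero)) (ifT (v3 ⬝ (snocT ⬝ v1 ⬝ .one)) .zero .one) .zero))) ⬝
    v0))

/-! ## Open Induction on Cantor space -/

/-- `α ∈ A`, for the open set `A` enumerated by the closed term `π`. -/
def memA (π : Term [] (.nat ⇒ .nat)) (α : Term Γ (.nat ⇒ .nat)) : Formula Γ :=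
  .ex (.ex (segT ⬝ α.weak.weak ⬝ v1 ≐ π.closed _ ⬝ v0))

/-- the lexicographic order `β < α` -/
def lexLt (β α : Term Γ (.nat ⇒ .nat)) : Formula Γ :=
  .ex (segT ⬝ β.weak ⬝ v0 ≐ segT ⬝ α.weak ⬝ v0 ⋏
    β.weak ⬝ v0 ≐ .zero ⋏ α.weak ⬝ v0 ≐ .one)

/-- `∀ α, (∀ β < α, β ∈ A) → α ∈ A`, over bit-streams -/
def progressive (π : Term [] (.nat ⇒ .nat)) : Formula Γ :=
  .all (σ := .nat ⇒ .nat) (isBitFun v0 ⟹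
    .all (σ := .nat ⇒ .nat) (isBitFun v0 ⟹ lexLt v0 v1 ⟹ memA π v0) ⟹ memA π v0)

/-- Open Induction on Cantor space, for the open set enumerated by `π`. -/
def openInduction (π : Term [] (.nat ⇒ .nat)) : Formula Γ :=
  progressive π ⟹ .all (σ := .nat ⇒ .nat) (isBitFun v0 ⟹ memA π v0)

/-- `B(x)` with the bounded quantifier written out:
`∃ k, ∀ q, len q = k → ∃ l m, (x * q restricted to length l) = π m`. -/
def memBUnfolded (π : Term [] (.nat ⇒ .nat)) (x : Term Γ .nat) : Formula Γ :=
  .ex (.all (lenT ⬝ v0 ≐ v1 ⟹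
    .ex (.ex (prefixT ⬝ (concatT ⬝ x.weak.weak.weak.weak ⬝ v2) ⬝ v1 ≐ π.closed _ ⬝ v0))))

/-- `x ∈ B` as a Σ-formula, with the bounded quantifier encoded. -/
def memB (π : Term [] (.nat ⇒ .nat)) (x : Term Γ .nat) : Formula Γ :=
  .ex (.ex (coverT ⬝ π.closed _ ⬝ x.weak.weak ⬝ v1 ⬝ v0 ≐ .zero))

end Operations

/-- The closed Σ-formula `⟨⟩ ∈ B`. -/
def nilMemB (π : Term [] (.nat ⇒ .nat)) : SigmaSentence where
  formula := memB π nilT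
  isSigma := ⟨rfl, rfl, trivial⟩

/-! ## The proof term -/

/-- `λ̃ x. shift k. k (ι₂ (λ a. k (ι₁ a)))` -/
def decideTerm {Γ : List Ty} : PTerm Γ :=
  .allI (σ := .nat)
    (.shift (.app (.var 0) (.inr (.lam (.app (.var 1) (.inl (.var 0)))))))

/-- `∀ x, x ∈ B ∨ (x ∈ B → ⟨⟩ ∈ B)` -/
def decidability {Γ : List Ty} (π : Term [] (.nat ⇒ .nat)) : Formula Γ :=
  .all (memB π v0 ⋎ (memB π v0 ⟹ (nilMemB π).inCtx _))

/-- `∃ χ : bool* → bool, ∀ x, (χ x = 1 → x ∈ B) ∧ (χ x = 0 → x ∈ B → ⟨⟩ ∈ B)` -/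
def characteristic {Γ : List Ty} (π : Term [] (.nat ⇒ .nat)) : Formula Γ :=
  .ex (σ := .nat ⇒ .nat) (isBitFun v0 ⋏
    .all ((v1 ⬝ v0 ≐ .one ⟹ memB π v0) ⋏
      (v1 ⬝ v0 ≐ .zero ⟹ memB π v0 ⟹ (nilMemB π).inCtx _)))

/-- The subterms that the outline of the proof term leaves open. Each is indexed by the sorts of
the individual variables in whose scope it stands. -/
structure Parts where
  /-- scope: `α'` -/
  aC : PTerm [.nat ⇒ .nat]
  /-- `α` is a bit-stream; scope: `χ, α'` -/
  eα : PTerm [.nat ⇒ .nat, .nat ⇒ .nat]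
  /-- scope: `n, β, χ, α'` -/
  a1 : PTerm [.nat, .nat ⇒ .nat, .nat ⇒ .nat, .nat ⇒ .nat]
  /-- scope: `k, n, β, χ, α'` -/
  p7 : PTerm [.nat, .nat, .nat ⇒ .nat, .nat ⇒ .nat, .nat ⇒ .nat]
  /-- scope: `j, k, n, β, χ, α'` -/
  p8 : PTerm [.nat, .nat, .nat, .nat ⇒ .nat, .nat ⇒ .nat, .nat ⇒ .nat]
  /-- scope of the next four: `m, l, χ, α'` -/
  aI : PTerm [.nat, .nat, .nat ⇒ .nat, .nat ⇒ .nat]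
  a0 : PTerm [.nat, .nat, .nat ⇒ .nat, .nat ⇒ .nat]
  a3 : PTerm [.nat, .nat, .nat ⇒ .nat, .nat ⇒ .nat]
  p10 : PTerm [.nat, .nat, .nat ⇒ .nat, .nat ⇒ .nat]
  /-- scope: `k', α'` -/
  p11 : PTerm [.nat, .nat ⇒ .nat]
  /-- scope: `j', k', α'` -/
  p12 : PTerm [.nat, .nat, .nat ⇒ .nat]

/-- The proof of `∀ β < α, β ∈ A` inside the proof term:
`λ̃ β. λ e'. λ h'. dest h' as (n, h'') in dest a₁ (π₂ (π₂ h'')) as (k, h''') in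
dest p₇ as (j, h⁴) in (min (n + k + 1) j, p₈)`, with `e'` a proof that `β` is a bit-stream. -/
def Parts.below (P : Parts) : PTerm [.nat ⇒ .nat, .nat ⇒ .nat] :=
  .allI (σ := .nat ⇒ .nat) (.lam (.lam
    (.exE (σ := .nat) (.var 0)
      (.exE (σ := .nat) (.app P.a1 (.snd (.snd (.var 0))))
        (.exE (σ := .nat) P.p7
          (.exI (minT ⬝ (.succ ⬝ (addT ⬝ v2 ⬝ v1)) ⬝ v0) P.p8))))))

/-- The proof term
`λ h. λ̃ α'. λ e. dest reset (dest a_C (λ̃ x. shift k. k (ι₂ (λ a. k (ι₁ a)))) as (χ, b) in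
dest h α e_α below as (l, c) in dest c as (m, d) in a_I a₀ a₃ l (0, p₁₀)) as (k', h⁵) in
dest p₁₁ as (j', h⁶) in (min k' j', p₁₂)`, with `e` a proof that `α'` is a bit-stream. -/
def Parts.term (P : Parts) : PTerm [] :=
  .lam (.allI (σ := .nat ⇒ .nat) (.lam
    (.exE (σ := .nat)
      (.reset
        (.exE (σ := .nat ⇒ .nat) (.app P.aC decideTerm)
          (.exE (σ := .nat)
            (.app (.app (.allE (.var 2) (alphaT ⬝ v0)) P.eα) P.below)
            (.exE (σ := .nat) (.var 0)
              (.app (.allE (.app (.app P.aI P.a0) P.a3) v1)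
                (.exI (σ := .nat) .zero P.p10))))))
      (.exE (σ := .nat) P.p11
        (.exI (minT ⬝ v1 ⬝ v0) P.p12)))))

end OpenInd

/-! Write S for `⟨⟩ ∈ B`. Control proves `x ∈ B ∨ (x ∈ B → S)` for all x, and unique choice turns
this into a function χ into the bits. The uniqueness premise holds because two different admissible
bits yield S, and under the marked turnstile a shift that discards its continuation derives anything
from S. The stream α built from χ takes the bit 1 after a string z exactly when χ accepts `z * ⟨0⟩`
and rejects `z * ⟨1⟩`. If β < α branches off at n, then the first n bits of α followed by 0 are in
B, so β ∈ A. Progressiveness then gives α ∈ A, so some initial segment of α is in B. Walking back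
along α, membership of a segment in B gives S at once if χ rejected that segment; otherwise χ
accepted both children of the previous segment, which is then in B itself. Induction yields S, reset
carries S to the unmarked turnstile, and S covers every stream, in particular α'.

Only control, choice and the skeleton of the proof term need explicit derivations:
`derives_decideTerm`, `derives_collapse`, `derives_below`, `derives_nilMemB`. Everything else is a
consequence in Heyting arithmetic without control whose proof term is irrelevant, and `Prv` records
only its existence. Such provability is obtained semantically. By a Lindenbaum argument
(`exists_world`, `prv_of_worlds`), a formula is provable from hypotheses once it belongs to every
consistent prime theory containing them. These worlds behave like a canonical Kripke model:
implications and universal statements are checked in larger worlds (`imp_intro`, `all_intro`), and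
existential witnesses become fresh variables (`ex_elim`). Minimal logic suffices because 0 = 1
proves every formula.

The terms of a world, modulo equality in all contexts, form a combinatory algebra with decidable
equality of numbers. Quantifier-free formulas therefore belong to a world iff they are classically
true in it (`F_subst_iff`), and the numbers form an ordered semiring to which the usual algebra
applies. Properties of coded strings follow by quantifier-free induction. The key ones are
`coverBody_eq_zero_iff`, `cover_of_cover_snoc` for passing from both children to their parent, and
the collection of bounds in `coverUpTo_of_unfoldedAt`, which gives the first claim. -/

namespace OpenInd

/-! ## Substitution -/

section Substitution

variable {Γ Δ Θ : List Ty} {σ τ : Ty}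

abbrev Sub.id (Γ : List Ty) : Sub Γ Γ := fun _ v => .var v

abbrev Sub.comp (s : Sub Γ Δ) (s' : Sub Δ Θ) : Sub Γ Θ := fun _ v => (s _ v).subst s'

abbrev Ren.toSub (r : Ren Γ Δ) : Sub Γ Δ := fun _ v => .var (r _ v)

theorem Term.rename_eq_subst (r : Ren Γ Δ) (t : Term Γ σ) : t.rename r = t.subst r.toSub := by
  induction t <;> simp_all [Term.rename, Term.subst]

theorem Term.subst_subst (s : Sub Γ Δ) (s' : Sub Δ Θ) (t : Term Γ σ) :
    (t.subst s).subst s' = t.subst (s.comp s') := by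
  induction t <;> simp_all [Term.subst]

@[simp] theorem Term.subst_id (t : Term Γ σ) : t.subst (Sub.id Γ) = t := by
  induction t <;> simp_all [Term.subst]

@[simp] theorem Sub.lift_id : (Sub.id Γ).lift τ = Sub.id (τ :: Γ) := by
  funext _ v
  cases v <;> rfl

theorem Ren.toSub_lift (r : Ren Γ Δ) : r.toSub.lift τ = (r.lift τ).toSub := by
  funext _ v
  cases v <;> rfl

theorem Term.weak_eq_subst (t : Term Γ σ) : (t.weak : Term (τ :: Γ) σ) = t.subst fun _ v => .var (.s v) :=
  t.rename_eq_subst _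

theorem Term.weak_subst_lift (s : Sub Γ Δ) (t : Term Γ σ) :
    (t.weak : Term (τ :: Γ) σ).subst (s.lift τ) = (t.subst s).weak := by
  simp only [Term.weak_eq_subst, Term.subst_subst]
  congr 1
  funext _ v
  exact Term.weak_eq_subst _

@[simp] theorem Term.weak_subst_cons (a : Term Δ τ) (s : Sub Γ Δ) (t : Term Γ σ) :
    t.weak.subst (Sub.cons a s) = t.subst s := by
  rw [Term.weak_eq_subst, Term.subst_subst]
  rfl

theorem Sub.lift_comp_lift (s : Sub Γ Δ) (s' : Sub Δ Θ) :
    (s.lift τ).comp (s'.lift τ) = (s.comp s').lift τ := by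
  funext _ v
  cases v with
  | z => rfl
  | s v => exact Term.weak_subst_lift s' (s _ v)

theorem Sub.lift_comp_cons (s : Sub Γ Δ) (a : Term Θ τ) (s' : Sub Δ Θ) :
    (s.lift τ).comp (Sub.cons a s') = Sub.cons a (s.comp s') := by
  funext _ v
  cases v with
  | z => rfl
  | s v => exact Term.weak_subst_cons a s' (s _ v)

theorem Sub.cons_comp (a : Term Δ τ) (s : Sub Γ Δ) (s' : Sub Δ Θ) :
    (Sub.cons a s).comp s' = Sub.cons (a.subst s') (s.comp s') := by
  funext _ v
  cases v <;> rfl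

theorem Formula.rename_eq_subst (r : Ren Γ Δ) (A : Formula Γ) : A.rename r = A.subst r.toSub := by
  induction A generalizing Δ <;>
    simp_all [Formula.rename, Formula.subst, Term.rename_eq_subst, Ren.toSub_lift]

theorem Formula.subst_subst (s : Sub Γ Δ) (s' : Sub Δ Θ) (A : Formula Γ) :
    (A.subst s).subst s' = A.subst (s.comp s') := by
  induction A generalizing Δ Θ <;>
    simp_all [Formula.subst, Term.subst_subst, Sub.lift_comp_lift]

@[simp] theorem Formula.subst_id (A : Formula Γ) : A.subst (Sub.id Γ) = A := by
  induction A <;> simp_all [Formula.subst]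

theorem Formula.weak_eq_subst (A : Formula Γ) : A.weak τ = A.subst fun _ v => .var (.s v) :=
  A.rename_eq_subst _

@[simp] theorem Formula.weak_subst_cons (a : Term Δ τ) (s : Sub Γ Δ) (A : Formula Γ) :
    (A.weak τ).subst (Sub.cons a s) = A.subst s := by
  rw [Formula.weak_eq_subst, Formula.subst_subst]
  rfl

theorem Formula.subst_lift_inst (s : Sub Γ Δ) (A : Formula (τ :: Γ)) (a : Term Δ τ) :
    (A.subst (s.lift τ)).inst a = A.subst (Sub.cons a s) := by
  rw [Formula.inst, Formula.subst_subst, Sub.lift_comp_cons]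
  congr 1
  funext _ v
  cases v <;> simp [Sub.cons, Sub.comp]

/-- A closed term is unchanged by substitution. -/
@[simp] theorem Term.closed_subst (t : Term [] σ) (s : Sub Γ Δ) : (t.closed Γ).subst s = t.closed Δ := by
  simp only [Term.closed, Term.rename_eq_subst, Term.subst_subst]
  congr 1
  funext _ v
  cases v

@[simp] theorem Term.closed_rename (t : Term [] σ) (r : Ren Γ Δ) :
    (t.closed Γ).rename r = t.closed Δ := by
  rw [Term.rename_eq_subst, Term.closed_subst]

/-- `Term.lam` branches on the occurrence of the bound variable. A lifted substitution neither
creates nor removes such occurrences, since it replaces the other variables by weakened terms. -/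
theorem Term.strengthen_subst (s : Sub Γ Δ) (t : Term (τ :: Γ) σ) :
    (t.subst (s.lift τ)).strengthen = t.strengthen.map (Term.subst s) := by
  have hw : ∀ {Γ : List Ty} {σ τ : Ty} (u : Term Γ σ),
      (u.weak : Term (τ :: Γ) σ).strengthen = some u := by
    intro Γ σ τ u
    induction u <;> simp_all [Term.weak, Term.rename, Term.strengthen, Ren.weak]
  induction t with
  | var v =>
    cases v with
    | z => rfl
    | s v => simpa [Term.subst, Sub.lift, Term.strengthen] using hw (s _ v)
  | app t u ht hu =>
    simp only [Term.subst, Term.strengthen]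
    rw [ht, hu]
    cases t.strengthen <;> cases u.strengthen <;> rfl
  | _ => rfl

/-- This is a syntactic identity. A weakened term abstracts to `Π u` because of the clause for an
absent variable, which settles the case of a variable that is replaced by a compound term. -/
theorem Term.lam_subst (s : Sub Γ Δ) (t : Term (τ :: Γ) σ) :
    t.lam.subst s = (t.subst (s.lift τ)).lam := by
  have hw : ∀ {Γ : List Ty} {σ τ : Ty} (u : Term Γ σ),
      (u.weak : Term (τ :: Γ) σ).lam = .combK σ τ ⬝ u := by
    intro Γ σ τ u
    induction u with
    | app t u ht hu =>
      have hw : ∀ {Γ : List Ty} {σ τ : Ty} (u : Term Γ σ),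
          (u.weak : Term (τ :: Γ) σ).strengthen = some u := by
        intro Γ σ τ u
        induction u <;> simp_all [Term.weak, Term.rename, Term.strengthen, Ren.weak]
      have := hw (τ := τ) (t ⬝ u)
      simp only [Term.weak, Term.rename] at this
      simp only [Term.weak, Term.rename, Term.lam]
      rw [this]
    | _ => rfl
  induction t with
  | var v =>
    cases v with
    | z => rfl
    | s v => simpa [Term.subst, Sub.lift, Term.lam] using (hw (s _ v)).symm
  | app t u ht hu =>
    have := Term.strengthen_subst s (t ⬝ u)
    simp only [Term.subst] at this
    simp only [Term.subst, Term.lam]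
    rw [this]
    cases h : (t ⬝ u).strengthen with
    | none => simp [Term.subst, ht, hu]
    | some w => simp [Term.subst]
  | _ => rfl

end Substitution

/-! ## Derivability without control -/

theorem Derives.weaken {T : Theory} {C : Option SigmaSentence} {Γ : List Ty} {d : Bool}
    {Δ Δ' : List (Formula Γ)} {p : PTerm Γ} {A : Formula Γ} (h : Derives T C d Δ p A)
    (hs : Δ ⊆ Δ') : ∃ p', Derives T C d Δ' p' A := by
  induction h with
  | ax h => exact ⟨_, .ax h⟩
  | hyp h =>
    obtain ⟨i, hi⟩ := List.mem_iff_getElem?.1 (hs (List.mem_of_getElem? h))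
    exact ⟨_, .hyp hi⟩
  | andI _ _ h₁ h₂ => exact ⟨_, .andI (h₁ hs).choose_spec (h₂ hs).choose_spec⟩
  | andE₁ _ h => exact ⟨_, .andE₁ (h hs).choose_spec⟩
  | andE₂ _ h => exact ⟨_, .andE₂ (h hs).choose_spec⟩
  | orI₁ _ h => exact ⟨_, .orI₁ (h hs).choose_spec⟩
  | orI₂ _ h => exact ⟨_, .orI₂ (h hs).choose_spec⟩
  | orE _ _ _ h h₁ h₂ =>
    exact ⟨_, .orE (h hs).choose_spec (h₁ (List.cons_subset_cons _ hs)).choose_spec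
      (h₂ (List.cons_subset_cons _ hs)).choose_spec⟩
  | impI _ h => exact ⟨_, .impI (h (List.cons_subset_cons _ hs)).choose_spec⟩
  | impE _ _ h₁ h₂ => exact ⟨_, .impE (h₁ hs).choose_spec (h₂ hs).choose_spec⟩
  | allI _ h => exact ⟨_, .allI (h (List.map_subset _ hs)).choose_spec⟩
  | allE t _ h => exact ⟨_, .allE t (h hs).choose_spec⟩
  | exI t _ h => exact ⟨_, .exI t (h hs).choose_spec⟩
  | exE _ _ h₁ h₂ =>
    exact ⟨_, .exE (h₁ hs).choose_spec
      (h₂ (List.cons_subset_cons _ (List.map_subset _ hs))).choose_spec⟩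
  | reset e _ h => exact ⟨_, .reset e (h hs).choose_spec⟩
  | shift e _ h => exact ⟨_, .shift e (h (List.cons_subset_cons _ hs)).choose_spec⟩

/-- Derivations without control can be used with any control formula, marker and larger theory. -/
theorem Derives.mono {T T' : Theory} (hT : ∀ Γ A, T Γ A → T' Γ A) (C : Option SigmaSentence)
    (d' : Bool) {Γ : List Ty} {d : Bool} {Δ : List (Formula Γ)} {p : PTerm Γ} {A : Formula Γ}
    (h : Derives T none d Δ p A) : Derives T' C d' Δ p A := by
  induction h with
  | ax h => exact .ax (hT _ _ h)
  | hyp h => exact .hyp h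
  | andI _ _ h₁ h₂ => exact .andI h₁ h₂
  | andE₁ _ h => exact .andE₁ h
  | andE₂ _ h => exact .andE₂ h
  | orI₁ _ h => exact .orI₁ h
  | orI₂ _ h => exact .orI₂ h
  | orE _ _ _ h h₁ h₂ => exact .orE h h₁ h₂
  | impI _ h => exact .impI h
  | impE _ _ h₁ h₂ => exact .impE h₁ h₂
  | allI _ h => exact .allI h
  | allE t _ h => exact .allE t h
  | exI t _ h => exact .exI t h
  | exE _ _ h₁ h₂ => exact .exE h₁ h₂
  | reset e => cases e
  | shift e => cases e

/-- Derivability in Heyting arithmetic of finite types. -/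
def Prv {Γ : List Ty} (Δ : List (Formula Γ)) (A : Formula Γ) : Prop :=
  ∃ p, Derives HAω none false Δ p A

/-- A closed term of each sort. -/
def Ty.default : (σ : Ty) → Term [] σ
  | .nat => .zero
  | .arr _ τ => .combK _ _ ⬝ τ.default

namespace Prv

variable {Γ : List Ty} {Δ Δ' : List (Formula Γ)} {A B E : Formula Γ} {σ : Ty}

theorem mono (h : Prv Δ A) (hs : Δ ⊆ Δ') : Prv Δ' A := h.choose_spec.weaken hs
theorem ax (h : HAω Γ A) : Prv Δ A := ⟨_, .ax h⟩
theorem hyp (h : A ∈ Δ) : Prv Δ A :=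
  let ⟨_, hi⟩ := List.mem_iff_getElem?.1 h
  ⟨_, .hyp hi⟩
theorem head : Prv (A :: Δ) A := hyp List.mem_cons_self
theorem andI (h₁ : Prv Δ A) (h₂ : Prv Δ B) : Prv Δ (A ⋏ B) :=
  ⟨_, .andI h₁.choose_spec h₂.choose_spec⟩
theorem andE₁ (h : Prv Δ (A ⋏ B)) : Prv Δ A := ⟨_, .andE₁ h.choose_spec⟩
theorem andE₂ (h : Prv Δ (A ⋏ B)) : Prv Δ B := ⟨_, .andE₂ h.choose_spec⟩
theorem orI₁ (h : Prv Δ A) : Prv Δ (A ⋎ B) := ⟨_, .orI₁ h.choose_spec⟩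
theorem orI₂ (h : Prv Δ B) : Prv Δ (A ⋎ B) := ⟨_, .orI₂ h.choose_spec⟩
theorem orE (h : Prv Δ (A ⋎ B)) (h₁ : Prv (A :: Δ) E) (h₂ : Prv (B :: Δ) E) : Prv Δ E :=
  ⟨_, .orE h.choose_spec h₁.choose_spec h₂.choose_spec⟩
theorem impI (h : Prv (A :: Δ) B) : Prv Δ (A ⟹ B) := ⟨_, .impI h.choose_spec⟩
theorem impE (h : Prv Δ (A ⟹ B)) (h' : Prv Δ A) : Prv Δ B :=
  ⟨_, .impE h.choose_spec h'.choose_spec⟩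
theorem cut (h : Prv Δ A) (h' : Prv (A :: Δ) B) : Prv Δ B := h'.impI.impE h
theorem allI {A : Formula (σ :: Γ)} (h : Prv (Δ.map (Formula.weak σ)) A) : Prv Δ (.all A) :=
  ⟨_, .allI h.choose_spec⟩
theorem allE {A : Formula (σ :: Γ)} (h : Prv Δ (.all A)) (t : Term Γ σ) : Prv Δ (A.inst t) :=
  ⟨_, .allE t h.choose_spec⟩
theorem exI {A : Formula (σ :: Γ)} (t : Term Γ σ) (h : Prv Δ (A.inst t)) : Prv Δ (.ex A) :=
  ⟨_, .exI t h.choose_spec⟩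
theorem exE {A : Formula (σ :: Γ)} (h : Prv Δ (.ex A))
    (h' : Prv (A :: Δ.map (Formula.weak σ)) (E.weak σ)) : Prv Δ E :=
  ⟨_, .exE h.choose_spec h'.choose_spec⟩

theorem trans {a b c : Term Γ .nat} (h : Prv Δ (a ≐ b)) (h' : Prv Δ (b ≐ c)) : Prv Δ (a ≐ c) :=
  ((ax (.trans a b c)).impE h).impE h'

theorem symm {a b : Term Γ .nat} (h : Prv Δ (a ≐ b)) : Prv Δ (b ≐ a) := (ax (.symm a b)).impE h

/-- If `0 = 1`, then all formulas are provable. -/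
theorem efq_of_mem (h : (.zero ≐ .one) ∈ Δ) : Prv Δ A := by
  induction A with
  | @eq Γ a b =>
    -- The context `R x a (Π (Π b))` has the value a at 0 and b at 1.
    have h₁ := (ax (.congr (.recR .nat ⬝ v0 ⬝ a.weak ⬝ (.combK _ _ ⬝ (.combK _ _ ⬝ b.weak)))
      .zero .one)).impE (hyp h)
    have h₂ := ax (Δ := Δ) (.recZero v0 a (.combK _ .nat ⬝ (.combK _ .nat ⬝ b)))
    have h₃ := ax (Δ := Δ) (.recSucc v0 .zero a (.combK _ .nat ⬝ (.combK _ .nat ⬝ b)))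
    have h₄ := ax (Δ := Δ) (.combK (v0 ⬝ Term.zero) (.combK .nat .nat ⬝ b)
      (.recR .nat ⬝ .zero ⬝ a ⬝ (.combK _ .nat ⬝ (.combK _ .nat ⬝ b))))
    have h₅ := ax (Δ := Δ) (.combK v0 b (.zero : Term Γ .nat))
    simp only [Term.inst, Term.subst, Term.weak_subst_cons, Sub.cons, Term.subst_id] at h₁ h₂ h₃ h₄ h₅
    exact h₂.symm.trans (h₁.trans (h₃.trans (h₄.trans h₅)))
  | and _ _ hA hB => exact andI (hA h) (hB h)
  | or _ _ hA _ => exact orI₁ (hA h)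
  | imp _ _ _ hB => exact impI (hB (List.mem_cons_of_mem _ h))
  | all _ hA => exact allI (hA (List.mem_map_of_mem (f := Formula.weak _) h))
  | @ex Γ σ A hA =>
    -- The induction hypothesis speaks of `A` with its variable free, not of an instance; it is
    -- generalized and then instantiated by a closed term, so every sort has to be inhabited.
    have h' := (impI (Δ := Δ.map (Formula.weak σ)) (A := .zero ≐ .one)
      (hA List.mem_cons_self)).allI.allE (Term.closed (Ty.default σ) Γ)
    exact exI _ (h'.impE (hyp h))

theorem efq (h : Prv Δ (.zero ≐ .one)) : Prv Δ A := h.cut (efq_of_mem List.mem_cons_self)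

end Prv

/-! ## Worlds: prime theories -/

/-- A consistent prime theory of Heyting arithmetic, in the individual variables `Γ`. -/
structure World (Γ : List Ty) where
  F : Formula Γ → Prop
  ded : ∀ {Δ : List (Formula Γ)} {A : Formula Γ}, Prv Δ A → (∀ B ∈ Δ, F B) → F A
  prime : ∀ {A B : Formula Γ}, F (A ⋎ B) → F A ∨ F B
  consistent : ¬ F (.zero ≐ .one)

section Existence

variable {Γ : List Ty}

/-- Contraction: all uses of `B` are merged into one hypothesis, and the others come from `G`. -/
theorem Prv.exists_insert {G : Set (Formula Γ)} {A B : Formula Γ} {Δ : List (Formula Γ)}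
    (hΔ : ∀ C ∈ Δ, C ∈ insert B G) (h : Prv Δ A) : ∃ Δ', (∀ C ∈ Δ', C ∈ G) ∧ Prv (B :: Δ') A := by
  classical
  refine ⟨Δ.filter (· ≠ B), fun C hC => ?_, h.mono fun C hC => ?_⟩
  · simp only [ne_eq, decide_not, List.mem_filter, Bool.not_eq_eq_eq_not, Bool.not_true,
      decide_eq_false_iff_not] at hC
    exact (hΔ C hC.1).resolve_left hC.2
  · by_cases hB : C = B
    · simp [hB]
    · simp [hB, hC]

/-- Lindenbaum's lemma: a maximal set that does not prove `A` is deductively closed and prime. It is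
consistent because 0 = 1 would prove `A`. -/
theorem exists_world (G : Set (Formula Γ)) (A : Formula Γ)
    (h : ∀ Δ : List (Formula Γ), (∀ B ∈ Δ, B ∈ G) → ¬ Prv Δ A) :
    ∃ w : World Γ, (∀ B ∈ G, w.F B) ∧ ¬ w.F A := by
  obtain ⟨m, hGm, hm⟩ := zorn_subset_nonempty
    {X : Set (Formula Γ) | ∀ Δ : List (Formula Γ), (∀ B ∈ Δ, B ∈ X) → ¬ Prv Δ A} (by
      intro c hc hchain hne
      refine ⟨⋃₀ c, fun Δ hΔ => ?_, fun s => Set.subset_sUnion_of_mem⟩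
      -- Derivations use finitely many hypotheses, so in a chain these lie in a single member.
      have : ∃ X ∈ c, ∀ B ∈ Δ, B ∈ X := by
        induction Δ with
        | nil => exact ⟨_, hne.some_mem, by simp⟩
        | cons B Δ ih =>
          obtain ⟨X, hX, hXΔ⟩ := ih fun C hC => hΔ C (List.mem_cons_of_mem _ hC)
          obtain ⟨Y, hY, hYB⟩ := hΔ B List.mem_cons_self
          rcases hchain.total hX hY with hXY | hXY
          · exact ⟨Y, hY, List.forall_mem_cons.2 ⟨hYB, fun C hC => hXY (hXΔ C hC)⟩⟩
          · exact ⟨X, hX, List.forall_mem_cons.2 ⟨hXY hYB, hXΔ⟩⟩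
      obtain ⟨X, hX, hXΔ⟩ := this
      exact hc hX Δ hXΔ) G h
  -- Maximality: anything outside m, together with finitely many members of m, proves `A`.
  have key : ∀ B, B ∉ m → ∃ Δ, (∀ C ∈ Δ, C ∈ m) ∧ Prv (B :: Δ) A := by
    intro B hB
    by_contra hcon
    refine hB (hm.le_of_ge (y := insert B m) (fun Δ hΔ hA => ?_) (Set.subset_insert _ _)
      (Set.mem_insert _ _))
    exact hcon (hA.exists_insert hΔ)
  have hA : A ∉ m := fun hA => hm.prop [A] (by simpa using hA) .head
  have ded : ∀ {Δ : List (Formula Γ)} {B : Formula Γ}, Prv Δ B → (∀ C ∈ Δ, C ∈ m) → B ∈ m := by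
    intro Δ B hB hΔ
    by_contra hBm
    obtain ⟨Δ', hΔ', hA'⟩ := key B hBm
    refine hm.prop (Δ ++ Δ') (fun C hC => (List.mem_append.1 hC).elim (hΔ C) (hΔ' C)) ?_
    exact (hB.mono (List.subset_append_left _ _)).cut
      (hA'.mono (List.cons_subset_cons _ (List.subset_append_right _ _)))
  refine ⟨⟨(· ∈ m), ded, ?_, ?_⟩, fun B hB => hGm hB, hA⟩
  · intro B C hBC
    by_contra hcon
    rw [not_or] at hcon
    obtain ⟨Δ₁, h₁, hB⟩ := key B hcon.1
    obtain ⟨Δ₂, h₂, hC⟩ := key C hcon.2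
    refine hm.prop ((B ⋎ C) :: (Δ₁ ++ Δ₂))
      (List.forall_mem_cons.2 ⟨hBC, fun D hD => (List.mem_append.1 hD).elim (h₁ D) (h₂ D)⟩) ?_
    refine Prv.head.orE (hB.mono (List.cons_subset_cons _ ?_)) (hC.mono (List.cons_subset_cons _ ?_))
    · exact List.subset_cons_of_subset _ (List.subset_append_left _ _)
    · exact List.subset_cons_of_subset _ (List.subset_append_right _ _)
  · exact fun h0 => hA (ded (Δ := [_]) (Prv.efq .head) (by simpa using h0))

/-- Completeness with respect to worlds over the same variables. -/
theorem prv_of_worlds {Δ : List (Formula Γ)} {A : Formula Γ}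
    (h : ∀ w : World Γ, (∀ B ∈ Δ, w.F B) → w.F A) : Prv Δ A := by
  by_contra hA
  obtain ⟨w, hw, hwA⟩ := exists_world {B | B ∈ Δ} A fun Δ' hΔ' hp => hA (hp.mono hΔ')
  exact hwA (h w hw)

end Existence

namespace World

variable {Γ : List Ty} (w : World Γ) {A B : Formula Γ} {σ τ : Ty}

theorem of_prv (h : Prv [] A) : w.F A := w.ded h (by simp)

theorem ded₁ (h : Prv [A] B) (hA : w.F A) : w.F B := w.ded h (by simpa using hA)

theorem ded₂ {E : Formula Γ} (h : Prv [A, B] E) (hA : w.F A) (hB : w.F B) : w.F E :=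
  w.ded h (by simpa using ⟨hA, hB⟩)

theorem and_iff : w.F (A ⋏ B) ↔ w.F A ∧ w.F B :=
  ⟨fun h => ⟨w.ded₁ Prv.head.andE₁ h, w.ded₁ Prv.head.andE₂ h⟩,
    fun h => w.ded₂ (.andI .head (.hyp (by simp))) h.1 h.2⟩

theorem or_iff : w.F (A ⋎ B) ↔ w.F A ∨ w.F B :=
  ⟨w.prime, fun h => h.elim (w.ded₁ (.orI₁ .head)) (w.ded₁ (.orI₂ .head))⟩

theorem mp (h : w.F (A ⟹ B)) (hA : w.F A) : w.F B :=
  w.ded₂ (.impE .head (.hyp (by simp))) h hA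

/-- The Kripke clause for implication: if `A ⟹ B` were missing, adding `A` would not prove `B`, and
some prime extension would omit `B`. -/
theorem imp_intro (h : ∀ w' : World Γ, (∀ C, w.F C → w'.F C) → w'.F A → w'.F B) :
    w.F (A ⟹ B) := by
  by_contra hcon
  obtain ⟨w', hw', hB⟩ := exists_world (insert A {C | w.F C}) B fun Δ hΔ hB => by
    obtain ⟨Δ', hΔ', hB'⟩ := hB.exists_insert hΔ
    exact hcon (w.ded hB'.impI hΔ')
  exact hB (h w' (fun C hC => hw' C (Or.inr hC)) (hw' A (Or.inl rfl)))

theorem inst {A : Formula (σ :: Γ)} (h : w.F (.all A)) (t : Term Γ σ) : w.F (A.inst t) :=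
  w.ded₁ (Prv.head.allE t) h

/-- The larger world has a fresh variable, which plays the role of the eigenvariable. -/
theorem all_intro {A : Formula (σ :: Γ)}
    (h : ∀ w' : World (σ :: Γ), (∀ C, w.F C → w'.F (C.weak σ)) → w'.F A) : w.F (.all A) := by
  by_contra hcon
  obtain ⟨w', hw', hA⟩ := exists_world (Formula.weak σ '' {C | w.F C}) A fun Δ hΔ hA => by
    obtain ⟨Δ', hΔ', rfl⟩ : ∃ Δ' : List (Formula Γ), (∀ C ∈ Δ', w.F C) ∧ Δ'.map (Formula.weak σ) = Δ := by
      clear hA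
      induction Δ with
      | nil => exact ⟨[], by simp, rfl⟩
      | cons B Δ ih =>
        obtain ⟨Δ', h₁, rfl⟩ := ih fun C hC => hΔ C (List.mem_cons_of_mem _ hC)
        obtain ⟨B', hB', rfl⟩ := hΔ B List.mem_cons_self
        exact ⟨B' :: Δ', List.forall_mem_cons.2 ⟨hB', h₁⟩, rfl⟩
    exact hcon (w.ded hA.allI hΔ')
  exact hA (h w' fun C hC => hw' _ ⟨C, hC, rfl⟩)

/-! ### The applicative structure of a world -/

/-- Terms are identified when they are equal in every context of sort `0`. -/
def setoid (σ : Ty) : Setoid (Term Γ σ) where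
  r a b := ∀ t : Term (σ :: Γ) .nat, w.F (t.inst a ≐ t.inst b)
  iseqv :=
    { refl := fun a t => w.of_prv (.ax (.refl _))
      symm := fun h t => w.ded₁ Prv.head.symm (h t)
      trans := fun h h' t => w.ded₂ (Prv.head.trans (.hyp (by simp))) (h t) (h' t) }

def M (σ : Ty) : Type := Quotient (w.setoid σ)

def cls (t : Term Γ σ) : w.M σ := Quotient.mk (w.setoid σ) t

theorem cls_surjective : Function.Surjective (w.cls (σ := σ)) := Quotient.mk_surjective

theorem cls_eq_iff {a b : Term Γ .nat} : w.cls a = w.cls b ↔ w.F (a ≐ b) := by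
  refine ⟨fun h => Quotient.exact h v0, fun h => Quotient.sound fun t => ?_⟩
  exact w.ded₁ ((Prv.ax (.congr t a b)).impE .head) h

def ap : w.M (σ ⇒ τ) → w.M σ → w.M τ :=
  Quotient.map₂ Term.app fun f g hfg a b hab t => by
    -- Function and argument are exchanged one at a time, absorbing the other into the context.
    have h₁ := hfg (t.subst (Sub.cons (v0 ⬝ a.weak) fun _ v => .var (.s v)))
    have h₂ := hab (t.subst (Sub.cons (g.weak ⬝ v0) fun _ v => .var (.s v)))
    simp only [Term.inst, Term.subst_subst, Sub.cons_comp, Term.subst, Term.weak_subst_cons,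
      Term.subst_id] at h₁ h₂
    exact w.ded₂ (A := t.inst (f ⬝ a) ≐ t.inst (g ⬝ a)) (B := t.inst (g ⬝ a) ≐ t.inst (g ⬝ b))
      (Prv.head.trans (.hyp (by simp))) h₁ h₂

@[simp] theorem cls_app (f : Term Γ (σ ⇒ τ)) (a : Term Γ σ) : w.cls (f ⬝ a) = w.ap (w.cls f) (w.cls a) :=
  (rfl)

-- The defining equations are axioms inside every context of sort 0, which is exactly equality of
-- classes.
@[simp] theorem ap_combK (a : w.M σ) (b : w.M τ) : w.ap (w.ap (w.cls (.combK σ τ)) a) b = a := by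
  obtain ⟨a, rfl⟩ := w.cls_surjective a
  obtain ⟨b, rfl⟩ := w.cls_surjective b
  exact Quotient.sound fun t => w.of_prv (.ax (.combK t a b))

@[simp] theorem ap_combS {ρ : Ty} (a : w.M (ρ ⇒ σ ⇒ τ)) (b : w.M (ρ ⇒ σ)) (c : w.M ρ) :
    w.ap (w.ap (w.ap (w.cls (.combS ρ σ τ)) a) b) c = w.ap (w.ap a c) (w.ap b c) := by
  obtain ⟨a, rfl⟩ := w.cls_surjective a
  obtain ⟨b, rfl⟩ := w.cls_surjective b
  obtain ⟨c, rfl⟩ := w.cls_surjective c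
  exact Quotient.sound fun t => w.of_prv (.ax (.combS t a b c))

instance : Zero (w.M .nat) := ⟨w.cls .zero⟩

def S (a : w.M .nat) : w.M .nat := w.ap (w.cls .succ) a

@[simp] theorem ap_succ (a : w.M .nat) : w.ap (w.cls .succ) a = w.S a := (rfl)

@[simp] theorem cls_zero : w.cls .zero = 0 := (rfl)

def R (n : w.M .nat) (b : w.M σ) (c : w.M (σ ⇒ .nat ⇒ σ)) : w.M σ :=
  w.ap (w.ap (w.ap (w.cls (.recR σ)) n) b) c

@[simp] theorem ap_recR (n : w.M .nat) (b : w.M σ) (c : w.M (σ ⇒ .nat ⇒ σ)) :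
    w.ap (w.ap (w.ap (w.cls (.recR σ)) n) b) c = w.R n b c := (rfl)

@[simp] theorem R_zero (b : w.M σ) (c : w.M (σ ⇒ .nat ⇒ σ)) : w.R 0 b c = b := by
  obtain ⟨b, rfl⟩ := w.cls_surjective b
  obtain ⟨c, rfl⟩ := w.cls_surjective c
  exact Quotient.sound fun t => w.of_prv (.ax (.recZero t b c))

@[simp] theorem R_succ (n : w.M .nat) (b : w.M σ) (c : w.M (σ ⇒ .nat ⇒ σ)) :
    w.R (w.S n) b c = w.ap (w.ap c (w.R n b c)) n := by
  obtain ⟨n, rfl⟩ := w.cls_surjective n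
  obtain ⟨b, rfl⟩ := w.cls_surjective b
  obtain ⟨c, rfl⟩ := w.cls_surjective c
  exact Quotient.sound fun t => w.of_prv (.ax (.recSucc t n b c))

/-! ### Evaluation -/

abbrev Env (Γ₀ : List Ty) : Type := ∀ σ : Ty, Var Γ₀ σ → w.M σ

variable {Γ₀ : List Ty}

def Env.nil : w.Env [] := fun _ v => nomatch v

variable {w} in
def Env.cons (a : w.M τ) (ρ : w.Env Γ₀) : w.Env (τ :: Γ₀)
  | _, .z => a
  | _, .s v => ρ _ v

def env (s : Sub Γ₀ Γ) : w.Env Γ₀ := fun _ v => w.cls (s _ v)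

variable {w} in
theorem Env.exists_sub (ρ : w.Env Γ₀) : ∃ s : Sub Γ₀ Γ, w.env s = ρ :=
  ⟨fun _ v => (w.cls_surjective (ρ _ v)).choose, by
    funext _ v
    exact (w.cls_surjective (ρ _ v)).choose_spec⟩

theorem env_cons (a : Term Γ τ) (s : Sub Γ₀ Γ) :
    w.env (Sub.cons a s) = Env.cons (w.cls a) (w.env s) := by
  funext _ v
  cases v <;> rfl

/-- Arbitrary representatives of the values are substituted; by `cls_subst` their choice is
immaterial. -/
noncomputable def eval (ρ : w.Env Γ₀) (t : Term Γ₀ σ) : w.M σ :=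
  w.cls (t.subst fun _ v => (ρ _ v).out)

theorem cls_out (a : w.M σ) : w.cls (Quotient.out a) = a := Quotient.out_eq _

variable (ρ : w.Env Γ₀)

@[simp] theorem eval_app (t : Term Γ₀ (σ ⇒ τ)) (u : Term Γ₀ σ) :
    w.eval ρ (t ⬝ u) = w.ap (w.eval ρ t) (w.eval ρ u) := (rfl)
@[simp] theorem eval_zero : w.eval ρ .zero = 0 := (rfl)
@[simp] theorem eval_succ : w.eval ρ .succ = w.cls .succ := (rfl)
@[simp] theorem eval_combK : w.eval ρ (.combK σ τ) = w.cls (.combK σ τ) := (rfl)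
@[simp] theorem eval_combS {δ : Ty} : w.eval ρ (.combS δ σ τ) = w.cls (.combS δ σ τ) := (rfl)
@[simp] theorem eval_recR : w.eval ρ (.recR σ) = w.cls (.recR σ) := (rfl)
@[simp] theorem eval_param : w.eval ρ .param = w.cls .param := (rfl)
theorem eval_var (v : Var Γ₀ σ) : w.eval ρ (.var v) = ρ _ v := w.cls_out _
@[simp] theorem eval_var_z (a : w.M τ) : w.eval (Env.cons a ρ) (.var .z) = a := w.eval_var _ _
@[simp] theorem eval_var_s (a : w.M τ) (v : Var Γ₀ σ) :
    w.eval (Env.cons a ρ) (.var (.s v)) = w.eval ρ (.var v) := by simp [eval_var, Env.cons]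

theorem cls_subst (s : Sub Γ₀ Γ) (t : Term Γ₀ σ) : w.cls (t.subst s) = w.eval (w.env s) t := by
  induction t with
  | var v => exact (w.eval_var (w.env s) v).symm
  | app t u ht hu => simp only [Term.subst, cls_app, eval_app, ht, hu]
  | _ => rfl

theorem eval_env_id (t : Term Γ σ) : w.eval (w.env (Sub.id Γ)) t = w.cls t := by
  rw [← cls_subst, Term.subst_id]

theorem eval_of_strengthen {t : Term (τ :: Γ₀) σ} {u : Term Γ₀ σ} (h : t.strengthen = some u)
    (a : w.M τ) : w.eval (Env.cons a ρ) t = w.eval ρ u := by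
  induction t with
  | var v =>
    cases v with
    | z => simp [Term.strengthen] at h
    | s v =>
      simp only [Term.strengthen, Option.some.injEq] at h
      simp [← h]
  | app t₁ t₂ h₁ h₂ =>
    simp only [Term.strengthen] at h
    split at h
    · next e₁ e₂ =>
      simp only [Option.some.injEq] at h
      simp [← h, h₁ e₁, h₂ e₂]
    · cases h
  | _ =>
    simp only [Term.strengthen, Option.some.injEq] at h
    simp [← h]

/-- The rule `β`. -/
@[simp] theorem ap_eval_lam (t : Term (τ :: Γ₀) σ) (a : w.M τ) :
    w.ap (w.eval ρ t.lam) a = w.eval (Env.cons a ρ) t := by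
  induction t with
  | var v =>
    cases v with
    | z => simp [Term.lam]
    | s v => simp [Term.lam]
  | app t₁ t₂ h₁ h₂ =>
    simp only [Term.lam]
    split
    · next u e => simp [w.eval_of_strengthen ρ e]
    · simp [h₁, h₂]
  | _ => simp [Term.lam]

end World

/-! ### Satisfaction of quantifier-free formulas -/

/-- Formulas without quantifiers. -/
def Formula.IsQF : {Γ : List Ty} → Formula Γ → Prop
  | _, .eq _ _ => True
  | _, .and A B => A.IsQF ∧ B.IsQF
  | _, .or A B => A.IsQF ∧ B.IsQF
  | _, .imp A B => A.IsQF ∧ B.IsQF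
  | _, .all _ => False
  | _, .ex _ => False

/-- Classical truth of a formula in a world. -/
def World.Sat {Γ : List Ty} (w : World Γ) : {Γ₀ : List Ty} → w.Env Γ₀ → Formula Γ₀ → Prop
  | _, ρ, .eq t u => w.eval ρ t = w.eval ρ u
  | _, ρ, .and A B => w.Sat ρ A ∧ w.Sat ρ B
  | _, ρ, .or A B => w.Sat ρ A ∨ w.Sat ρ B
  | _, ρ, .imp A B => w.Sat ρ A → w.Sat ρ B
  | _, ρ, .all A => ∀ a, w.Sat (World.Env.cons a ρ) A
  | _, ρ, .ex A => ∃ a, w.Sat (World.Env.cons a ρ) A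

namespace World

variable {Γ Γ₀ : List Ty}

abbrev _root_.OpenInd.Sub.empty (Γ : List Ty) : Sub [] Γ := fun _ v => nomatch v

/-! ### Induction in all worlds -/

/-- The step of the induction axiom is a universal implication, which is verified in extensions with
a fresh variable. Base and step are therefore required in all worlds and for all parameters. `H`
carries the assumptions on the parameters, which persist along extensions. -/
theorem induction (H : Formula Γ₀) (C : Formula (.nat :: Γ₀))
    (h₀ : ∀ {Γ : List Ty} (w : World Γ) (s : Sub Γ₀ Γ), w.F (H.subst s) →
      w.F (C.subst (Sub.cons .zero s)))
    (h₁ : ∀ {Γ : List Ty} (w : World Γ) (s : Sub Γ₀ Γ) (n : Term Γ .nat), w.F (H.subst s) →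
      w.F (C.subst (Sub.cons n s)) → w.F (C.subst (Sub.cons (.succ ⬝ n) s)))
    (w : World Γ) (s : Sub Γ₀ Γ) (hH : w.F (H.subst s)) (n : Term Γ .nat) :
    w.F (C.subst (Sub.cons n s)) := by
  have h := w.of_prv (.ax (.induction (C.subst (s.lift .nat))))
  have hb : w.F ((C.subst (s.lift .nat)).inst .zero) := by
    rw [Formula.subst_lift_inst]
    exact h₀ w s hH
  have h' := w.inst (w.mp (w.mp h hb) (w.all_intro fun w' hw' => w'.imp_intro fun w'' hw'' hC => ?_)) n
  · rwa [Formula.subst_lift_inst] at h'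
  · have e₀ : (Sub.cons v0 fun _ v => (s _ v).weak) = s.lift .nat := by
      funext _ v
      cases v <;> rfl
    rw [Formula.subst_subst, Sub.lift_comp_cons]
    have := h₁ w'' (fun _ v => (s _ v).weak) v0 ?_ ?_
    · convert this using 3
      funext _ v
      exact (Term.weak_eq_subst _).symm
    · have := hw'' _ (hw' _ hH)
      rw [Formula.weak_eq_subst, Formula.subst_subst] at this
      convert this using 3
      funext v
      exact Term.weak_eq_subst _
    · rwa [e₀]

/-- Induction for a universally quantified formula. -/
theorem all_induction {τ : Ty} (H : Formula Γ₀) (C : Formula (τ :: .nat :: Γ₀))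
    (h₀ : ∀ {Γ : List Ty} (w : World Γ) (s : Sub Γ₀ Γ), w.F (H.subst s) →
      ∀ p, w.F (C.subst (Sub.cons p (Sub.cons .zero s))))
    (h₁ : ∀ {Γ : List Ty} (w : World Γ) (s : Sub Γ₀ Γ) (n : Term Γ .nat), w.F (H.subst s) →
      (∀ p, w.F (C.subst (Sub.cons p (Sub.cons n s)))) →
      ∀ p, w.F (C.subst (Sub.cons p (Sub.cons (.succ ⬝ n) s))))
    (w : World Γ) (s : Sub Γ₀ Γ) (hH : w.F (H.subst s)) (n : Term Γ .nat) (p : Term Γ τ) :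
    w.F (C.subst (Sub.cons p (Sub.cons n s))) := by
  -- A universal statement follows from its instances in all extensions; the instance used is a
  -- fresh variable.
  have key : ∀ {Γ : List Ty} (w : World Γ) (s : Sub Γ₀ Γ) (n : Term Γ .nat), w.F (H.subst s) →
      (∀ {Γ' : List Ty} (w' : World Γ') (s' : Sub Γ Γ'), (∀ A, w.F A → w'.F (A.subst s')) →
        ∀ p, w'.F (C.subst (Sub.cons p (Sub.cons (n.subst s') (s.comp s'))))) →
      w.F ((Formula.all C).subst (Sub.cons n s)) := by
    intro Γ w s n hH h
    refine w.all_intro fun w' hw' => ?_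
    have := h w' (fun _ v => .var (.s v)) (fun A hA => by
      rw [← Formula.weak_eq_subst]
      exact hw' A hA) v0
    convert this using 2
    funext _ v
    rcases v with _ | _ | v
    · rfl
    · exact Term.weak_eq_subst _
    · exact Term.weak_eq_subst _
  have := w.inst (induction H (.all C) (fun w s hH => key w s _ hH fun w' s' hw' => ?_)
    (fun w s n hH hn => key w s _ hH fun w' s' hw' => ?_) w s hH n) p
  · rwa [Formula.subst_lift_inst] at this
  · have := hw' _ hH
    rw [Formula.subst_subst] at this
    exact h₀ w' _ this
  · have h := hw' _ hH
    rw [Formula.subst_subst] at h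
    refine h₁ w' (s.comp s') (n.subst s') h fun p => ?_
    have := hw' _ hn
    rw [Formula.subst_subst] at this
    have := w'.inst this p
    rw [Formula.subst_lift_inst, Sub.cons_comp] at this
    exact this

variable (w : World Γ) {σ τ : Ty}

/-! ### Decidability -/

instance : One (w.M .nat) := ⟨w.S 0⟩

theorem S_zero : w.S 0 = 1 := rfl

@[simp] theorem cls_lam_ap (t : Term (σ :: Γ) τ) (a : w.M σ) :
    w.ap (w.cls t.lam) a = w.eval (Env.cons a (w.env (Sub.id Γ))) t := by
  rw [← eval_env_id, ap_eval_lam]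

/-- Recursion with the value 0 at 0 and 1 at successors would give 0 = 1. -/
theorem zero_ne_S (a : w.M .nat) : 0 ≠ w.S a := by
  intro h
  have := congrArg (fun x => w.R (σ := .nat) x 0 (w.ap (w.cls (.combK _ _)) (w.ap (w.cls (.combK _ _)) 1))) h
  simp only [R_zero, R_succ, ap_combK] at this
  exact w.consistent (w.cls_eq_iff.1 this)

def pred (a : w.M .nat) : w.M .nat := w.ap (w.cls predT) a

@[simp] theorem ap_predT (a : w.M .nat) : w.ap (w.cls predT) a = w.pred a := (rfl)

@[simp] theorem pred_zero : w.pred 0 = 0 := by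
  simp [pred, predT]

@[simp] theorem pred_S (a : w.M .nat) : w.pred (w.S a) = a := by
  simp [pred, predT]

theorem S_injective : Function.Injective w.S := fun a b h => by
  simpa using congrArg w.pred h

end World

@[simp] theorem predT_subst {Γ Δ : List Ty} (s : Sub Γ Δ) : predT.subst s = predT := by
  simp [predT, Term.lam_subst, Term.subst, Sub.lift]

namespace World

variable {Γ Γ₀ : List Ty} (w : World Γ) {σ τ : Ty}

theorem eval_of_subst {t : Term Γ₀ σ} {t' : Term Γ σ} (h : ∀ s : Sub Γ₀ Γ, t.subst s = t')
    (ρ : w.Env Γ₀) : w.eval ρ t = w.cls t' := by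
  obtain ⟨s, rfl⟩ := ρ.exists_sub
  rw [← cls_subst, h]

@[simp] theorem eval_predT (ρ : w.Env Γ₀) : w.eval ρ predT = w.cls predT :=
  w.eval_of_subst predT_subst ρ

/-- Induction proves the disjunction inside the theory, and primeness of the world selects a
disjunct. -/
theorem eq_zero_or_S_pred (a : w.M .nat) : a = 0 ∨ a = w.S (w.pred a) := by
  obtain ⟨a, rfl⟩ := w.cls_surjective a
  have h : w.F ((v0 ≐ .zero ⋎ v0 ≐ .succ ⬝ (predT ⬝ v0)).subst (Sub.cons a (Sub.empty _))) :=
    induction (Γ₀ := []) (.zero ≐ .zero) (v0 ≐ .zero ⋎ v0 ≐ .succ ⬝ (predT ⬝ v0))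
      (fun w s _ => w.or_iff.2 (.inl (w.cls_eq_iff.1 rfl)))
      (fun w s n _ _ => w.or_iff.2 (.inr (w.cls_eq_iff.1 (by simp [Term.subst, Sub.cons])))) w _
      (w.cls_eq_iff.1 rfl) a
  refine (w.or_iff.1 h).imp (fun h => w.cls_eq_iff.2 h) fun h => ?_
  have := w.cls_eq_iff.2 h
  simpa [Term.subst, Sub.cons] using this

/-- Induction on `a` for all `b` at once, with `b` zero or a successor. The second alternative is a
refutation that belongs to the world and so persists to extensions, unlike the mere absence of the
equation. -/
theorem eq_dec (a b : Term Γ .nat) : w.F (a ≐ b) ∨ w.F (a ≐ b ⟹ .zero ≐ .one) := by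
  refine w.or_iff.1 (all_induction (Γ₀ := []) (.zero ≐ .zero) (v1 ≐ v0 ⋎ (v1 ≐ v0 ⟹ .zero ≐ .one))
    (fun w s _ p => w.or_iff.2 ?_) (fun w s n _ ih p => w.or_iff.2 ?_) w (Sub.empty _)
    (w.cls_eq_iff.1 rfl) a b)
  · rcases w.eq_zero_or_S_pred (w.cls p) with h | h
    · exact .inl (w.cls_eq_iff.1 h.symm)
    · refine .inr (w.imp_intro fun w' hw' h' => (w'.zero_ne_S (w'.cls (predT ⬝ p)) ?_).elim)
      have := w'.cls_eq_iff.2 (hw' _ (w.cls_eq_iff (a := p) (b := .succ ⬝ (predT ⬝ p)).1 h))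
      exact (w'.cls_eq_iff.2 h').trans this
  · rcases w.eq_zero_or_S_pred (w.cls p) with h | h
    · refine .inr (w.imp_intro fun w' hw' h' => (w'.zero_ne_S (w'.cls n) ?_).elim)
      have := w'.cls_eq_iff.2 (hw' _ (w.cls_eq_iff (a := p) (b := .zero).1 h))
      exact ((w'.cls_eq_iff.2 h').trans this).symm
    · refine (w.or_iff.1 (ih (predT ⬝ p))).imp (fun h₁ => ?_) fun h₁ => ?_
      · refine w.cls_eq_iff.1 (h.trans ?_).symm
        exact (congrArg w.S (w.cls_eq_iff.2 h₁)).symm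
      · refine w.imp_intro fun w' hw' h' => w'.mp (hw' _ h₁) (w'.cls_eq_iff.1 ?_)
        have := w'.cls_eq_iff.2 (hw' _ (w.cls_eq_iff (a := p) (b := .succ ⬝ (predT ⬝ p)).1 h))
        exact w'.S_injective ((w'.cls_eq_iff.2 h').trans this)

theorem qf_dec {A : Formula Γ} (hA : A.IsQF) : w.F A ∨ w.F (A ⟹ .zero ≐ .one) := by
  induction A with
  | eq a b => exact w.eq_dec a b
  | and A B ihA ihB =>
    rcases ihA w hA.1 with h | h
    · rcases ihB w hA.2 with h' | h'
      · exact .inl (w.and_iff.2 ⟨h, h'⟩)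
      · exact .inr (w.imp_intro fun w' hw' hAB => w'.mp (hw' _ h') (w'.and_iff.1 hAB).2)
    · exact .inr (w.imp_intro fun w' hw' hAB => w'.mp (hw' _ h) (w'.and_iff.1 hAB).1)
  | or A B ihA ihB =>
    rcases ihA w hA.1 with h | h
    · exact .inl (w.or_iff.2 (.inl h))
    · rcases ihB w hA.2 with h' | h'
      · exact .inl (w.or_iff.2 (.inr h'))
      · exact .inr (w.imp_intro fun w' hw' hAB =>
          (w'.or_iff.1 hAB).elim (w'.mp (hw' _ h)) (w'.mp (hw' _ h')))
  | imp A B ihA ihB =>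
    rcases ihB w hA.2 with h' | h'
    · exact .inl (w.imp_intro fun w' hw' _ => hw' _ h')
    · rcases ihA w hA.1 with h | h
      · exact .inr (w.imp_intro fun w' hw' hAB => w'.mp (hw' _ h') (w'.mp hAB (hw' _ h)))
      · exact .inl (w.imp_intro fun w' hw' hA' => (w'.consistent (w'.mp (hw' _ h) hA')).elim)
  | all => exact hA.elim
  | ex => exact hA.elim

/-- A decided premise is either already in the world or contradictory in all its extensions, so
extensions need not be considered. -/
theorem imp_iff {A B : Formula Γ} (hA : A.IsQF) : w.F (A ⟹ B) ↔ (w.F A → w.F B) := by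
  refine ⟨fun h => w.mp h, fun h => ?_⟩
  rcases w.qf_dec hA with h' | h'
  · exact w.imp_intro fun w' hw' _ => hw' _ (h h')
  · exact w.imp_intro fun w' hw' hA' => (w'.consistent (w'.mp (hw' _ h') hA')).elim

end World

theorem Formula.IsQF.subst {Γ Δ : List Ty} {A : Formula Γ} (h : A.IsQF) (s : Sub Γ Δ) :
    (A.subst s).IsQF := by
  induction A generalizing Δ <;> simp_all [Formula.IsQF, Formula.subst]

namespace World

variable {Γ Γ₀ : List Ty} (w : World Γ) {σ τ : Ty}

/-- This allows quantifier-free formulas to be treated as classical statements about the values in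
`M`. -/
theorem F_subst_iff {A : Formula Γ₀} (h : A.IsQF) (s : Sub Γ₀ Γ) :
    w.F (A.subst s) ↔ w.Sat (w.env s) A := by
  induction A with
  | eq a b => simp only [Formula.subst, Sat, ← cls_eq_iff, cls_subst]
  | and A B ihA ihB => simp only [Formula.subst, Sat, and_iff, ihA h.1, ihB h.2]
  | or A B ihA ihB => simp only [Formula.subst, Sat, or_iff, ihA h.1, ihB h.2]
  | imp A B ihA ihB => simp only [Formula.subst, Sat, w.imp_iff (h.1.subst s), ihA h.1, ihB h.2]
  | all => exact h.elim
  | ex => exact h.elim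

/-- The formula `A` belongs to the world, for values of its variables given by `ρ`. -/
def Holds (A : Formula Γ₀) (ρ : w.Env Γ₀) : Prop := ∃ s, w.env s = ρ ∧ w.F (A.subst s)

/-- Only `C` must be quantifier-free. `H` may contain quantifiers, for instance that a parameter is
a bit-stream, and hence stays a statement about membership in the world. -/
theorem sat_induction_of (H : Formula Γ₀) (C : Formula (.nat :: Γ₀)) (hC : C.IsQF)
    (h₀ : ∀ {Γ : List Ty} (w : World Γ) (ρ : w.Env Γ₀), w.Holds H ρ → w.Sat (Env.cons 0 ρ) C)
    (h₁ : ∀ {Γ : List Ty} (w : World Γ) (ρ : w.Env Γ₀) (n : w.M .nat), w.Holds H ρ →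
      w.Sat (Env.cons n ρ) C → w.Sat (Env.cons (w.S n) ρ) C)
    (w : World Γ) (ρ : w.Env Γ₀) (hH : w.Holds H ρ) (n : w.M .nat) : w.Sat (Env.cons n ρ) C := by
  obtain ⟨s, rfl, hs⟩ := hH
  obtain ⟨n, rfl⟩ := w.cls_surjective n
  rw [← env_cons, ← w.F_subst_iff hC]
  refine induction H C (fun w s h => ?_) (fun w s n h hn => ?_) w s hs n
  · rw [w.F_subst_iff hC, env_cons]
    exact h₀ w _ ⟨s, rfl, h⟩
  · rw [w.F_subst_iff hC, env_cons] at hn ⊢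
    exact h₁ w _ _ ⟨s, rfl, h⟩ hn

theorem sat_induction (C : Formula (.nat :: Γ₀)) (hC : C.IsQF)
    (h₀ : ∀ {Γ : List Ty} (w : World Γ) (ρ : w.Env Γ₀), w.Sat (Env.cons 0 ρ) C)
    (h₁ : ∀ {Γ : List Ty} (w : World Γ) (ρ : w.Env Γ₀) (n : w.M .nat),
      w.Sat (Env.cons n ρ) C → w.Sat (Env.cons (w.S n) ρ) C)
    (w : World Γ) (ρ : w.Env Γ₀) (n : w.M .nat) : w.Sat (Env.cons n ρ) C :=
  sat_induction_of (.zero ≐ .zero) C hC (fun w ρ _ => h₀ w ρ) (fun w ρ n _ => h₁ w ρ n) w ρ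
    (let ⟨s, hs⟩ := ρ.exists_sub; ⟨s, hs, w.cls_eq_iff.1 rfl⟩) n

theorem sat_all_induction_of (H : Formula Γ₀) (C : Formula (τ :: .nat :: Γ₀)) (hC : C.IsQF)
    (h₀ : ∀ {Γ : List Ty} (w : World Γ) (ρ : w.Env Γ₀), w.Holds H ρ →
      ∀ p, w.Sat (Env.cons p (Env.cons 0 ρ)) C)
    (h₁ : ∀ {Γ : List Ty} (w : World Γ) (ρ : w.Env Γ₀) (n : w.M .nat), w.Holds H ρ →
      (∀ p, w.Sat (Env.cons p (Env.cons n ρ)) C) → ∀ p, w.Sat (Env.cons p (Env.cons (w.S n) ρ)) C)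
    (w : World Γ) (ρ : w.Env Γ₀) (hH : w.Holds H ρ) (n : w.M .nat) (p : w.M τ) :
    w.Sat (Env.cons p (Env.cons n ρ)) C := by
  obtain ⟨s, rfl, hs⟩ := hH
  obtain ⟨n, rfl⟩ := w.cls_surjective n
  obtain ⟨p, rfl⟩ := w.cls_surjective p
  rw [← env_cons, ← env_cons, ← w.F_subst_iff hC]
  refine all_induction H C (fun w s h p => ?_) (fun w s n h hn p => ?_) w s hs n p
  · rw [w.F_subst_iff hC, env_cons, env_cons]
    exact h₀ w _ ⟨s, rfl, h⟩ _
  · rw [w.F_subst_iff hC, env_cons, env_cons]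
    refine h₁ w _ (w.cls n) ⟨s, rfl, h⟩ (fun p => ?_) _
    obtain ⟨p, rfl⟩ := w.cls_surjective p
    have := hn p
    rwa [w.F_subst_iff hC, env_cons, env_cons] at this

end World

/-! ### Computation rules for substitution and weakening. -/

section SimpLemmas

variable {Γ Δ : List Ty} {σ τ υ : Ty} (s : Sub Γ Δ)

@[simp] theorem Term.subst_app (t : Term Γ (σ ⇒ τ)) (u : Term Γ σ) :
    (t ⬝ u).subst s = t.subst s ⬝ u.subst s := (rfl)
@[simp] theorem Term.subst_of_var (v : Var Γ σ) : (Term.var v).subst s = s _ v := (rfl)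
@[simp] theorem Term.subst_zero : Term.zero.subst s = .zero := (rfl)
@[simp] theorem Term.subst_succ : Term.succ.subst s = .succ := (rfl)
@[simp] theorem Term.subst_combK : (Term.combK σ τ).subst s = .combK σ τ := (rfl)
@[simp] theorem Term.subst_recR : (Term.recR σ).subst s = .recR σ := (rfl)
@[simp] theorem Formula.subst_eq (t u : Term Γ .nat) :
    (t ≐ u).subst s = (t.subst s ≐ u.subst s) := (rfl)
@[simp] theorem Formula.subst_and (A B : Formula Γ) :
    (A ⋏ B).subst s = (A.subst s ⋏ B.subst s) := (rfl)
@[simp] theorem Formula.subst_or (A B : Formula Γ) :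
    (A ⋎ B).subst s = (A.subst s ⋎ B.subst s) := (rfl)
@[simp] theorem Formula.subst_imp (A B : Formula Γ) :
    (A ⟹ B).subst s = (A.subst s ⟹ B.subst s) := (rfl)
@[simp] theorem Formula.subst_all (A : Formula (σ :: Γ)) :
    (Formula.all A).subst s = .all (A.subst (s.lift σ)) := (rfl)
@[simp] theorem Formula.subst_ex (A : Formula (σ :: Γ)) :
    (Formula.ex A).subst s = .ex (A.subst (s.lift σ)) := (rfl)
@[simp] theorem Term.weak_app (t : Term Γ (σ ⇒ τ)) (u : Term Γ σ) :
    ((t ⬝ u).weak : Term (υ :: Γ) τ) = t.weak ⬝ u.weak := (rfl)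
@[simp] theorem Term.weak_zero : ((.zero : Term Γ .nat).weak : Term (υ :: Γ) _) = .zero := (rfl)
@[simp] theorem Term.weak_succ :
    ((.succ : Term Γ (.nat ⇒ .nat)).weak : Term (υ :: Γ) _) = .succ := (rfl)
@[simp] theorem Term.weak_var (v : Var Γ σ) :
    ((Term.var v).weak : Term (υ :: Γ) _) = .var (.s v) := (rfl)
@[simp] theorem Term.weak_closed (t : Term [] σ) :
    ((t.closed Γ).weak : Term (υ :: Γ) σ) = t.closed _ := t.closed_rename _

@[simp] theorem Term.weak_combK (σ τ υ : Ty) :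
    ((.combK σ τ : Term Γ _).weak : Term (υ :: Γ) _) = .combK σ τ := (rfl)

@[simp] theorem Term.subst_var (t : Term Γ σ) : t.subst (fun _ v => .var v) = t := t.subst_id

@[simp] theorem Sub.lift_z : s.lift τ _ .z = .var .z := (rfl)
@[simp] theorem Sub.lift_s (v : Var Γ σ) : s.lift τ _ (.s v) = (s _ v).weak := (rfl)
@[simp] theorem Sub.cons_z (a : Term Δ τ) : Sub.cons a s _ .z = a := (rfl)
@[simp] theorem Sub.cons_s (a : Term Δ τ) (v : Var Γ σ) :
    Sub.cons a s _ (.s v) = s _ v := (rfl)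

end SimpLemmas


/-! ### Variables that do not occur in a term. -/

def Var.index {Γ : List Ty} {σ : Ty} : Var Γ σ → ℕ
  | .z => 0
  | .s v => v.index + 1

def Term.avoids (n : ℕ) {Γ : List Ty} : {σ : Ty} → Term Γ σ → Bool
  | _, .var v => v.index != n
  | _, .app t u => t.avoids n && u.avoids n
  | _, _ => true

/-- The variable with index `n` does not occur in the term. -/
def Term.Avoids (n : ℕ) {Γ : List Ty} {σ : Ty} (t : Term Γ σ) : Prop := t.avoids n = true

section Avoids

variable {n : ℕ} {Γ : List Ty} {σ τ : Ty}

@[simp] theorem Term.avoids_var {v : Var Γ σ} : (Term.var v).Avoids n ↔ v.index ≠ n := by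
  simp [Term.Avoids, Term.avoids]
@[simp] theorem Term.avoids_app {t : Term Γ (σ ⇒ τ)} {u : Term Γ σ} :
    (t ⬝ u).Avoids n ↔ t.Avoids n ∧ u.Avoids n := by
  simp [Term.Avoids, Term.avoids]
@[simp] theorem Term.avoids_zero : (.zero : Term Γ _).Avoids n := (rfl)
@[simp] theorem Term.avoids_succ : (.succ : Term Γ _).Avoids n := (rfl)
@[simp] theorem Term.avoids_combK : (.combK σ τ : Term Γ _).Avoids n := (rfl)
@[simp] theorem Term.avoids_combS {ρ : Ty} : (.combS ρ σ τ : Term Γ _).Avoids n := (rfl)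
@[simp] theorem Term.avoids_recR : (.recR σ : Term Γ _).Avoids n := (rfl)
@[simp] theorem Term.avoids_param : (.param : Term Γ _).Avoids n := (rfl)

end Avoids

theorem Term.avoids_of_strengthen {n : ℕ} {Γ : List Ty} {σ τ : Ty} {t : Term (τ :: Γ) σ}
    {u : Term Γ σ} (e : t.strengthen = some u) : t.Avoids (n + 1) ↔ u.Avoids n := by
  induction t with
  | var v =>
    cases v with
    | z => simp [Term.strengthen] at e
    | s v =>
      simp only [Term.strengthen, Option.some.injEq] at e
      simp [← e, Var.index]
  | app t₁ t₂ h₁ h₂ =>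
    simp only [Term.strengthen] at e
    split at e
    · next e₁ e₂ =>
      simp only [Option.some.injEq] at e
      simp [← e, h₁ e₁, h₂ e₂]
    · cases e
  | _ =>
    simp only [Term.strengthen, Option.some.injEq] at e
    simp [← e]

@[simp] theorem Term.avoids_lam {n : ℕ} {Γ : List Ty} {σ τ : Ty} {t : Term (τ :: Γ) σ} :
    t.lam.Avoids n ↔ t.Avoids (n + 1) := by
  induction t with
  | var v =>
    cases v with
    | z => simp [Term.lam, Var.index]
    | s v => simp [Term.lam, Var.index]
  | app t₁ t₂ h₁ h₂ =>
    simp only [Term.lam]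
    split
    · next u e => simp [← Term.avoids_of_strengthen (n := n) e]
    · simp [h₁, h₂]
  | _ => simp [Term.lam]

theorem World.eval_congr_of_avoids {Γ Γ₀ : List Ty} (w : World Γ) {n : ℕ} {ρ ρ' : w.Env Γ₀}
    (h : ∀ (σ : Ty) (v : Var Γ₀ σ), v.index ≠ n → ρ σ v = ρ' σ v) {σ : Ty} {t : Term Γ₀ σ}
    (ht : t.Avoids n) : w.eval ρ t = w.eval ρ' t := by
  induction t with
  | var v => simpa [eval_var] using h _ v (Term.avoids_var.1 ht)
  | app t u iht ihu => simp [iht (Term.avoids_app.1 ht).1, ihu (Term.avoids_app.1 ht).2]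
  | _ => simp

/-- Unfolding a recursion at `S a` leaves its step function under an environment with `S a`, whereas
the recursive value uses `a`. The step functions do not mention that variable, so the two agree. -/
theorem World.eval_cons_S {Γ Γ₀ : List Ty} (w : World Γ) {σ τ : Ty} (ρ : w.Env Γ₀) (a : w.M .nat)
    {t : Term (τ :: .nat :: Γ₀) σ} (h : t.Avoids 1) :
    w.eval (Env.cons (w.S a) ρ) t.lam = w.eval (Env.cons a ρ) t.lam :=
  w.eval_congr_of_avoids (n := 0) (fun _ v hv => by
    cases v with
    | z => exact (hv rfl).elim
    | s v => rfl) (Term.avoids_lam.2 h)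

/-- Closed terms avoid all variables. -/
theorem Term.avoids_of_subst {Γ : List Ty} {σ : Ty} {t : ∀ Γ, Term Γ σ} (n : ℕ)
    (h : ∀ {Γ Δ} (s : Sub Γ Δ), (t Γ).subst s = t Δ) : (t Γ).Avoids n := by
  have key : ∀ {σ : Ty} (u : Term [] σ) (s : Sub [] Γ), (u.subst s).Avoids n := by
    intro σ u s
    induction u with
    | var v => cases v
    | app t u ht hu => simp [ht, hu]
    | _ => rfl
  rw [← h (fun _ v => nomatch v : Sub [] Γ)]
  exact key _ _

/-! ### The defined operations are closed terms. -/

section Closed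

variable {Γ Δ : List Ty} (s : Sub Γ Δ)

@[simp] theorem monusT_subst : monusT.subst s = monusT := by
  simp [monusT, Term.lam_subst]

@[simp] theorem addT_subst : addT.subst s = addT := by
  simp [addT, Term.lam_subst]

@[simp] theorem mulT_subst : mulT.subst s = mulT := by
  simp [mulT, Term.lam_subst]

@[simp] theorem minT_subst : minT.subst s = minT := by
  simp [minT, Term.lam_subst]

@[simp] theorem distT_subst : distT.subst s = distT := by
  simp [distT, Term.lam_subst]

@[simp] theorem parityT_subst : parityT.subst s = parityT := by
  simp [parityT, Term.lam_subst]

@[simp] theorem halfT_subst : halfT.subst s = halfT := by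
  simp [halfT, Term.lam_subst]

@[simp] theorem snocT_subst : snocT.subst s = snocT := by
  simp [snocT, Term.lam_subst]

@[simp] theorem initT_subst : initT.subst s = initT := by
  simp [initT, Term.lam_subst]

@[simp] theorem lastT_subst : lastT.subst s = lastT := by
  simp [lastT, Term.lam_subst]

@[simp] theorem foldT_subst : foldT.subst s = foldT := by
  simp [foldT, ifT, Term.lam_subst]

@[simp] theorem lenT_subst : lenT.subst s = lenT := by
  simp [lenT, Term.lam_subst]

@[simp] theorem concatT_subst : concatT.subst s = concatT := by
  simp [concatT, Term.lam_subst]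

@[simp] theorem prefixT_subst : prefixT.subst s = prefixT := by
  simp [prefixT, ifT, Term.lam_subst]

@[simp] theorem nthT_subst : nthT.subst s = nthT := by
  simp [nthT, Term.lam_subst]

@[simp] theorem segT_subst : segT.subst s = segT := by
  simp [segT, Term.lam_subst]

@[simp] theorem sumT_subst : sumT.subst s = sumT := by
  simp [sumT, Term.lam_subst]

@[simp] theorem prodT_subst : prodT.subst s = prodT := by
  simp [prodT, Term.lam_subst]

@[simp] theorem coverT_subst : coverT.subst s = coverT := by
  simp [coverT, Term.lam_subst]

@[simp] theorem alphaT_subst : alphaT.subst s = alphaT := by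
  simp [alphaT, ifT, Term.lam_subst]

theorem predT_avoids {n : ℕ} : (predT : Term Γ _).Avoids n :=
  Term.avoids_of_subst (t := fun _ => predT) n predT_subst

theorem addT_avoids {n : ℕ} : (addT : Term Γ _).Avoids n :=
  Term.avoids_of_subst (t := fun _ => addT) n addT_subst

theorem monusT_avoids {n : ℕ} : (monusT : Term Γ _).Avoids n :=
  Term.avoids_of_subst (t := fun _ => monusT) n monusT_subst

theorem mulT_avoids {n : ℕ} : (mulT : Term Γ _).Avoids n :=
  Term.avoids_of_subst (t := fun _ => mulT) n mulT_subst

theorem parityT_avoids {n : ℕ} : (parityT : Term Γ _).Avoids n :=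
  Term.avoids_of_subst (t := fun _ => parityT) n parityT_subst

theorem initT_avoids {n : ℕ} : (initT : Term Γ _).Avoids n :=
  Term.avoids_of_subst (t := fun _ => initT) n initT_subst

theorem lastT_avoids {n : ℕ} : (lastT : Term Γ _).Avoids n :=
  Term.avoids_of_subst (t := fun _ => lastT) n lastT_subst

theorem lenT_avoids {n : ℕ} : (lenT : Term Γ _).Avoids n :=
  Term.avoids_of_subst (t := fun _ => lenT) n lenT_subst

theorem snocT_avoids {n : ℕ} : (snocT : Term Γ _).Avoids n :=
  Term.avoids_of_subst (t := fun _ => snocT) n snocT_subst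

end Closed

namespace World

variable {Γ Γ₀ : List Ty} (w : World Γ) {σ τ : Ty} (ρ : w.Env Γ₀)

@[simp] theorem eval_monusT : w.eval ρ monusT = w.cls monusT := w.eval_of_subst monusT_subst ρ
@[simp] theorem eval_addT : w.eval ρ addT = w.cls addT := w.eval_of_subst addT_subst ρ
@[simp] theorem eval_mulT : w.eval ρ mulT = w.cls mulT := w.eval_of_subst mulT_subst ρ
@[simp] theorem eval_distT : w.eval ρ distT = w.cls distT := w.eval_of_subst distT_subst ρ
@[simp] theorem eval_parityT : w.eval ρ parityT = w.cls parityT :=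
  w.eval_of_subst parityT_subst ρ
@[simp] theorem eval_halfT : w.eval ρ halfT = w.cls halfT := w.eval_of_subst halfT_subst ρ
@[simp] theorem eval_snocT : w.eval ρ snocT = w.cls snocT := w.eval_of_subst snocT_subst ρ
@[simp] theorem eval_initT : w.eval ρ initT = w.cls initT := w.eval_of_subst initT_subst ρ
@[simp] theorem eval_lastT : w.eval ρ lastT = w.cls lastT := w.eval_of_subst lastT_subst ρ
@[simp] theorem eval_foldT : w.eval ρ foldT = w.cls foldT := w.eval_of_subst foldT_subst ρ
@[simp] theorem eval_lenT : w.eval ρ lenT = w.cls lenT := w.eval_of_subst lenT_subst ρ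
@[simp] theorem eval_concatT : w.eval ρ concatT = w.cls concatT :=
  w.eval_of_subst concatT_subst ρ
@[simp] theorem eval_prefixT : w.eval ρ prefixT = w.cls prefixT :=
  w.eval_of_subst prefixT_subst ρ
@[simp] theorem eval_segT : w.eval ρ segT = w.cls segT := w.eval_of_subst segT_subst ρ
@[simp] theorem eval_sumT : w.eval ρ sumT = w.cls sumT := w.eval_of_subst sumT_subst ρ
@[simp] theorem eval_prodT : w.eval ρ prodT = w.cls prodT := w.eval_of_subst prodT_subst ρ
@[simp] theorem eval_coverT : w.eval ρ coverT = w.cls coverT := w.eval_of_subst coverT_subst ρ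
@[simp] theorem eval_alphaT : w.eval ρ alphaT = w.cls alphaT := w.eval_of_subst alphaT_subst ρ

/-! ### The semiring of numbers of a world -/

instance : Add (w.M .nat) := ⟨fun a b => w.ap (w.ap (w.cls addT) a) b⟩
instance : Mul (w.M .nat) := ⟨fun a b => w.ap (w.ap (w.cls mulT) a) b⟩
instance : _root_.Sub (w.M .nat) := ⟨fun a b => w.ap (w.ap (w.cls monusT) a) b⟩

@[simp] theorem ap_addT (a b : w.M .nat) : w.ap (w.ap (w.cls addT) a) b = a + b := (rfl)
@[simp] theorem ap_mulT (a b : w.M .nat) : w.ap (w.ap (w.cls mulT) a) b = a * b := (rfl)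
@[simp] theorem ap_monusT (a b : w.M .nat) : w.ap (w.ap (w.cls monusT) a) b = a - b := (rfl)

theorem add_zero' (a : w.M .nat) : a + 0 = a := by
  simp [← ap_addT, addT]

theorem add_S (a b : w.M .nat) : a + w.S b = w.S (a + b) := by
  simp [← ap_addT, addT, eval_cons_S, Var.index]

theorem mul_zero' (a : w.M .nat) : a * 0 = 0 := by
  simp [← ap_mulT, mulT]

theorem mul_S (a b : w.M .nat) : a * w.S b = a * b + a := by
  simp [← ap_mulT, mulT, eval_cons_S, addT_avoids, Var.index]

theorem sub_zero' (a : w.M .nat) : a - 0 = a := by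
  simp [← ap_monusT, monusT]

theorem sub_S (a b : w.M .nat) : a - w.S b = w.pred (a - b) := by
  simp [← ap_monusT, monusT, eval_cons_S, predT_avoids, Var.index]

theorem zero_add' (a : w.M .nat) : 0 + a = a := by
  simpa [Sat] using sat_induction (Γ₀ := []) (addT ⬝ .zero ⬝ v0 ≐ v0) trivial
    (by intros; simp [Sat, add_zero']) (by simp +contextual [Sat, add_S]) w (Env.nil w) a

theorem S_add (a b : w.M .nat) : w.S a + b = w.S (a + b) := by
  simpa [Sat] using sat_induction (Γ₀ := [.nat])
    (addT ⬝ (.succ ⬝ v1) ⬝ v0 ≐ .succ ⬝ (addT ⬝ v1 ⬝ v0)) trivial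
    (by intros; simp [Sat, add_zero']) (by simp +contextual [Sat, add_S]) w (.cons a (.nil w)) b

theorem add_comm' (a b : w.M .nat) : a + b = b + a := by
  simpa [Sat] using sat_induction (Γ₀ := [.nat]) (addT ⬝ v1 ⬝ v0 ≐ addT ⬝ v0 ⬝ v1) trivial
    (by intros; simp [Sat, add_zero', zero_add'])
    (by simp +contextual [Sat, add_S, S_add]) w (.cons a (.nil w)) b

theorem add_assoc' (a b c : w.M .nat) : a + b + c = a + (b + c) := by
  simpa [Sat] using sat_induction (Γ₀ := [.nat, .nat])
    (addT ⬝ (addT ⬝ v2 ⬝ v1) ⬝ v0 ≐ addT ⬝ v2 ⬝ (addT ⬝ v1 ⬝ v0)) trivial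
    (by intros; simp [Sat, add_zero'])
    (by simp +contextual [Sat, add_S]) w (.cons b (.cons a (.nil w))) c

noncomputable instance : AddCommMonoid (w.M .nat) where
  add_assoc := w.add_assoc'
  zero_add := w.zero_add'
  add_zero := w.add_zero'
  add_comm := w.add_comm'
  nsmul := nsmulRec

theorem zero_mul' (a : w.M .nat) : 0 * a = 0 := by
  simpa [Sat] using sat_induction (Γ₀ := []) (mulT ⬝ .zero ⬝ v0 ≐ .zero) trivial
    (by intros; simp [Sat, mul_zero']) (by simp +contextual [Sat, mul_S]) w (Env.nil w) a

theorem S_mul (a b : w.M .nat) : w.S a * b = a * b + b := by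
  simpa [Sat] using sat_induction (Γ₀ := [.nat])
    (mulT ⬝ (.succ ⬝ v1) ⬝ v0 ≐ addT ⬝ (mulT ⬝ v1 ⬝ v0) ⬝ v0) trivial
    (by intros; simp [Sat, mul_zero'])
    (by
      intro Γ w ρ n h
      simp only [Sat, eval_app, eval_mulT, eval_addT, eval_var_z, eval_var_s, eval_succ, ap_succ, ap_mulT, ap_addT] at h ⊢
      rw [mul_S, mul_S, h, add_S, add_S, add_right_comm]) w (.cons a (.nil w)) b

theorem mul_comm' (a b : w.M .nat) : a * b = b * a := by
  simpa [Sat] using sat_induction (Γ₀ := [.nat]) (mulT ⬝ v1 ⬝ v0 ≐ mulT ⬝ v0 ⬝ v1) trivial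
    (by intros; simp [Sat, mul_zero', zero_mul'])
    (by simp +contextual [Sat, mul_S, S_mul]) w (.cons a (.nil w)) b

theorem mul_add' (a b c : w.M .nat) : a * (b + c) = a * b + a * c := by
  simpa [Sat] using sat_induction (Γ₀ := [.nat, .nat])
    (mulT ⬝ v2 ⬝ (addT ⬝ v1 ⬝ v0) ≐ addT ⬝ (mulT ⬝ v2 ⬝ v1) ⬝ (mulT ⬝ v2 ⬝ v0)) trivial
    (by intros; simp [Sat, mul_zero'])
    (by simp +contextual [Sat, mul_S, add_S, add_assoc]) w (.cons b (.cons a (.nil w))) c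

theorem mul_assoc' (a b c : w.M .nat) : a * b * c = a * (b * c) := by
  simpa [Sat] using sat_induction (Γ₀ := [.nat, .nat])
    (mulT ⬝ (mulT ⬝ v2 ⬝ v1) ⬝ v0 ≐ mulT ⬝ v2 ⬝ (mulT ⬝ v1 ⬝ v0)) trivial
    (by intros; simp [Sat, mul_zero'])
    (by simp +contextual [Sat, mul_S, mul_add']) w (.cons b (.cons a (.nil w))) c

theorem mul_one' (a : w.M .nat) : a * 1 = a := by
  rw [← S_zero, mul_S, mul_zero', zero_add]

noncomputable instance : CommSemiring (w.M .nat) where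
  mul_assoc := w.mul_assoc'
  mul_comm := w.mul_comm'
  zero_mul := w.zero_mul'
  mul_zero := w.mul_zero'
  one_mul a := by rw [mul_comm', mul_one']
  mul_one := w.mul_one'
  left_distrib := w.mul_add'
  right_distrib a b c := by rw [mul_comm', mul_add', mul_comm' _ c, mul_comm' _ c]

theorem S_eq (a : w.M .nat) : w.S a = a + 1 := by
  rw [← S_zero, add_S, add_zero]

theorem pred_eq (a : w.M .nat) : w.pred a = a - 1 := by
  rw [← S_zero, sub_S, sub_zero']

theorem S_sub_S (a b : w.M .nat) : w.S a - w.S b = a - b := by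
  simpa [Sat] using sat_induction (Γ₀ := [.nat])
    (monusT ⬝ (.succ ⬝ v1) ⬝ (.succ ⬝ v0) ≐ monusT ⬝ v1 ⬝ v0) trivial
    (by intros; simp [Sat, sub_zero', sub_S])
    (by
      intro Γ w ρ n h
      simp only [Sat, eval_app, eval_monusT, eval_var_z, eval_var_s, eval_succ, ap_succ, ap_monusT] at h ⊢
      rw [sub_S, h, sub_S]) w (.cons a (.nil w)) b

theorem zero_sub' (a : w.M .nat) : 0 - a = 0 := by
  simpa [Sat] using sat_induction (Γ₀ := []) (monusT ⬝ .zero ⬝ v0 ≐ .zero) trivial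
    (by intros; simp [Sat, sub_zero']) (by simp +contextual [Sat, sub_S]) w (Env.nil w) a

theorem add_sub_cancel' (a b : w.M .nat) : a + b - b = a := by
  simpa [Sat] using sat_induction (Γ₀ := [.nat])
    (monusT ⬝ (addT ⬝ v1 ⬝ v0) ⬝ v0 ≐ v1) trivial
    (by intros; simp [Sat, sub_zero'])
    (by simp +contextual [Sat, add_S, S_sub_S]) w (.cons a (.nil w)) b

theorem sub_add' (a b c : w.M .nat) : a - (b + c) = a - b - c := by
  simpa [Sat] using sat_induction (Γ₀ := [.nat, .nat])
    (monusT ⬝ v2 ⬝ (addT ⬝ v1 ⬝ v0) ≐ monusT ⬝ (monusT ⬝ v2 ⬝ v1) ⬝ v0) trivial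
    (by intros; simp [Sat, sub_zero'])
    (by simp +contextual [Sat, add_S, sub_S]) w (.cons b (.cons a (.nil w))) c

theorem sub_self' (a : w.M .nat) : a - a = 0 := by
  simpa using w.add_sub_cancel' 0 a

/-- Both sides are the maximum of `a` and `b`. It identifies `a - b = 0` with the existence of a
difference, by double induction. -/
theorem add_sub_max (a b : w.M .nat) : a + (b - a) = b + (a - b) := by
  have := sat_all_induction_of (Γ₀ := []) (.zero ≐ .zero)
    (addT ⬝ v1 ⬝ (monusT ⬝ v0 ⬝ v1) ≐ addT ⬝ v0 ⬝ (monusT ⬝ v1 ⬝ v0)) trivial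
    (by intros; simp [Sat, sub_zero', zero_sub'])
    (by
      intro Γ w ρ n _ h p
      simp only [Sat, eval_app, eval_monusT, eval_addT, eval_var_z, eval_var_s, ap_addT, ap_monusT] at h ⊢
      rcases w.eq_zero_or_S_pred p with hp | hp
      · simp [hp, sub_zero', zero_sub']
      · rw [hp, S_sub_S, S_sub_S, S_add, S_add, h])
    w (.nil w) ⟨Sub.empty _, funext fun _ => funext nofun, w.cls_eq_iff.1 rfl⟩ a b
  simpa [Sat] using this

theorem sub_total (a b : w.M .nat) : a - b = 0 ∨ b - a = 0 := by
  have := sat_all_induction_of (Γ₀ := []) (.zero ≐ .zero)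
    (monusT ⬝ v1 ⬝ v0 ≐ .zero ⋎ monusT ⬝ v0 ⬝ v1 ≐ .zero) ⟨trivial, trivial⟩
    (by intros; simp [Sat, zero_sub'])
    (by
      intro Γ w ρ n _ h p
      simp only [Sat, eval_app, eval_monusT, eval_var_z, eval_var_s, ap_monusT, eval_zero] at h ⊢
      rcases w.eq_zero_or_S_pred p with hp | hp
      · simp [hp, zero_sub']
      · rw [hp, S_sub_S, S_sub_S]
        exact h _)
    w (.nil w) ⟨Sub.empty _, funext fun _ => funext nofun, w.cls_eq_iff.1 rfl⟩ a b
  simpa [Sat] using this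

theorem exists_add_iff {a b : w.M .nat} : a - b = 0 ↔ ∃ c, b = a + c := by
  refine ⟨fun h => ⟨b - a, ?_⟩, ?_⟩
  · rw [add_sub_max, h, add_zero]
  · rintro ⟨c, rfl⟩
    rw [sub_add', sub_self', zero_sub']

theorem eq_zero_of_add {a b : w.M .nat} (h : a + b = 0) : a = 0 := by
  rcases w.eq_zero_or_S_pred b with hb | hb
  · rwa [hb, add_zero] at h
  · rw [hb, add_S] at h
    exact (w.zero_ne_S _ h.symm).elim

/-- With this definition `a ≤ b` is an equation between terms and can occur in quantifier-free
inductions. -/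
noncomputable instance : LinearOrder (w.M .nat) where
  le a b := a - b = 0
  le_refl := w.sub_self'
  le_trans a b c hab hbc := by
    obtain ⟨d, rfl⟩ := w.exists_add_iff.1 hab
    obtain ⟨e, rfl⟩ := w.exists_add_iff.1 hbc
    exact w.exists_add_iff.2 ⟨d + e, add_assoc _ _ _⟩
  le_antisymm a b hab hba := by
    obtain ⟨d, rfl⟩ := w.exists_add_iff.1 hab
    obtain ⟨e, he⟩ := w.exists_add_iff.1 hba
    have := congrArg (· - a) he
    rw [sub_self', add_assoc, add_comm a, add_sub_cancel'] at this
    rw [w.eq_zero_of_add this.symm, add_zero]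
  le_total := w.sub_total
  toDecidableLE := Classical.decRel _

theorem le_iff {a b : w.M .nat} : a ≤ b ↔ a - b = 0 := Iff.rfl

instance : CanonicallyOrderedAdd (w.M .nat) where
  exists_add_of_le h := w.exists_add_iff.1 h
  le_add_self _ b := w.exists_add_iff.2 ⟨b, add_comm _ _⟩
  le_self_add _ b := w.exists_add_iff.2 ⟨b, rfl⟩

theorem add_left_cancel' {a b c : w.M .nat} (h : a + b = a + c) : b = c := by
  simpa only [add_comm a, add_sub_cancel'] using congrArg (· - a) h

instance : IsOrderedCancelAddMonoid (w.M .nat) where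
  add_le_add_left a b h c := by
    obtain ⟨d, rfl⟩ := w.exists_add_iff.1 h
    exact w.exists_add_iff.2 ⟨d, by ring⟩
  le_of_add_le_add_left a b c h := by
    obtain ⟨d, hd⟩ := w.exists_add_iff.1 h
    rw [add_assoc] at hd
    exact w.exists_add_iff.2 ⟨d, w.add_left_cancel' hd⟩

instance : OrderedSub (w.M .nat) where
  tsub_le_iff_right a b c := by rw [le_iff, le_iff, add_comm, sub_add']

instance : Nontrivial (w.M .nat) := ⟨0, 1, w.zero_ne_S 0⟩

theorem lt_iff {a b : w.M .nat} : a < b ↔ a + 1 ≤ b := by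
  refine ⟨fun h => ?_, fun h => (lt_add_one a).trans_le h⟩
  obtain ⟨c, rfl⟩ := exists_add_of_le h.le
  rcases w.eq_zero_or_S_pred c with hc | hc
  · exact (h.ne (by rw [hc, add_zero])).elim
  · rw [hc, S_eq, ← add_assoc, add_right_comm]
    exact le_self_add

theorem mul_lt_mul' {a b c : w.M .nat} (h : 0 < c) (hab : a < b) : c * a < c * b := by
  obtain ⟨d, rfl⟩ := exists_add_of_le (w.lt_iff.1 hab)
  rw [mul_add, mul_add, mul_one, add_assoc]
  exact lt_add_of_pos_right _ (h.trans_le le_self_add)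

instance : IsStrictOrderedRing (w.M .nat) where
  zero_le_one := zero_le
  mul_lt_mul_of_pos_left _ hc _ _ h := w.mul_lt_mul' hc h
  mul_lt_mul_of_pos_right c hc a b h := by
    rw [mul_comm a, mul_comm b]
    exact w.mul_lt_mul' hc h

end World

namespace World

variable {Γ Γ₀ : List Ty} (w : World Γ) {σ τ : Ty}

/-! ### Bits, parity and halves -/

def IsBit (a : w.M .nat) : Prop := a = 0 ∨ a = 1

@[simp] theorem S_eq_add_one (a : w.M .nat) : w.S a = a + 1 := w.S_eq a

@[simp] theorem R_add_one (n : w.M .nat) (b : w.M σ) (c : w.M (σ ⇒ .nat ⇒ σ)) :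
    w.R (n + 1) b c = w.ap (w.ap c (w.R n b c)) n := by
  rw [← S_eq, R_succ]

theorem eval_cons_add_one (ρ : w.Env Γ₀) (a : w.M .nat)
    {t : Term (τ :: .nat :: Γ₀) σ} (h : t.Avoids 1) :
    w.eval (Env.cons (a + 1) ρ) t.lam = w.eval (Env.cons a ρ) t.lam := by
  rw [← S_eq, w.eval_cons_S ρ a h]

theorem eval_cons_cons_congr (ρ : w.Env Γ₀) (b : w.M σ) (a a' : w.M .nat)
    {υ : Ty} {t : Term (τ :: σ :: .nat :: Γ₀) υ} (h : t.Avoids 2) :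
    w.eval (Env.cons b (Env.cons a ρ)) t.lam = w.eval (Env.cons b (Env.cons a' ρ)) t.lam :=
  w.eval_congr_of_avoids (n := 1) (fun _ v hv => by
    rcases v with _ | _ | v
    · rfl
    · exact (hv rfl).elim
    · rfl) (Term.avoids_lam.2 h)

theorem eq_zero_or_add_one (a : w.M .nat) : a = 0 ∨ ∃ b, a = b + 1 :=
  (w.eq_zero_or_S_pred a).imp id fun h => ⟨_, h.trans (w.S_eq _)⟩

@[simp] theorem add_one_ne_zero' (a : w.M .nat) : a + 1 ≠ 0 := by
  rw [← S_eq]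
  exact (w.zero_ne_S a).symm

@[simp] theorem add_one_sub_one (a : w.M .nat) : a + 1 - 1 = a := w.add_sub_cancel' a 1

theorem lt_add_one_iff {a b : w.M .nat} : a < b + 1 ↔ a ≤ b := by
  rw [lt_iff, add_le_add_iff_right]

def parity (a : w.M .nat) : w.M .nat := w.ap (w.cls parityT) a
def half (a : w.M .nat) : w.M .nat := w.ap (w.cls halfT) a

@[simp] theorem ap_parityT (a : w.M .nat) : w.ap (w.cls parityT) a = w.parity a := (rfl)
@[simp] theorem ap_halfT (a : w.M .nat) : w.ap (w.cls halfT) a = w.half a := (rfl)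

@[simp] theorem parity_zero : w.parity 0 = 0 := by
  simp [← ap_parityT, parityT]

@[simp] theorem parity_add_one (a : w.M .nat) : w.parity (a + 1) = 1 - w.parity a := by
  simp [← ap_parityT, parityT, eval_cons_add_one, Var.index, monusT_avoids]

@[simp] theorem half_zero : w.half 0 = 0 := by
  simp [← ap_halfT, halfT]

@[simp] theorem half_add_one (a : w.M .nat) : w.half (a + 1) = w.half a + w.parity a := by
  simp [← ap_halfT, halfT, eval_cons_add_one, Var.index, addT_avoids, parityT_avoids]

variable {w} in
theorem IsBit.one_sub {a : w.M .nat} (h : w.IsBit a) : w.IsBit (1 - a) := by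
  rcases h with rfl | rfl
  · exact .inr (tsub_zero _)
  · exact .inl (tsub_self _)

theorem isBit_parity (a : w.M .nat) : w.IsBit (w.parity a) := by
  simpa [Sat, isBit, IsBit] using sat_induction (Γ₀ := []) (isBit (parityT ⬝ v0)) ⟨trivial, trivial⟩
    (by intros; simp [Sat, isBit])
    (by
      intro Γ w ρ n h
      simp only [Sat, isBit, eval_app, eval_parityT, eval_var_z, ap_parityT, eval_zero, eval_succ, ap_succ, S_eq_add_one, parity_add_one, zero_add] at h ⊢
      exact IsBit.one_sub h) w (.nil w) a

/-- Adding 1 flips the parity and increases the half by the old parity. This makes `init` and `last`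
decompose every nonzero code. -/
theorem half_add_half (a : w.M .nat) : w.half a + w.half a + w.parity a = a := by
  simpa [Sat] using sat_induction (Γ₀ := [])
    (addT ⬝ (addT ⬝ (halfT ⬝ v0) ⬝ (halfT ⬝ v0)) ⬝ (parityT ⬝ v0) ≐ v0) trivial
    (by intros; simp [Sat])
    (by
      intro Γ w ρ n h
      simp only [Sat, eval_app, eval_parityT, eval_halfT, eval_addT, eval_var_z, ap_parityT, ap_halfT, ap_addT, S_eq_add_one, parity_add_one, half_add_one] at h ⊢
      rcases w.isBit_parity n with hn | hn
      · rw [hn, add_zero] at h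
        rw [hn, add_zero, tsub_zero, h]
      · rw [hn] at h
        rw [hn, tsub_self, add_zero, ← add_assoc, add_right_comm _ 1, h]) w (.nil w) a

theorem parity_add_self (a : w.M .nat) : w.parity (a + a) = 0 := by
  simpa [Sat] using sat_induction (Γ₀ := []) (parityT ⬝ (addT ⬝ v0 ⬝ v0) ≐ .zero) trivial
    (by intros; simp [Sat])
    (by
      intro Γ w ρ n h
      simp only [Sat, eval_app, eval_parityT, eval_addT, eval_var_z, ap_parityT, eval_zero, ap_addT, S_eq_add_one] at h ⊢
      rw [add_add_add_comm, ← add_assoc, parity_add_one, parity_add_one, h, tsub_zero, tsub_self])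
    w (.nil w) a

theorem half_add_self (a : w.M .nat) : w.half (a + a) = a := by
  simpa [Sat] using sat_induction (Γ₀ := []) (halfT ⬝ (addT ⬝ v0 ⬝ v0) ≐ v0) trivial
    (by intros; simp [Sat])
    (by
      intro Γ w ρ n h
      simp only [Sat, eval_app, eval_halfT, eval_addT, eval_var_z, ap_halfT, ap_addT, S_eq_add_one] at h ⊢
      rw [add_add_add_comm, ← add_assoc, half_add_one, half_add_one, parity_add_one,
        parity_add_self, h, tsub_zero, add_zero])
    w (.nil w) a

/-! ### Bit-strings -/

def snoc (p b : w.M .nat) : w.M .nat := w.ap (w.ap (w.cls snocT) p) b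
def init (p : w.M .nat) : w.M .nat := w.ap (w.cls initT) p
def last (p : w.M .nat) : w.M .nat := w.ap (w.cls lastT) p

@[simp] theorem ap_snocT (p b : w.M .nat) : w.ap (w.ap (w.cls snocT) p) b = w.snoc p b := (rfl)
@[simp] theorem ap_initT (p : w.M .nat) : w.ap (w.cls initT) p = w.init p := (rfl)
@[simp] theorem ap_lastT (p : w.M .nat) : w.ap (w.cls lastT) p = w.last p := (rfl)

theorem snoc_eq (p b : w.M .nat) : w.snoc p b = p + p + b + 1 := by
  simp [← ap_snocT, snocT]

theorem init_eq (p : w.M .nat) : w.init p = w.half (p - 1) := by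
  simp [← ap_initT, initT, pred_eq]

theorem last_eq (p : w.M .nat) : w.last p = w.parity (p - 1) := by
  simp [← ap_lastT, lastT, pred_eq]

theorem init_snoc {b : w.M .nat} (hb : w.IsBit b) (p : w.M .nat) : w.init (w.snoc p b) = p := by
  rw [init_eq, snoc_eq, add_one_sub_one]
  rcases hb with rfl | rfl
  · rw [add_zero, half_add_self]
  · rw [half_add_one, half_add_self, parity_add_self, add_zero]

theorem last_snoc {b : w.M .nat} (hb : w.IsBit b) (p : w.M .nat) : w.last (w.snoc p b) = b := by
  rw [last_eq, snoc_eq, add_one_sub_one]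
  rcases hb with rfl | rfl
  · rw [add_zero, parity_add_self]
  · rw [parity_add_one, parity_add_self, tsub_zero]

theorem isBit_last (p : w.M .nat) : w.IsBit (w.last p) := by
  rw [last_eq]
  exact w.isBit_parity _

theorem snoc_init_last (p : w.M .nat) : w.snoc (w.init (p + 1)) (w.last (p + 1)) = p + 1 := by
  rw [snoc_eq, init_eq, last_eq, add_one_sub_one, half_add_half]

/-- Removing the last bit lowers the code; this is the measure behind `fold` and string induction.
-/
theorem init_add_one_le (p : w.M .nat) : w.init (p + 1) ≤ p := by
  rw [init_eq, add_one_sub_one]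
  nth_rw 2 [← w.half_add_half p]
  rw [add_assoc]
  exact le_self_add

/-- The value of the term `ifT`. -/
def ite (c y z : w.M .nat) : w.M .nat :=
  w.R c z (w.ap (w.cls (.combK (.nat ⇒ .nat) .nat)) (w.ap (w.cls (.combK .nat .nat)) y))

@[simp] theorem eval_ifT (ρ : w.Env Γ₀) (c y z : Term Γ₀ .nat) :
    w.eval ρ (ifT c y z) = w.ite (w.eval ρ c) (w.eval ρ y) (w.eval ρ z) := (rfl)

@[simp] theorem ite_zero (y z : w.M .nat) : w.ite 0 y z = z := by
  simp [ite]

@[simp] theorem ite_add_one (c y z : w.M .nat) : w.ite (c + 1) y z = y := by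
  simp [ite]

@[simp] theorem ite_one (y z : w.M .nat) : w.ite 1 y z = y := by
  simpa using w.ite_add_one 0 y z

end World

/-- The recursion of `foldT`, with a separate bound for its depth. -/
def loopT {Γ : List Ty} : Term Γ (.nat ⇒ (.nat ⇒ .nat ⇒ .nat) ⇒ .nat ⇒ .nat ⇒ .nat) :=
  .lam (.lam (.lam
    (.recR (.nat ⇒ .nat) ⬝ v0 ⬝ .lam v3 ⬝
      .lam (.lam (.lam (ifT v0 (v4 ⬝ (v2 ⬝ (initT ⬝ v0)) ⬝ (lastT ⬝ v0)) v5))))))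

@[simp] theorem loopT_subst {Γ Δ : List Ty} (s : Sub Γ Δ) : loopT.subst s = loopT := by
  simp [loopT, ifT, Term.lam_subst]

namespace World

variable {Γ Γ₀ : List Ty} (w : World Γ) {σ τ : Ty}

@[simp] theorem eval_loopT (ρ : w.Env Γ₀) : w.eval ρ loopT = w.cls loopT :=
  w.eval_of_subst loopT_subst ρ

def loop (b : w.M .nat) (f : w.M (.nat ⇒ .nat ⇒ .nat)) (d p : w.M .nat) : w.M .nat :=
  w.ap (w.ap (w.ap (w.ap (w.cls loopT) b) f) d) p

def fold (b : w.M .nat) (f : w.M (.nat ⇒ .nat ⇒ .nat)) (p : w.M .nat) : w.M .nat :=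
  w.ap (w.ap (w.ap (w.cls foldT) b) f) p

@[simp] theorem ap_loopT (b : w.M .nat) (f : w.M (.nat ⇒ .nat ⇒ .nat)) (d p : w.M .nat) :
    w.ap (w.ap (w.ap (w.ap (w.cls loopT) b) f) d) p = w.loop b f d p := (rfl)

@[simp] theorem ap_foldT (b : w.M .nat) (f : w.M (.nat ⇒ .nat ⇒ .nat)) (p : w.M .nat) :
    w.ap (w.ap (w.ap (w.cls foldT) b) f) p = w.fold b f p := (rfl)

variable (b : w.M .nat) (f : w.M (.nat ⇒ .nat ⇒ .nat))

theorem fold_eq_loop (p : w.M .nat) : w.fold b f p = w.loop b f p p := by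
  simp [← ap_foldT, ← ap_loopT, foldT, loopT]

theorem loop_zero (p : w.M .nat) : w.loop b f 0 p = b := by
  simp [← ap_loopT, loopT]

theorem loop_add_one (d p : w.M .nat) : w.loop b f (d + 1) p =
    w.ite p (w.ap (w.ap f (w.loop b f d (w.init p))) (w.last p)) b := by
  simp [← ap_loopT, loopT, ifT, eval_cons_add_one, Var.index, initT_avoids, lastT_avoids, ite]

/-- Each step of the loop lowers a nonzero code, so depth `p` already reaches the empty string. The
induction on `d` treats all `p` at once because the step passes to `init p`. -/
theorem loop_add_one_of_le {d p : w.M .nat} (h : p ≤ d) :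
    w.loop b f (d + 1) p = w.loop b f d p := by
  have := sat_all_induction_of (Γ₀ := [.nat ⇒ .nat ⇒ .nat, .nat]) (.zero ≐ .zero)
    (monusT ⬝ v0 ⬝ v1 ≐ .zero ⟹
      loopT ⬝ v3 ⬝ v2 ⬝ (.succ ⬝ v1) ⬝ v0 ≐ loopT ⬝ v3 ⬝ v2 ⬝ v1 ⬝ v0) ⟨trivial, trivial⟩
    (by
      intro Γ w ρ _ p h
      simp only [Sat, eval_app, eval_monusT, eval_loopT, eval_var_z, eval_var_s, ap_loopT, ap_monusT, eval_succ, ap_succ, S_eq_add_one, eval_zero, ← le_iff] at h ⊢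
      rw [le_antisymm h zero_le, loop_add_one, ite_zero, loop_zero])
    (by
      intro Γ w ρ n _ ih p h
      simp only [Sat, eval_app, eval_monusT, eval_loopT, eval_var_z, eval_var_s, ap_loopT, ap_monusT, eval_succ, ap_succ, S_eq_add_one, eval_zero, ← le_iff] at h ih ⊢
      rw [loop_add_one w _ _ (n + 1), loop_add_one w _ _ n p]
      rcases w.eq_zero_or_add_one p with rfl | ⟨p, rfl⟩
      · rw [ite_zero, ite_zero]
      · rw [ih _ ((w.init_add_one_le p).trans (add_le_add_iff_right 1 |>.1 h))])
    w (.cons f (.cons b (.nil w)))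
    (let ⟨s, hs⟩ := Env.exists_sub _; ⟨s, hs, w.cls_eq_iff.1 rfl⟩) d p
  simpa [Sat, ← le_iff, h] using this

theorem loop_add (p k : w.M .nat) : w.loop b f (p + k) p = w.fold b f p := by
  have := sat_induction (Γ₀ := [.nat, .nat ⇒ .nat ⇒ .nat, .nat])
    (loopT ⬝ v3 ⬝ v2 ⬝ (addT ⬝ v1 ⬝ v0) ⬝ v1 ≐ foldT ⬝ v3 ⬝ v2 ⬝ v1) trivial
    (by intros; simp [Sat, fold_eq_loop])
    (by
      intro Γ w ρ n h
      simp only [Sat, eval_app, eval_addT, eval_loopT, eval_var_z, eval_var_s, ap_loopT, ap_addT, S_eq_add_one, eval_foldT, ap_foldT] at h ⊢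
      rw [← add_assoc, loop_add_one_of_le _ _ _ le_self_add, h])
    w (.cons p (.cons f (.cons b (.nil w)))) k
  simpa [Sat] using this

@[simp] theorem fold_zero : w.fold b f 0 = b := by
  rw [fold_eq_loop, loop_zero]

/-- After one step the remaining depth is `p + p + c` instead of `p`; `loop_add` discards the
excess. -/
theorem fold_snoc {c : w.M .nat} (hc : w.IsBit c) (p : w.M .nat) :
    w.fold b f (w.snoc p c) = w.ap (w.ap f (w.fold b f p)) c := by
  rw [fold_eq_loop]
  nth_rw 1 [snoc_eq]
  rw [loop_add_one, init_snoc w hc, last_snoc w hc, add_assoc, loop_add, snoc_eq, ite_add_one]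

/-- Induction along bit-strings. -/
theorem sat_string_induction (C : Formula (.nat :: Γ₀)) (hC : C.IsQF)
    (h₀ : ∀ {Γ : List Ty} (w : World Γ) (ρ : w.Env Γ₀), w.Sat (Env.cons 0 ρ) C)
    (h₁ : ∀ {Γ : List Ty} (w : World Γ) (ρ : w.Env Γ₀) (p c : w.M .nat), w.IsBit c →
      w.Sat (Env.cons p ρ) C → w.Sat (Env.cons (w.snoc p c) ρ) C)
    (w : World Γ) (ρ : w.Env Γ₀) (p : w.M .nat) : w.Sat (Env.cons p ρ) C := by
  -- `r` makes room for a bound n next to p: the induction is course-of-values, on the claim for all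
  -- codes p ≤ n.
  let r : Sub (.nat :: Γ₀) (.nat :: .nat :: Γ₀) := Sub.cons v0 fun _ v => .var (.s (.s v))
  have hr : ∀ {Γ : List Ty} (w : World Γ) (ρ : w.Env Γ₀) (p n : w.M .nat),
      w.Sat (Env.cons p (Env.cons n ρ)) (C.subst r) ↔ w.Sat (Env.cons p ρ) C := by
    intro Γ w ρ p n
    obtain ⟨s, rfl⟩ := ρ.exists_sub
    obtain ⟨p, rfl⟩ := w.cls_surjective p
    obtain ⟨n, rfl⟩ := w.cls_surjective n
    rw [← env_cons, ← env_cons, ← env_cons, ← w.F_subst_iff hC, ← w.F_subst_iff (hC.subst r),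
      Formula.subst_subst, Sub.cons_comp]
    exact Iff.rfl
  have := sat_all_induction_of (.zero ≐ .zero) (monusT ⬝ v0 ⬝ v1 ≐ .zero ⟹ C.subst r)
    ⟨trivial, hC.subst r⟩
    (by
      intro Γ w ρ _ p h
      simp only [Sat, eval_app, eval_monusT, eval_var_z, eval_var_s, ap_monusT, eval_zero, ← le_iff, hr] at h ⊢
      rw [le_antisymm h zero_le]
      exact h₀ w ρ)
    (by
      intro Γ w ρ n _ ih p h
      simp only [Sat, eval_app, eval_monusT, eval_var_z, eval_var_s, ap_monusT, eval_zero, S_eq_add_one, ← le_iff, hr] at h ih ⊢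
      rcases w.eq_zero_or_add_one p with rfl | ⟨p, rfl⟩
      · exact h₀ w ρ
      · rw [← w.snoc_init_last]
        exact h₁ w ρ _ _ (w.isBit_last _)
          (ih _ ((w.init_add_one_le p).trans (add_le_add_iff_right 1 |>.1 h))))
    w ρ (let ⟨s, hs⟩ := Env.exists_sub _; ⟨s, hs, w.cls_eq_iff.1 rfl⟩) p p
  simp only [Sat, eval_app, eval_monusT, eval_var_z, eval_var_s, ap_monusT, eval_zero, ← le_iff, hr] at this
  exact this le_rfl

end World

/-! ### Auxiliary terms for searching, shifting streams, splitting strings and building α. -/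

section Closed

variable {Γ Δ : List Ty} {n : ℕ}

/-- `f, N ↦` some `i ≤ N` with `f i = 0`, if there is one -/
def searchT : Term Γ ((.nat ⇒ .nat) ⇒ .nat ⇒ .nat) :=
  .lam (.lam (.recR .nat ⬝ v0 ⬝ .zero ⬝ .lam (.lam (ifT (v3 ⬝ v1) (.succ ⬝ v0) v1))))

/-- `β, n, i ↦ β (n + i)` -/
def shiftT : Term Γ ((.nat ⇒ .nat) ⇒ .nat ⇒ .nat ⇒ .nat) :=
  .lam (.lam (.lam (v2 ⬝ (addT ⬝ v1 ⬝ v0))))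

/-- the successor of the first bit -/
def headT : Term Γ (.nat ⇒ .nat) :=
  foldT ⬝ .zero ⬝ .lam (.lam (ifT v1 v1 (.succ ⬝ v0)))

/-- the successor of the string without its first bit -/
def tailT : Term Γ (.nat ⇒ .nat) :=
  foldT ⬝ .zero ⬝ .lam (.lam (ifT v1 (.succ ⬝ (snocT ⬝ (predT ⬝ v1) ⬝ v0)) .one))

/-- the string of the first `n` bits of `alphaT` -/
def rhoT : Term Γ ((.nat ⇒ .nat) ⇒ .nat ⇒ .nat) :=
  .lam (.lam (.recR .nat ⬝ v0 ⬝ nilT ⬝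
      .lam (.lam (snocT ⬝ v1 ⬝
        ifT (v3 ⬝ (snocT ⬝ v1 ⬝ .zero)) (ifT (v3 ⬝ (snocT ⬝ v1 ⬝ .one)) .zero .one) .zero))))

@[simp] theorem searchT_subst (s : Sub Γ Δ) : searchT.subst s = searchT := by
  simp [searchT, ifT, Term.lam_subst]

@[simp] theorem shiftT_subst (s : Sub Γ Δ) : shiftT.subst s = shiftT := by
  simp [shiftT, Term.lam_subst]

@[simp] theorem headT_subst (s : Sub Γ Δ) : headT.subst s = headT := by
  simp [headT, ifT, Term.lam_subst]

@[simp] theorem tailT_subst (s : Sub Γ Δ) : tailT.subst s = tailT := by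
  simp [tailT, ifT, Term.lam_subst]

@[simp] theorem rhoT_subst (s : Sub Γ Δ) : rhoT.subst s = rhoT := by
  simp [rhoT, ifT, Term.lam_subst]

end Closed

namespace World

variable {Γ Γ₀ : List Ty} (w : World Γ) {σ τ : Ty}

@[simp] theorem eval_searchT (ρ : w.Env Γ₀) : w.eval ρ searchT = w.cls searchT :=
  w.eval_of_subst searchT_subst ρ
@[simp] theorem eval_shiftT (ρ : w.Env Γ₀) : w.eval ρ shiftT = w.cls shiftT :=
  w.eval_of_subst shiftT_subst ρ
@[simp] theorem eval_headT (ρ : w.Env Γ₀) : w.eval ρ headT = w.cls headT :=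
  w.eval_of_subst headT_subst ρ
@[simp] theorem eval_tailT (ρ : w.Env Γ₀) : w.eval ρ tailT = w.cls tailT :=
  w.eval_of_subst tailT_subst ρ
@[simp] theorem eval_rhoT (ρ : w.Env Γ₀) : w.eval ρ rhoT = w.cls rhoT :=
  w.eval_of_subst rhoT_subst ρ

/-! ### Length, concatenation and initial segments -/

def len (p : w.M .nat) : w.M .nat := w.ap (w.cls lenT) p
def concat (p q : w.M .nat) : w.M .nat := w.ap (w.ap (w.cls concatT) p) q
def pref (p n : w.M .nat) : w.M .nat := w.ap (w.ap (w.cls prefixT) p) n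
def head (p : w.M .nat) : w.M .nat := w.ap (w.cls headT) p
def tail (p : w.M .nat) : w.M .nat := w.ap (w.cls tailT) p

@[simp] theorem ap_lenT (p : w.M .nat) : w.ap (w.cls lenT) p = w.len p := (rfl)
@[simp] theorem ap_concatT (p q : w.M .nat) : w.ap (w.ap (w.cls concatT) p) q = w.concat p q := (rfl)
@[simp] theorem ap_prefixT (p n : w.M .nat) : w.ap (w.ap (w.cls prefixT) p) n = w.pref p n := (rfl)
@[simp] theorem ap_headT (p : w.M .nat) : w.ap (w.cls headT) p = w.head p := (rfl)
@[simp] theorem ap_tailT (p : w.M .nat) : w.ap (w.cls tailT) p = w.tail p := (rfl)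

@[simp] theorem len_zero : w.len 0 = 0 := by
  simp [← ap_lenT, lenT]

theorem len_snoc {b : w.M .nat} (hb : w.IsBit b) (p : w.M .nat) :
    w.len (w.snoc p b) = w.len p + 1 := by
  simp [← ap_lenT, lenT, fold_snoc w _ _ hb]

@[simp] theorem concat_zero (p : w.M .nat) : w.concat p 0 = p := by
  simp [← ap_concatT, concatT]

theorem concat_snoc {b : w.M .nat} (hb : w.IsBit b) (p q : w.M .nat) :
    w.concat p (w.snoc q b) = w.snoc (w.concat p q) b := by
  simp [← ap_concatT, concatT, fold_snoc w _ _ hb]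

@[simp] theorem pref_zero (n : w.M .nat) : w.pref 0 n = 0 := by
  simp [← ap_prefixT, prefixT]

theorem pref_snoc {b : w.M .nat} (hb : w.IsBit b) (p n : w.M .nat) : w.pref (w.snoc p b) n =
    w.ite (n - w.len (w.pref p n)) (w.snoc (w.pref p n) b) (w.pref p n) := by
  simp only [← ap_prefixT, prefixT, cls_lam_ap, ap_eval_lam, eval_app, eval_foldT, eval_zero, eval_var_s, eval_var_z, ap_foldT, fold_snoc w _ _ hb]
  simp only [eval_ifT, eval_app, eval_var_s, eval_var_z, eval_monusT, eval_lenT, eval_snocT, ap_monusT, ap_lenT, ap_snocT]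
  -- The folded function stands in the scope of the whole string, which differs on the two sides,
  -- but does not mention it.
  rw [eval_cons_cons_congr w _ n (w.snoc p b) p]
  simp [ifT, Var.index, snocT_avoids, monusT_avoids, lenT_avoids]

@[simp] theorem head_zero : w.head 0 = 0 := by
  simp [← ap_headT, headT]

theorem head_snoc {b : w.M .nat} (hb : w.IsBit b) (p : w.M .nat) :
    w.head (w.snoc p b) = w.ite (w.head p) (w.head p) (b + 1) := by
  simp [← ap_headT, headT, fold_snoc w _ _ hb]

@[simp] theorem tail_zero : w.tail 0 = 0 := by
  simp [← ap_tailT, tailT]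

theorem tail_snoc {b : w.M .nat} (hb : w.IsBit b) (p : w.M .nat) :
    w.tail (w.snoc p b) = w.ite (w.tail p) (w.snoc (w.tail p - 1) b + 1) 1 := by
  simp [← ap_tailT, tailT, fold_snoc w _ _ hb, pred_eq]

theorem pref_of_len_le {p n : w.M .nat} (h : w.len p ≤ n) : w.pref p n = p := by
  have := sat_string_induction (Γ₀ := [.nat])
    (monusT ⬝ (lenT ⬝ v0) ⬝ v1 ≐ .zero ⟹ prefixT ⬝ v0 ⬝ v1 ≐ v0) ⟨trivial, trivial⟩
    (by intros; simp [Sat])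
    (by
      intro Γ w ρ p c hc ih h
      simp only [Sat, eval_app, eval_monusT, eval_lenT, eval_prefixT, eval_var_z, eval_var_s, ap_monusT, ap_lenT, ap_prefixT, eval_zero, ← le_iff, len_snoc w hc] at ih h ⊢
      have h' := ih (le_self_add.trans h)
      obtain ⟨k, hk⟩ := exists_add_of_le h
      rw [pref_snoc w hc, h', hk, add_assoc, add_tsub_cancel_left, add_comm 1, ite_add_one])
    w (.cons n (.nil w)) p
  simp only [Sat, eval_app, eval_monusT, eval_lenT, eval_prefixT, eval_var_z, eval_var_s, ap_monusT, ap_lenT, ap_prefixT, eval_zero, ← le_iff] at this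
  exact this h

theorem len_pref {p n : w.M .nat} (h : n ≤ w.len p) : w.len (w.pref p n) = n := by
  have := sat_string_induction (Γ₀ := [.nat])
    (monusT ⬝ v1 ⬝ (lenT ⬝ v0) ≐ .zero ⟹ lenT ⬝ (prefixT ⬝ v0 ⬝ v1) ≐ v1) ⟨trivial, trivial⟩
    (by simp +contextual [Sat])
    (by
      intro Γ w ρ p c hc ih h
      simp only [Sat, eval_app, eval_monusT, eval_lenT, eval_prefixT, eval_var_z, eval_var_s, ap_monusT, ap_lenT, ap_prefixT, eval_zero, ← le_iff, len_snoc w hc] at ih h ⊢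
      rcases h.lt_or_eq with h | h
      · rw [pref_snoc w hc, ih (w.lt_add_one_iff.1 h), tsub_self, ite_zero,
          ih (w.lt_add_one_iff.1 h)]
      · rw [pref_of_len_le, len_snoc w hc, h]
        rw [len_snoc w hc, h])
    w (.cons n (.nil w)) p
  simp only [Sat, eval_app, eval_monusT, eval_lenT, eval_prefixT, eval_var_z, eval_var_s, ap_monusT, ap_lenT, ap_prefixT, eval_zero, ← le_iff] at this
  exact this h

theorem len_pref_le (p n : w.M .nat) : w.len (w.pref p n) ≤ n := by
  rcases le_total n (w.len p) with h | h
  · exact (w.len_pref h).le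
  · rwa [pref_of_len_le w h]

theorem pref_snoc_of_le {p n b : w.M .nat} (hb : w.IsBit b) (h : n ≤ w.len p) :
    w.pref (w.snoc p b) n = w.pref p n := by
  rw [pref_snoc w hb, len_pref w h, tsub_self, ite_zero]

theorem len_concat (p q : w.M .nat) : w.len (w.concat p q) = w.len p + w.len q := by
  simpa [Sat] using sat_string_induction (Γ₀ := [.nat])
    (lenT ⬝ (concatT ⬝ v1 ⬝ v0) ≐ addT ⬝ (lenT ⬝ v1) ⬝ (lenT ⬝ v0)) trivial
    (by intros; simp [Sat])
    (by
      intro Γ w ρ p c hc ih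
      simp only [Sat, eval_app, eval_addT, eval_lenT, eval_concatT, eval_var_z, eval_var_s, ap_addT, ap_lenT, ap_concatT] at ih ⊢
      rw [concat_snoc w hc, len_snoc w hc, len_snoc w hc, ih, add_assoc])
    w (.cons p (.nil w)) q

theorem pref_concat_add (y q i : w.M .nat) :
    w.pref (w.concat y q) (w.len y + i) = w.concat y (w.pref q i) := by
  simpa [Sat] using sat_string_induction (Γ₀ := [.nat, .nat])
    (prefixT ⬝ (concatT ⬝ v1 ⬝ v0) ⬝ (addT ⬝ (lenT ⬝ v1) ⬝ v2) ≐
      concatT ⬝ v1 ⬝ (prefixT ⬝ v0 ⬝ v2)) trivial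
    (by
      intros
      simp only [Sat, eval_app, eval_addT, eval_lenT, eval_concatT, eval_prefixT, eval_var_z, eval_var_s, ap_addT, ap_lenT, ap_concatT, ap_prefixT, pref_zero, concat_zero]
      exact pref_of_len_le _ le_self_add)
    (by
      intro Γ w ρ p c hc ih
      simp only [Sat, eval_app, eval_addT, eval_lenT, eval_concatT, eval_prefixT, eval_var_z, eval_var_s, ap_addT, ap_lenT, ap_concatT, ap_prefixT] at ih ⊢
      rcases lt_or_ge (w.len p) (w.eval ρ (.var (.s .z))) with h | h
      · rw [lt_iff] at h
        rw [w.pref_of_len_le, w.pref_of_len_le]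
        · rwa [len_snoc w hc]
        · rw [len_concat, len_snoc w hc]
          gcongr
      · rw [concat_snoc w hc, pref_snoc_of_le w hc, ih, pref_snoc_of_le w hc h]
        rw [len_concat]
        gcongr)
    w (.cons y (.cons i (.nil w))) q

theorem pref_pref {l i : w.M .nat} (h : l ≤ i) (p : w.M .nat) :
    w.pref (w.pref p i) l = w.pref p l := by
  have := sat_string_induction (Γ₀ := [.nat, .nat])
    (monusT ⬝ v1 ⬝ v2 ≐ .zero ⟹ prefixT ⬝ (prefixT ⬝ v0 ⬝ v2) ⬝ v1 ≐ prefixT ⬝ v0 ⬝ v1)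
    ⟨trivial, trivial⟩
    (by intros; simp [Sat])
    (by
      intro Γ w ρ p c hc ih h
      simp only [Sat, eval_app, eval_monusT, eval_prefixT, eval_var_z, eval_var_s, ap_monusT, ap_prefixT, eval_zero, ← le_iff] at ih h ⊢
      rcases lt_or_ge (w.len p) (w.eval ρ (.var (.s .z))) with h' | h'
      · rw [lt_iff] at h'
        rw [w.pref_of_len_le (n := w.eval ρ (.var (.s .z)))]
        rwa [len_snoc w hc]
      · rw [pref_snoc_of_le w hc h', ih h, pref_snoc_of_le w hc (h.trans h')])
    w (.cons l (.cons i (.nil w))) p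
  simp only [Sat, eval_app, eval_monusT, eval_prefixT, eval_var_z, eval_var_s, ap_monusT, ap_prefixT, eval_zero, ← le_iff] at this
  exact this h

/-- Codes grow at the right end, so splitting off the first bit takes an induction; explicit terms
keep it quantifier-free. `headT` and `tailT` give successors, 0 being reserved for the empty string,
whence the subtractions. The last two equations say that both values are nonzero. -/
theorem head_tail (z q : w.M .nat) : q = 0 ∨
    w.concat z q = w.concat (w.snoc z (w.head q - 1)) (w.tail q - 1) ∧
      w.len (w.tail q - 1) + 1 = w.len q ∧ w.IsBit (w.head q - 1) ∧
      w.head q - 1 + 1 = w.head q ∧ w.tail q - 1 + 1 = w.tail q := by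
  have := sat_string_induction (Γ₀ := [.nat])
    (v0 ≐ .zero ⋎
      (concatT ⬝ v1 ⬝ v0 ≐
        concatT ⬝ (snocT ⬝ v1 ⬝ (predT ⬝ (headT ⬝ v0))) ⬝ (predT ⬝ (tailT ⬝ v0)) ⋏
      .succ ⬝ (lenT ⬝ (predT ⬝ (tailT ⬝ v0))) ≐ lenT ⬝ v0 ⋏
      isBit (predT ⬝ (headT ⬝ v0)) ⋏
      .succ ⬝ (predT ⬝ (headT ⬝ v0)) ≐ headT ⬝ v0 ⋏
      .succ ⬝ (predT ⬝ (tailT ⬝ v0)) ≐ tailT ⬝ v0))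
    ⟨trivial, trivial, trivial, ⟨trivial, trivial⟩, trivial, trivial⟩
    (by intros; simp [Sat])
    (by
      intro Γ w ρ p c hc ih
      simp only [Sat, isBit, eval_app, eval_concatT, eval_snocT, eval_predT, eval_headT, eval_tailT, eval_lenT, eval_succ, eval_var_z, eval_var_s, ap_concatT, ap_snocT, ap_predT, ap_headT, ap_tailT, ap_lenT, ap_succ, S_eq_add_one, eval_zero, pred_eq, zero_add] at ih ⊢
      right
      rw [head_snoc w hc, tail_snoc w hc, len_snoc w hc, concat_snoc w hc]
      rcases ih with rfl | ⟨h₁, h₂, h₃, h₄, h₅⟩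
      · simp only [head_zero, tail_zero, ite_zero, concat_zero, tsub_self, len_zero, zero_add, add_one_sub_one, and_true, true_and]
        exact hc
      · rw [← h₄, ← h₅]
        simp only [ite_add_one, add_one_sub_one, concat_snoc w hc, len_snoc w hc, and_true]
        exact ⟨by rw [h₁], by rw [h₂], h₃⟩)
    w (.cons z (.nil w)) q
  simpa [Sat, isBit, IsBit, pred_eq] using this

theorem exists_cons {q k : w.M .nat} (h : w.len q = k + 1) (z : w.M .nat) :
    ∃ b t, w.IsBit b ∧ w.len t = k ∧ w.concat z q = w.concat (w.snoc z b) t := by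
  rcases w.head_tail z q with rfl | ⟨h₁, h₂, h₃, -, -⟩
  · rw [len_zero] at h
    exact (w.add_one_ne_zero' k h.symm).elim
  · exact ⟨_, _, h₃, add_right_cancel (h₂.trans h), h₁⟩

end World

/-! ### The summands of the covering term. -/

section Closed

variable {Γ Δ : List Ty}

/-- `coverT` is the sum of the values of this term. -/
def coverBodyT : Term Γ ((.nat ⇒ .nat) ⇒ .nat ⇒ .nat ⇒ .nat ⇒ .nat ⇒ .nat) :=
  .lam (.lam (.lam (.lam
      (.lam (mulT ⬝ (monusT ⬝ .one ⬝ (distT ⬝ (lenT ⬝ v0) ⬝ v2)) ⬝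
        (prodT ⬝ v1 ⬝ .lam
          (prodT ⬝ v2 ⬝ .lam
            (distT ⬝ (prefixT ⬝ (concatT ⬝ v5 ⬝ v2) ⬝ v1) ⬝ (v6 ⬝ v0)))))))))

@[simp] theorem coverBodyT_subst (s : Sub Γ Δ) : coverBodyT.subst s = coverBodyT := by
  simp [coverBodyT, Term.lam_subst, Term.subst, Sub.lift, Term.weak, Term.rename, Ren.weak]

end Closed

namespace World

variable {Γ Γ₀ : List Ty} (w : World Γ) {σ τ : Ty}

@[simp] theorem eval_coverBodyT (ρ : w.Env Γ₀) : w.eval ρ coverBodyT = w.cls coverBodyT :=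
  w.eval_of_subst coverBodyT_subst ρ

/-! ### Minima and distances -/

theorem ap_minT (a b : w.M .nat) : w.ap (w.ap (w.cls minT) a) b = min a b := by
  have : w.ap (w.ap (w.cls minT) a) b = a - (a - b) := by simp [minT]
  rw [this]
  rcases le_total a b with h | h
  · rw [tsub_eq_zero_of_le h, tsub_zero, min_eq_left h]
  · rw [min_eq_right h, tsub_tsub_cancel_of_le h]

theorem ap_distT (a b : w.M .nat) : w.ap (w.ap (w.cls distT) a) b = (a - b) + (b - a) := by
  simp [distT]

theorem dist_eq_zero_iff {a b : w.M .nat} : w.ap (w.ap (w.cls distT) a) b = 0 ↔ a = b := by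
  rw [ap_distT, add_eq_zero, tsub_eq_zero_iff_le, tsub_eq_zero_iff_le, le_antisymm_iff]

/-! ### Bounded sums and products -/

def sum (N : w.M .nat) (f : w.M (.nat ⇒ .nat)) : w.M .nat := w.ap (w.ap (w.cls sumT) N) f
def prod (N : w.M .nat) (f : w.M (.nat ⇒ .nat)) : w.M .nat := w.ap (w.ap (w.cls prodT) N) f
def search (f : w.M (.nat ⇒ .nat)) (N : w.M .nat) : w.M .nat := w.ap (w.ap (w.cls searchT) f) N

@[simp] theorem ap_sumT (N : w.M .nat) (f : w.M (.nat ⇒ .nat)) :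
    w.ap (w.ap (w.cls sumT) N) f = w.sum N f := (rfl)
@[simp] theorem ap_prodT (N : w.M .nat) (f : w.M (.nat ⇒ .nat)) :
    w.ap (w.ap (w.cls prodT) N) f = w.prod N f := (rfl)
@[simp] theorem ap_searchT (f : w.M (.nat ⇒ .nat)) (N : w.M .nat) :
    w.ap (w.ap (w.cls searchT) f) N = w.search f N := (rfl)

@[simp] theorem sum_zero (f : w.M (.nat ⇒ .nat)) : w.sum 0 f = w.ap f 0 := by
  simp [← ap_sumT, sumT, - zero_add]

theorem sum_add_one (N : w.M .nat) (f : w.M (.nat ⇒ .nat)) :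
    w.sum (N + 1) f = w.sum N f + w.ap f (N + 1) := by
  simp only [← ap_sumT, sumT, cls_lam_ap, ap_eval_lam, eval_app, eval_recR, ap_recR, eval_succ,
    ap_succ, S_eq_add_one, eval_zero, eval_var_z, eval_var_s, R_add_one]
  rw [eval_cons_cons_congr w _ f (N + 1) N]
  · simp
  · simp [Var.index, addT_avoids]

@[simp] theorem prod_zero (f : w.M (.nat ⇒ .nat)) : w.prod 0 f = w.ap f 0 := by
  simp [← ap_prodT, prodT, - zero_add]
  rw [zero_add, one_mul]

theorem prod_add_one (N : w.M .nat) (f : w.M (.nat ⇒ .nat)) :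
    w.prod (N + 1) f = w.prod N f * w.ap f (N + 1) := by
  simp only [← ap_prodT, prodT, cls_lam_ap, ap_eval_lam, eval_app, eval_recR, ap_recR, eval_succ,
    ap_succ, S_eq_add_one, eval_zero, eval_var_z, eval_var_s, R_add_one]
  rw [eval_cons_cons_congr w _ f (N + 1) N]
  · simp
  · simp [Var.index, mulT_avoids]

@[simp] theorem search_zero (f : w.M (.nat ⇒ .nat)) : w.search f 0 = 0 := by
  simp [← ap_searchT, searchT]

theorem search_add_one (N : w.M .nat) (f : w.M (.nat ⇒ .nat)) :
    w.search f (N + 1) = w.ite (w.ap f (w.search f N)) (N + 1) (w.search f N) := by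
  simp [← ap_searchT, searchT, ifT, eval_cons_add_one, Var.index, ite]

theorem apply_eq_zero_of_sum {N i : w.M .nat} {f : w.M (.nat ⇒ .nat)} (h : w.sum N f = 0)
    (hi : i ≤ N) : w.ap f i = 0 := by
  have := sat_induction (Γ₀ := [.nat, .nat ⇒ .nat])
    (monusT ⬝ v1 ⬝ v0 ≐ .zero ⟹ sumT ⬝ v0 ⬝ v2 ≐ .zero ⟹ v2 ⬝ v1 ≐ .zero)
    ⟨trivial, trivial, trivial⟩
    (by
      intro Γ w ρ h h'
      simp only [Sat, eval_app, eval_monusT, eval_sumT, eval_var_z, eval_var_s, ap_monusT,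
        ap_sumT, eval_zero, ← le_iff, sum_zero] at h h' ⊢
      rwa [le_antisymm h zero_le])
    (by
      intro Γ w ρ n ih h h'
      simp only [Sat, eval_app, eval_monusT, eval_sumT, eval_var_z, eval_var_s, ap_monusT,
        ap_sumT, eval_zero, ← le_iff, S_eq_add_one, sum_add_one, add_eq_zero] at ih h h' ⊢
      rcases h.lt_or_eq with h | h
      · exact ih (w.lt_add_one_iff.1 h) h'.1
      · rw [h]
        exact h'.2)
    w (.cons i (.cons f (.nil w))) N
  simp only [Sat, eval_app, eval_monusT, eval_sumT, eval_var_z, eval_var_s, ap_monusT,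
    ap_sumT, eval_zero, ← le_iff] at this
  exact this hi h

theorem prod_eq_zero_of {N i : w.M .nat} {f : w.M (.nat ⇒ .nat)} (h : w.ap f i = 0)
    (hi : i ≤ N) : w.prod N f = 0 := by
  have := sat_induction (Γ₀ := [.nat, .nat ⇒ .nat])
    (monusT ⬝ v1 ⬝ v0 ≐ .zero ⟹ v2 ⬝ v1 ≐ .zero ⟹ prodT ⬝ v0 ⬝ v2 ≐ .zero)
    ⟨trivial, trivial, trivial⟩
    (by
      intro Γ w ρ h h'
      simp only [Sat, eval_app, eval_monusT, eval_prodT, eval_var_z, eval_var_s, ap_monusT,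
        ap_prodT, eval_zero, ← le_iff, prod_zero] at h h' ⊢
      rwa [le_antisymm h zero_le] at h')
    (by
      intro Γ w ρ n ih h h'
      simp only [Sat, eval_app, eval_monusT, eval_prodT, eval_var_z, eval_var_s, ap_monusT,
        ap_prodT, eval_zero, ← le_iff, S_eq_add_one, prod_add_one] at ih h h' ⊢
      rcases h.lt_or_eq with h | h
      · rw [ih (w.lt_add_one_iff.1 h) h', zero_mul]
      · rw [← h, h', mul_zero])
    w (.cons i (.cons f (.nil w))) N
  simp only [Sat, eval_app, eval_monusT, eval_prodT, eval_var_z, eval_var_s, ap_monusT,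
    ap_prodT, eval_zero, ← le_iff] at this
  exact this hi h

theorem search_le (N : w.M .nat) (f : w.M (.nat ⇒ .nat)) : w.search f N ≤ N := by
  have := sat_induction (Γ₀ := [.nat ⇒ .nat]) (monusT ⬝ (searchT ⬝ v1 ⬝ v0) ⬝ v0 ≐ .zero) trivial
    (by intros; simp [Sat])
    (by
      intro Γ w ρ n ih
      simp only [Sat, eval_app, eval_monusT, eval_searchT, eval_var_z, eval_var_s, ap_monusT,
        ap_searchT, eval_zero, ← le_iff, S_eq_add_one, search_add_one] at ih ⊢
      rcases w.eq_zero_or_add_one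
        (w.ap (w.eval ρ (.var .z)) (w.search (w.eval ρ (.var .z)) n)) with h | ⟨c, h⟩
      · rw [h, ite_zero]
        exact ih.trans le_self_add
      · rw [h, ite_add_one])
    w (.cons f (.nil w)) N
  simpa only [Sat, eval_app, eval_monusT, eval_searchT, eval_var_z, eval_var_s, ap_monusT,
    ap_searchT, eval_zero, ← le_iff] using this

/-- The search term replaces the existential quantifier over vanishing factors, so that
quantifier-free induction applies. -/
theorem apply_search_eq_zero {N : w.M .nat} {f : w.M (.nat ⇒ .nat)} (h : w.prod N f = 0) :
    w.ap f (w.search f N) = 0 := by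
  have := sat_induction (Γ₀ := [.nat ⇒ .nat])
    (prodT ⬝ v0 ⬝ v1 ≐ .zero ⟹ v1 ⬝ (searchT ⬝ v1 ⬝ v0) ≐ .zero) ⟨trivial, trivial⟩
    (by
      intro Γ w ρ h
      simpa [Sat] using h)
    (by
      intro Γ w ρ n ih h
      simp only [Sat, eval_app, eval_prodT, eval_searchT, eval_var_z, eval_var_s, ap_prodT,
        ap_searchT, eval_zero, S_eq_add_one, prod_add_one, search_add_one,
        mul_eq_zero] at ih h ⊢
      rcases w.eq_zero_or_add_one
        (w.ap (w.eval ρ (.var .z)) (w.search (w.eval ρ (.var .z)) n)) with h' | ⟨c, h'⟩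
      · rw [h', ite_zero, h']
      · rw [h', ite_add_one]
        refine h.resolve_left fun h => ?_
        rw [ih h] at h'
        exact w.add_one_ne_zero' c h'.symm)
    w (.cons f (.nil w)) N
  simp only [Sat, eval_app, eval_prodT, eval_searchT, eval_var_z, eval_var_s, ap_prodT,
    ap_searchT, eval_zero] at this
  exact this h

theorem prod_eq_zero_iff {N : w.M .nat} {f : w.M (.nat ⇒ .nat)} :
    w.prod N f = 0 ↔ ∃ i ≤ N, w.ap f i = 0 :=
  ⟨fun h => ⟨_, w.search_le N f, w.apply_search_eq_zero h⟩, fun ⟨_, hi, h⟩ => w.prod_eq_zero_of h hi⟩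

/-! ### Initial segments of bit-streams -/

def seg (α : w.M (.nat ⇒ .nat)) (n : w.M .nat) : w.M .nat := w.ap (w.ap (w.cls segT) α) n

@[simp] theorem ap_segT (α : w.M (.nat ⇒ .nat)) (n : w.M .nat) :
    w.ap (w.ap (w.cls segT) α) n = w.seg α n := (rfl)

@[simp] theorem seg_zero (α : w.M (.nat ⇒ .nat)) : w.seg α 0 = 0 := by
  simp [← ap_segT, segT]

theorem seg_add_one (α : w.M (.nat ⇒ .nat)) (n : w.M .nat) :
    w.seg α (n + 1) = w.snoc (w.seg α n) (w.ap α n) := by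
  simp [← ap_segT, segT, eval_cons_add_one, Var.index, snocT_avoids]

/-- The bit-string `1, …, 1` of length `k`. -/
def ones (k : w.M .nat) : w.M .nat := w.seg (w.ap (w.cls (.combK .nat .nat)) 1) k

theorem ones_add_one (k : w.M .nat) : w.ones (k + 1) = w.snoc (w.ones k) 1 := by
  rw [ones, seg_add_one, ap_combK, ones]

/-- Among the strings of a given length the one with all bits 1 has the largest code, so a sum up to
it visits all of them. -/
theorem le_ones (q : w.M .nat) : q ≤ w.ones (w.len q) := by
  have := sat_string_induction (Γ₀ := [])
    (monusT ⬝ v0 ⬝ (segT ⬝ (.combK .nat .nat ⬝ .one) ⬝ (lenT ⬝ v0)) ≐ .zero) trivial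
    (by
      intros
      simp only [Sat, eval_app, eval_monusT, eval_var_z, ap_monusT, eval_zero, ← le_iff]
      exact zero_le)
    (by
      intro Γ w ρ p c hc ih
      simp only [Sat, eval_app, eval_monusT, eval_segT, eval_lenT, eval_combK, eval_succ,
        eval_var_z, ap_monusT, ap_segT, ap_lenT, ap_succ, S_eq_add_one, eval_zero, zero_add,
        ← le_iff] at ih ⊢
      change _ ≤ w.ones _ at ih
      change _ ≤ w.ones _
      rw [len_snoc w hc, ones_add_one, snoc_eq, snoc_eq]
      have : c ≤ 1 := by
        rcases hc with rfl | rfl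
        · exact zero_le
        · exact le_rfl
      gcongr)
    w (.nil w) q
  simpa only [Sat, eval_app, eval_monusT, eval_segT, eval_lenT, eval_combK, eval_succ,
        eval_var_z, ap_monusT, ap_segT, ap_lenT, ap_succ, S_eq_add_one, eval_zero, zero_add,
        ← le_iff, ones] using this

def shift (β : w.M (.nat ⇒ .nat)) (n : w.M .nat) : w.M (.nat ⇒ .nat) :=
  w.ap (w.ap (w.cls shiftT) β) n

@[simp] theorem ap_shiftT (β : w.M (.nat ⇒ .nat)) (n : w.M .nat) :
    w.ap (w.ap (w.cls shiftT) β) n = w.shift β n := (rfl)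

@[simp] theorem ap_shift (β : w.M (.nat ⇒ .nat)) (n i : w.M .nat) :
    w.ap (w.shift β n) i = w.ap β (n + i) := by
  simp [← ap_shiftT, shiftT]

end World

namespace World

variable {Γ Γ₀ : List Ty} (w : World Γ) {σ τ : Ty}

theorem env_empty : w.env (Sub.empty Γ) = Env.nil w := by
  funext _ v
  cases v

variable {w} in
theorem Holds.cons {H : Formula Γ₀} {ρ : w.Env Γ₀} (h : w.Holds H ρ) (a : w.M τ) :
    w.Holds (H.weak τ) (Env.cons a ρ) := by
  obtain ⟨s, rfl, hs⟩ := h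
  obtain ⟨a, rfl⟩ := w.cls_surjective a
  exact ⟨Sub.cons a s, w.env_cons a s, by rwa [Formula.weak_subst_cons]⟩

/-- `β` is the value of a term that is a bit-stream in the world. -/
def BitFun (β : w.M (.nat ⇒ .nat)) : Prop := ∃ t, w.cls t = β ∧ w.F (isBitFun t)

variable {w} in
theorem BitFun.isBit {β : w.M (.nat ⇒ .nat)} (h : w.BitFun β) (a : w.M .nat) :
    w.IsBit (w.ap β a) := by
  obtain ⟨t, rfl, ht⟩ := h
  obtain ⟨a, rfl⟩ := w.cls_surjective a
  have := w.inst ht a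
  rw [OpenInd.isBit, Formula.inst] at this
  simp only [Formula.subst, Term.subst, Term.weak_subst_cons, or_iff, ← cls_eq_iff] at this
  have e : t.subst (fun _ v => .var v) = t := t.subst_id
  rw [e] at this
  simpa [Sub.cons, IsBit] using this

variable {w} in
theorem BitFun.holds {β : w.M (.nat ⇒ .nat)} (h : w.BitFun β) :
    w.Holds (isBitFun v0) (Env.cons β (Env.nil w)) := by
  obtain ⟨t, rfl, ht⟩ := h
  refine ⟨Sub.cons t (Sub.empty _), by rw [env_cons, env_empty], ?_⟩
  exact ht

variable {w} in
theorem Holds.bitFun {t : Term Γ₀ (.nat ⇒ .nat)} {ρ : w.Env Γ₀} (h : w.Holds (isBitFun t) ρ) :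
    w.BitFun (w.eval ρ t) := by
  obtain ⟨s, rfl, hs⟩ := h
  refine ⟨t.subst s, w.cls_subst s t, ?_⟩
  rw [isBitFun] at hs ⊢
  simpa only [Formula.subst, isBit, Term.subst, Term.weak_subst_lift, Sub.lift] using hs

theorem len_seg {β : w.M (.nat ⇒ .nat)} (hβ : w.BitFun β) (n : w.M .nat) :
    w.len (w.seg β n) = n := by
  simpa [Sat] using sat_induction_of (Γ₀ := [.nat ⇒ .nat]) (isBitFun v0)
    (lenT ⬝ (segT ⬝ v1 ⬝ v0) ≐ v0) trivial
    (by intros; simp [Sat])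
    (by
      intro Γ w ρ n hρ ih
      simp only [Sat, eval_app, eval_segT, eval_lenT, eval_var_z, eval_var_s, ap_segT, ap_lenT,
        S_eq_add_one, seg_add_one] at ih ⊢
      rw [len_snoc w (hρ.bitFun.isBit _), ih])
    w _ hβ.holds n

theorem pref_seg {β : w.M (.nat ⇒ .nat)} (hβ : w.BitFun β) {l n : w.M .nat} (h : l ≤ n) :
    w.pref (w.seg β n) l = w.seg β l := by
  have := sat_induction_of (Γ₀ := [.nat, .nat ⇒ .nat]) (isBitFun v1)
    (monusT ⬝ v1 ⬝ v0 ≐ .zero ⟹ prefixT ⬝ (segT ⬝ v2 ⬝ v0) ⬝ v1 ≐ segT ⬝ v2 ⬝ v1)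
    ⟨trivial, trivial⟩
    (by
      intro Γ w ρ _ h
      simp only [Sat, eval_app, eval_segT, eval_prefixT, eval_monusT, eval_var_z, eval_var_s,
        ap_segT, ap_prefixT, ap_monusT, eval_zero, ← le_iff, seg_zero, pref_zero] at h ⊢
      rw [le_antisymm h zero_le, seg_zero])
    (by
      intro Γ w ρ n hρ ih h
      simp only [Sat, eval_app, eval_segT, eval_prefixT, eval_monusT, eval_var_z, eval_var_s,
        ap_segT, ap_prefixT, ap_monusT, eval_zero, ← le_iff, S_eq_add_one] at ih h ⊢
      rcases h.lt_or_eq with h | h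
      · rw [lt_add_one_iff] at h
        rw [seg_add_one, pref_snoc_of_le w (hρ.bitFun.isBit _), ih h]
        rwa [len_seg w hρ.bitFun]
      · rw [pref_of_len_le, h]
        rw [len_seg w hρ.bitFun, h])
    w _ (hβ.holds.cons l) n
  simp only [Sat, eval_app, eval_segT, eval_prefixT, eval_monusT, eval_var_z, eval_var_s,
    ap_segT, ap_prefixT, ap_monusT, eval_zero, ← le_iff] at this
  exact this h

theorem pref_seg_min {β : w.M (.nat ⇒ .nat)} (hβ : w.BitFun β) (l n : w.M .nat) :
    w.pref (w.seg β n) l = w.seg β (min n l) := by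
  rcases le_total n l with h | h
  · rw [min_eq_left h, pref_of_len_le]
    rwa [len_seg w hβ]
  · rw [min_eq_right h, w.pref_seg hβ h]

theorem len_seg_shift {β : w.M (.nat ⇒ .nat)} (hβ : w.BitFun β) (n k : w.M .nat) :
    w.len (w.seg (w.shift β n) k) = k := by
  simpa [Sat] using sat_induction_of (Γ₀ := [.nat, .nat ⇒ .nat]) (isBitFun v1)
    (lenT ⬝ (segT ⬝ (shiftT ⬝ v2 ⬝ v1) ⬝ v0) ≐ v0) trivial
    (by intros; simp [Sat])
    (by
      intro Γ w ρ n hρ ih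
      simp only [Sat, eval_app, eval_segT, eval_lenT, eval_shiftT, eval_var_z, eval_var_s, ap_segT,
        ap_lenT, ap_shiftT, S_eq_add_one, seg_add_one, ap_shift] at ih ⊢
      rw [len_snoc w (hρ.bitFun.isBit _), ih])
    w _ (hβ.holds.cons n) k

theorem seg_add {β : w.M (.nat ⇒ .nat)} (hβ : w.BitFun β) (n k : w.M .nat) :
    w.seg β (n + k) = w.concat (w.seg β n) (w.seg (w.shift β n) k) := by
  simpa [Sat] using sat_induction_of (Γ₀ := [.nat, .nat ⇒ .nat]) (isBitFun v1)
    (segT ⬝ v2 ⬝ (addT ⬝ v1 ⬝ v0) ≐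
      concatT ⬝ (segT ⬝ v2 ⬝ v1) ⬝ (segT ⬝ (shiftT ⬝ v2 ⬝ v1) ⬝ v0)) trivial
    (by intros; simp [Sat])
    (by
      intro Γ w ρ n hρ ih
      simp only [Sat, eval_app, eval_segT, eval_concatT, eval_shiftT, eval_addT, eval_var_z,
        eval_var_s, ap_segT, ap_concatT, ap_shiftT, ap_addT, S_eq_add_one, seg_add_one,
        ap_shift] at ih ⊢
      rw [concat_snoc w (hρ.bitFun.isBit _), ← ih, ← add_assoc, seg_add_one])
    w _ (hβ.holds.cons n) k

/-! ### Covers -/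

def cover (π : w.M (.nat ⇒ .nat)) (x k N : w.M .nat) : w.M .nat :=
  w.ap (w.ap (w.ap (w.ap (w.cls coverT) π) x) k) N

def coverBody (π : w.M (.nat ⇒ .nat)) (x k N : w.M .nat) : w.M (.nat ⇒ .nat) :=
  w.ap (w.ap (w.ap (w.ap (w.cls coverBodyT) π) x) k) N

variable (π : w.M (.nat ⇒ .nat))

@[simp] theorem ap_coverT (x k N : w.M .nat) :
    w.ap (w.ap (w.ap (w.ap (w.cls coverT) π) x) k) N = w.cover π x k N := (rfl)

@[simp] theorem ap_coverBodyT (x k N : w.M .nat) :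
    w.ap (w.ap (w.ap (w.ap (w.cls coverBodyT) π) x) k) N = w.coverBody π x k N := (rfl)

theorem cover_eq (x k N : w.M .nat) :
    w.cover π x k N = w.sum (w.ones k) (w.coverBody π x k N) := by
  simp only [← ap_coverT, coverT, cls_lam_ap, ap_eval_lam, eval_app, eval_sumT, eval_segT, ap_sumT,
    ap_segT, eval_combK, eval_var_z, eval_var_s, eval_succ, eval_zero, ap_succ, S_eq_add_one,
    zero_add, ← ap_coverBodyT, coverBodyT]
  rfl

/-- There are no zero divisors, so either the weight `1 - |len q - k|` vanishes, which means `len q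
≠ k`, or some factor of the nested products does. -/
theorem coverBody_eq_zero_iff {x k N q : w.M .nat} : w.ap (w.coverBody π x k N) q = 0 ↔
    (w.len q = k → ∃ l ≤ N, ∃ m ≤ N, w.pref (w.concat x q) l = w.ap π m) := by
  simp only [← ap_coverBodyT, coverBodyT, cls_lam_ap, ap_eval_lam, eval_app, eval_mulT, eval_monusT,
    eval_succ, eval_zero, eval_distT, eval_lenT, eval_prodT, eval_prefixT, eval_concatT, eval_var_z,
    eval_var_s, ap_mulT, ap_monusT, ap_succ, S_eq_add_one, zero_add, ap_lenT, ap_prodT,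
    ap_prefixT, ap_concatT, mul_eq_zero, prod_eq_zero_iff, dist_eq_zero_iff]
  rw [or_iff_not_imp_left]
  refine imp_congr_left ?_
  rw [← w.dist_eq_zero_iff (a := w.len q)]
  rcases w.eq_zero_or_add_one (w.ap (w.ap (w.cls distT) (w.len q)) k) with h | ⟨c, h⟩
  · rw [h, tsub_zero]
    simp
  · rw [h, iff_false_right (w.add_one_ne_zero' c), not_not]
    exact tsub_eq_zero_of_le le_add_self

theorem exists_of_cover {x k N : w.M .nat} (h : w.cover π x k N = 0) {q : w.M .nat}
    (hq : w.len q = k) : ∃ l ≤ N, ∃ m ≤ N, w.pref (w.concat x q) l = w.ap π m := by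
  rw [cover_eq] at h
  have := w.le_ones q
  rw [hq] at this
  exact (w.coverBody_eq_zero_iff π).1 (w.apply_eq_zero_of_sum h this) hq

/-- For k = 0 the sum has the empty string as its only index; `l + m` bounds both witnesses. -/
theorem cover_zero_eq_zero {x l m : w.M .nat} (h : w.pref x l = w.ap π m) :
    w.cover π x 0 (l + m) = 0 := by
  rw [cover_eq, ones, seg_zero, sum_zero, coverBody_eq_zero_iff]
  intro _
  refine ⟨l, le_self_add, m, le_add_self, ?_⟩
  rwa [concat_zero]

theorem coverBody_mono {x k N N' q : w.M .nat} (hN : N ≤ N')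
    (h : w.ap (w.coverBody π x k N) q = 0) : w.ap (w.coverBody π x k N') q = 0 := by
  rw [coverBody_eq_zero_iff] at h ⊢
  intro hq
  obtain ⟨l, hl, m, hm, e⟩ := h hq
  exact ⟨l, hl.trans hN, m, hm.trans hN, e⟩

/-- Allows bounds obtained for different strings to be replaced by a common larger one. -/
theorem sum_coverBody_mono {x k N N' : w.M .nat} (hN : N ≤ N') {y : w.M .nat}
    (h : w.sum y (w.coverBody π x k N) = 0) : w.sum y (w.coverBody π x k N') = 0 := by
  have := sat_induction (Γ₀ := [.nat, .nat, .nat, .nat, .nat ⇒ .nat])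
    (monusT ⬝ v1 ⬝ v2 ≐ .zero ⟹ sumT ⬝ v0 ⬝ (coverBodyT ⬝ v5 ⬝ v4 ⬝ v3 ⬝ v1) ≐ .zero ⟹
      sumT ⬝ v0 ⬝ (coverBodyT ⬝ v5 ⬝ v4 ⬝ v3 ⬝ v2) ≐ .zero)
    ⟨trivial, trivial, trivial⟩
    (by
      intro Γ w ρ hN h
      simp only [Sat, eval_app, eval_monusT, eval_sumT, eval_coverBodyT, eval_zero, eval_var_z,
        eval_var_s, ap_monusT, ap_sumT, ap_coverBodyT, ← le_iff, sum_zero] at hN h ⊢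
      exact w.coverBody_mono _ hN h)
    (by
      intro Γ w ρ n ih hN h
      simp only [Sat, eval_app, eval_monusT, eval_sumT, eval_coverBodyT, eval_zero, eval_var_z,
        eval_var_s, ap_monusT, ap_sumT, ap_coverBodyT, ← le_iff, S_eq_add_one, sum_add_one,
        add_eq_zero] at ih hN h ⊢
      exact ⟨ih hN h.1, w.coverBody_mono _ hN h.2⟩)
    w (.cons N (.cons N' (.cons k (.cons x (.cons π (.nil w)))))) y
  simp only [Sat, eval_app, eval_monusT, eval_sumT, eval_coverBodyT, eval_zero, eval_var_z,
    eval_var_s, ap_monusT, ap_sumT, ap_coverBodyT, ← le_iff] at this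
  exact this hN h

/-- A covering by strings of length k also serves longer ones: cut `t` to length k and view the
prefix found as a prefix of the uncut string. -/
theorem exists_pref_of_cover {z b t k N : w.M .nat}
    (h : w.cover π (w.snoc z b) k N = 0) (ht : k ≤ w.len t) :
    ∃ l ≤ N, ∃ m ≤ N, w.pref (w.concat (w.snoc z b) t) l = w.ap π m := by
  obtain ⟨l, hl, m, hm, e⟩ := w.exists_of_cover π h (q := w.pref t k) (w.len_pref ht)
  rw [← pref_concat_add] at e
  rcases le_total l (w.len (w.snoc z b) + k) with h' | h'
  · exact ⟨l, hl, m, hm, by rw [← e, pref_pref w h']⟩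
  -- Here l exceeds the length of the cut string, so that string itself is enumerated and its
  -- maximal length replaces l.
  · refine ⟨_, h'.trans hl, m, hm, ?_⟩
    rw [← e, w.pref_of_len_le (p := w.pref _ (w.len (w.snoc z b) + k))]
    exact (w.len_pref_le _ _).trans h'

/-- A string of length `k₀ + k₁ + 1` is a bit followed by a tail long enough for either child. Sums
serve as upper bounds in place of maxima. -/
theorem cover_of_cover_snoc {z k₀ N₀ k₁ N₁ : w.M .nat} (h₀ : w.cover π (w.snoc z 0) k₀ N₀ = 0)
    (h₁ : w.cover π (w.snoc z 1) k₁ N₁ = 0) : w.cover π z (k₀ + k₁ + 1) (N₀ + N₁) = 0 := by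
  -- Each summand vanishes; that the whole sum does needs a further induction, whose formula has the
  -- two coverings as premises.
  have body : ∀ {Γ : List Ty} (w : World Γ) {π : w.M (.nat ⇒ .nat)} {z k₀ N₀ k₁ N₁ : w.M .nat},
      w.cover π (w.snoc z 0) k₀ N₀ = 0 → w.cover π (w.snoc z 1) k₁ N₁ = 0 →
      ∀ q, w.ap (w.coverBody π z (k₀ + k₁ + 1) (N₀ + N₁)) q = 0 := by
    intro Γ w π z k₀ N₀ k₁ N₁ h₀ h₁ q
    rw [coverBody_eq_zero_iff]
    intro hq
    obtain ⟨b, t, hb, ht, e⟩ := w.exists_cons hq z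
    rw [e]
    rcases hb with rfl | rfl
    · obtain ⟨l, hl, m, hm, e'⟩ := w.exists_pref_of_cover π h₀ (t := t)
        (ht.symm ▸ le_self_add)
      exact ⟨l, hl.trans le_self_add, m, hm.trans le_self_add, e'⟩
    · obtain ⟨l, hl, m, hm, e'⟩ := w.exists_pref_of_cover π h₁ (t := t)
        (ht.symm ▸ le_add_self)
      exact ⟨l, hl.trans le_add_self, m, hm.trans le_add_self, e'⟩
  have := sat_induction (Γ₀ := [.nat, .nat, .nat, .nat, .nat, .nat ⇒ .nat])
    (coverT ⬝ .var (.s (.s (.s (.s (.s (.s .z)))))) ⬝ (snocT ⬝ v1 ⬝ .zero) ⬝ v2 ⬝ v3 ≐ .zero ⟹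
      coverT ⬝ .var (.s (.s (.s (.s (.s (.s .z)))))) ⬝ (snocT ⬝ v1 ⬝ .one) ⬝ v4 ⬝ v5 ≐ .zero ⟹
      sumT ⬝ v0 ⬝ (coverBodyT ⬝ .var (.s (.s (.s (.s (.s (.s .z)))))) ⬝ v1 ⬝
        (.succ ⬝ (addT ⬝ v2 ⬝ v4)) ⬝ (addT ⬝ v3 ⬝ v5)) ≐ .zero)
    ⟨trivial, trivial, trivial⟩
    (by
      intro Γ w ρ h₀ h₁
      simp only [Sat, eval_app, eval_addT, eval_sumT, eval_coverT, eval_coverBodyT, eval_snocT,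
        eval_zero, eval_succ, eval_var_z, eval_var_s, ap_succ, ap_addT, ap_sumT, ap_snocT, ap_coverT,
        ap_coverBodyT, S_eq_add_one, sum_zero, zero_add] at h₀ h₁ ⊢
      exact body w h₀ h₁ _)
    (by
      intro Γ w ρ n ih h₀ h₁
      simp only [Sat, eval_app, eval_addT, eval_sumT, eval_coverT, eval_coverBodyT, eval_snocT,
        eval_zero, eval_succ, eval_var_z, eval_var_s, ap_succ, ap_addT, ap_sumT, ap_snocT, ap_coverT,
        ap_coverBodyT, S_eq_add_one, sum_add_one, zero_add, add_eq_zero] at ih h₀ h₁ ⊢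
      exact ⟨ih h₀ h₁, body w h₀ h₁ _⟩)
    w (.cons z (.cons k₀ (.cons N₀ (.cons k₁ (.cons N₁ (.cons π (.nil w))))))) (w.ones (k₀ + k₁ + 1))
  simp only [Sat, eval_app, eval_addT, eval_sumT, eval_coverT, eval_coverBodyT, eval_snocT,
        eval_zero, eval_succ, eval_var_z, eval_var_s, ap_succ, ap_addT, ap_sumT, ap_snocT, ap_coverT,
        ap_coverBodyT, S_eq_add_one, zero_add] at this
  rw [cover_eq]
  exact this h₀ h₁

/-- Apply the covering to the k bits of `β` that follow the first n. The minimum appears because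
cutting at l has no effect beyond length n + k. -/
theorem exists_seg_of_cover {β : w.M (.nat ⇒ .nat)} (hβ : w.BitFun β) {n k N : w.M .nat}
    (h : w.cover π (w.seg β n) k N = 0) : ∃ l m, w.seg β (min (n + k) l) = w.ap π m := by
  obtain ⟨l, -, m, -, e⟩ := w.exists_of_cover π h (w.len_seg_shift hβ n k)
  rw [← seg_add w hβ, pref_seg_min w hβ] at e
  exact ⟨l, m, e⟩

/-! ### The bit-stream defined by `alphaT` -/

def rho (χ : w.M (.nat ⇒ .nat)) (n : w.M .nat) : w.M .nat := w.ap (w.ap (w.cls rhoT) χ) n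
def alpha (χ : w.M (.nat ⇒ .nat)) : w.M (.nat ⇒ .nat) := w.ap (w.cls alphaT) χ

variable (χ : w.M (.nat ⇒ .nat))

@[simp] theorem ap_rhoT (n : w.M .nat) : w.ap (w.ap (w.cls rhoT) χ) n = w.rho χ n := (rfl)
@[simp] theorem ap_alphaT : w.ap (w.cls alphaT) χ = w.alpha χ := (rfl)

/-- The bit by which `alphaT` prolongs the string `z`. -/
def alphaBit (z : w.M .nat) : w.M .nat :=
  w.ite (w.ap χ (w.snoc z 0)) (w.ite (w.ap χ (w.snoc z 1)) 0 1) 0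

theorem isBit_alphaBit (z : w.M .nat) : w.IsBit (w.alphaBit χ z) := by
  rw [alphaBit]
  rcases w.eq_zero_or_add_one (w.ap χ (w.snoc z 0)) with h | ⟨c, h⟩
  · rw [h, ite_zero]
    exact .inl rfl
  · rw [h, ite_add_one]
    rcases w.eq_zero_or_add_one (w.ap χ (w.snoc z 1)) with h | ⟨c, h⟩
    · rw [h, ite_zero]
      exact .inr rfl
    · rw [h, ite_add_one]
      exact .inl rfl

@[simp] theorem rho_zero : w.rho χ 0 = 0 := by
  simp [← ap_rhoT, rhoT]

theorem rho_add_one (n : w.M .nat) :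
    w.rho χ (n + 1) = w.snoc (w.rho χ n) (w.alphaBit χ (w.rho χ n)) := by
  simp [← ap_rhoT, rhoT, ifT, eval_cons_add_one, Var.index, snocT_avoids, alphaBit, ite]

theorem len_rho (n : w.M .nat) : w.len (w.rho χ n) = n := by
  simpa [Sat] using sat_induction (Γ₀ := [.nat ⇒ .nat]) (lenT ⬝ (rhoT ⬝ v1 ⬝ v0) ≐ v0) trivial
    (by intros; simp [Sat])
    (by
      intro Γ w ρ n ih
      simp only [Sat, eval_app, eval_lenT, eval_rhoT, eval_var_z, eval_var_s, ap_lenT, ap_rhoT,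
        S_eq_add_one, rho_add_one] at ih ⊢
      rw [len_snoc w (w.isBit_alphaBit _ _), ih])
    w (.cons χ (.nil w)) n

/-- After n + 1 steps the string has length n + 1, so its bit with index n is the one appended last.
-/
theorem ap_alpha (n : w.M .nat) : w.ap (w.alpha χ) n = w.alphaBit χ (w.rho χ n) := by
  have : w.ap (w.alpha χ) n = w.last (w.pref (w.rho χ (n + 1)) (n + 1)) := by
    simp only [← ap_alphaT, alphaT, nthT, cls_lam_ap, ap_eval_lam, eval_app, eval_lastT,
      eval_prefixT, eval_recR, eval_var_z, eval_var_s, eval_succ, ap_lastT, ap_prefixT, ap_recR,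
      ap_succ, S_eq_add_one, ← ap_rhoT, rhoT, R_add_one]
    rw [w.eval_cons_add_one _ n]
    · simp
    · simp [ifT, Var.index, snocT_avoids]
  rw [this, pref_of_len_le w (w.len_rho χ _).le, rho_add_one, last_snoc w (w.isBit_alphaBit _ _)]

/-- `alphaT` recomputes the whole string for every bit; this says that the recomputations cohere. -/
theorem seg_alpha (n : w.M .nat) : w.seg (w.alpha χ) n = w.rho χ n := by
  simpa [Sat] using sat_induction (Γ₀ := [.nat ⇒ .nat])
    (segT ⬝ (alphaT ⬝ v1) ⬝ v0 ≐ rhoT ⬝ v1 ⬝ v0) trivial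
    (by intros; simp [Sat])
    (by
      intro Γ w ρ n ih
      simp only [Sat, eval_app, eval_segT, eval_rhoT, eval_alphaT, eval_var_z, eval_var_s, ap_segT,
        ap_rhoT, ap_alphaT, S_eq_add_one, seg_add_one, rho_add_one, ap_alpha] at ih ⊢
      rw [ih])
    w (.cons χ (.nil w)) n

end World

/-! ### Substitution and weakening in the formulas of Open Induction. -/

section Substitution

variable {Γ Δ : List Ty} {σ τ υ : Ty}

theorem Term.weak_of_subst {t : ∀ Γ, Term Γ σ}
    (h : ∀ {Γ Δ : List Ty} (s : Sub Γ Δ), (t Γ).subst s = t Δ) :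
    ((t Γ).weak : Term (υ :: Γ) σ) = t _ := by
  rw [Term.weak_eq_subst, h]

@[simp] theorem addT_weak : ((addT : Term Γ _).weak : Term (υ :: Γ) _) = addT :=
  Term.weak_of_subst addT_subst
@[simp] theorem minT_weak : ((minT : Term Γ _).weak : Term (υ :: Γ) _) = minT :=
  Term.weak_of_subst minT_subst
@[simp] theorem coverT_weak : ((coverT : Term Γ _).weak : Term (υ :: Γ) _) = coverT :=
  Term.weak_of_subst coverT_subst
@[simp] theorem coverBodyT_weak :
    ((coverBodyT : Term Γ _).weak : Term (υ :: Γ) _) = coverBodyT :=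
  Term.weak_of_subst coverBodyT_subst
@[simp] theorem sumT_weak : ((sumT : Term Γ _).weak : Term (υ :: Γ) _) = sumT :=
  Term.weak_of_subst sumT_subst
@[simp] theorem snocT_weak : ((snocT : Term Γ _).weak : Term (υ :: Γ) _) = snocT :=
  Term.weak_of_subst snocT_subst
@[simp] theorem segT_weak : ((segT : Term Γ _).weak : Term (υ :: Γ) _) = segT :=
  Term.weak_of_subst segT_subst
@[simp] theorem alphaT_weak : ((alphaT : Term Γ _).weak : Term (υ :: Γ) _) = alphaT :=
  Term.weak_of_subst alphaT_subst

variable (π : Term [] (.nat ⇒ .nat)) (s : Sub Γ Δ)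

@[simp] theorem isBitFun_subst (t : Term Γ (.nat ⇒ .nat)) :
    (isBitFun t).subst s = isBitFun (t.subst s) := by
  simp [isBitFun, isBit, Term.weak_subst_lift]

@[simp] theorem memA_subst (t : Term Γ (.nat ⇒ .nat)) :
    (memA π t).subst s = memA π (t.subst s) := by
  simp [memA, Term.weak_subst_lift, Term.closed_subst]

@[simp] theorem memB_subst (t : Term Γ .nat) : (memB π t).subst s = memB π (t.subst s) := by
  simp [memB, Term.weak_subst_lift, Term.closed_subst]

@[simp] theorem memBUnfolded_subst (t : Term Γ .nat) :
    (memBUnfolded π t).subst s = memBUnfolded π (t.subst s) := by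
  simp [memBUnfolded, Term.weak_subst_lift, Term.closed_subst]

@[simp] theorem lexLt_subst (t u : Term Γ (.nat ⇒ .nat)) :
    (lexLt t u).subst s = lexLt (t.subst s) (u.subst s) := by
  simp [lexLt, Term.weak_subst_lift]

@[simp] theorem progressive_subst : (progressive π).subst s = progressive π := by
  simp [progressive]

@[simp] theorem isBitFun_weak (t : Term Γ (.nat ⇒ .nat)) :
    (isBitFun t).weak τ = isBitFun t.weak := by
  rw [Formula.weak_eq_subst, isBitFun_subst, Term.weak_eq_subst]

@[simp] theorem memA_weak (t : Term Γ (.nat ⇒ .nat)) : (memA π t).weak τ = memA π t.weak := by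
  rw [Formula.weak_eq_subst, memA_subst, Term.weak_eq_subst]

@[simp] theorem memB_weak (t : Term Γ .nat) : (memB π t).weak τ = memB π t.weak := by
  rw [Formula.weak_eq_subst, memB_subst, Term.weak_eq_subst]

@[simp] theorem memBUnfolded_weak (t : Term Γ .nat) :
    (memBUnfolded π t).weak τ = memBUnfolded π t.weak := by
  rw [Formula.weak_eq_subst, memBUnfolded_subst, Term.weak_eq_subst]

@[simp] theorem progressive_weak : (progressive π : Formula Γ).weak τ = progressive π := by
  rw [Formula.weak_eq_subst, progressive_subst]

theorem nilMemB_inCtx : (nilMemB π).inCtx Γ = memB π nilT := by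
  rw [SigmaSentence.inCtx, Formula.rename_eq_subst, nilMemB, memB_subst]
  rfl

@[simp] theorem Formula.weak_eq' (t u : Term Γ .nat) :
    (t ≐ u).weak τ = (t.weak ≐ u.weak) := (rfl)

@[simp] theorem Formula.weak_and (A B : Formula Γ) :
    (A ⋏ B).weak τ = (A.weak τ ⋏ B.weak τ) := (rfl)

end Substitution

/-! ### Existential formulas and membership in B inside worlds. -/

namespace World

variable {Γ Γ₀ : List Ty} (w : World Γ) {σ τ : Ty}

theorem ex_intro {A : Formula (σ :: Γ)} (t : Term Γ σ) (h : w.F (A.inst t)) : w.F (.ex A) :=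
  w.ded₁ (Prv.head.exI t) h

theorem _root_.OpenInd.Formula.rename_lift_inst (A : Formula (σ :: Γ)) :
    (A.rename ((Ren.weak Γ σ).lift σ)).inst v0 = A := by
  rw [Formula.inst, Formula.rename_eq_subst, Formula.subst_subst]
  conv_rhs => rw [← Formula.subst_id A]
  congr 1
  funext _ v
  cases v <;> rfl

variable {w} in
theorem of_all {A : Formula (σ :: Γ)} {w' : World (σ :: Γ)}
    (hw' : ∀ C, w.F C → w'.F (C.weak σ)) (h : w.F (.all A)) : w'.F A := by
  have := w'.inst (hw' _ h) v0
  rwa [Formula.rename_lift_inst] at this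

variable {w} in
-- A world need not contain witnesses for its existential members, so the witness is a fresh
-- variable of a larger world, and the goal is weakened.
theorem ex_elim {A : Formula (σ :: Γ)} {G : Formula Γ} (h : w.F (.ex A))
    (h' : ∀ w' : World (σ :: Γ), (∀ C, w.F C → w'.F (C.weak σ)) → w'.F A → w'.F (G.weak σ)) :
    w.F G := by
  have key : w.F (.all (A ⟹ G.weak σ)) := w.all_intro fun w' hw' => w'.imp_intro fun w'' hw'' hA =>
    h' w'' (fun C hC => hw'' _ (hw' C hC)) hA
  refine w.ded₂ (A := .ex A) (B := .all (A ⟹ G.weak σ)) (.exE .head ?_) h key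
  have := (Prv.hyp (Δ := A :: [Formula.ex A, .all (A ⟹ G.weak σ)].map (Formula.weak σ))
    (A := (Formula.all (A ⟹ G.weak σ)).weak σ) (by simp)).allE v0
  rw [Formula.rename_lift_inst] at this
  exact this.impE .head

variable (π : Term [] (.nat ⇒ .nat))

theorem memB_intro {t : Term Γ .nat} (k N : w.M .nat)
    (h : w.cover (w.cls (π.closed Γ)) (w.cls t) k N = 0) : w.F (memB π t) := by
  obtain ⟨k, rfl⟩ := w.cls_surjective k
  obtain ⟨N, rfl⟩ := w.cls_surjective N
  refine w.ex_intro k (w.ex_intro N ?_)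
  simp only [Formula.inst, Formula.subst_eq, Term.subst_app, Term.subst_of_var, Term.subst_zero, Term.weak_subst_lift, Term.weak_subst_cons, Term.closed_subst, coverT_subst, Sub.lift_z, Sub.lift_s, Sub.cons_z, Term.subst_var, ← cls_eq_iff]
  exact h

variable {w π} in
theorem memB_elim {t : Term Γ .nat} {G : Formula Γ} (h : w.F (memB π t))
    (h' : ∀ w' : World (.nat :: .nat :: Γ), (∀ C, w.F C → w'.F ((C.weak .nat).weak .nat)) →
      w'.cover (w'.cls (π.closed _)) (w'.cls t.weak.weak) (w'.cls v1) (w'.cls v0) = 0 →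
        w'.F ((G.weak .nat).weak .nat)) : w.F G :=
  ex_elim h fun _ hw₁ h₁ => ex_elim h₁ fun w₂ hw₂ h₂ =>
    h' w₂ (fun C hC => hw₂ _ (hw₁ C hC)) (w₂.cls_eq_iff.2 h₂)

variable {π} in
theorem memB_congr {t u : Term Γ .nat} (htu : w.cls t = w.cls u) (h : w.F (memB π t)) :
    w.F (memB π u) := by
  refine memB_elim h fun w' hw' h' => ?_
  rw [memB_weak, memB_weak]
  refine w'.memB_intro π (w'.cls v1) (w'.cls v0) ?_
  have e : w'.cls t.weak.weak = w'.cls u.weak.weak :=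
    w'.cls_eq_iff.2 (hw' _ (w.cls_eq_iff.1 htu))
  rwa [← e]

end World

/-! ### The bounded quantifier written out -/

section

variable {Γ Δ : List Ty} {τ : Ty} (π : Term [] (.nat ⇒ .nat)) (s : Sub Γ Δ)

/-- The string `q` is harmless for `x ∈ B` with the length `k`. -/
def coverAt (x k q : Term Γ .nat) : Formula Γ :=
  .ex (coverBodyT ⬝ π.closed _ ⬝ x.weak ⬝ k.weak ⬝ v0 ⬝ q.weak ≐ .zero)

/-- All strings up to the code `y` are harmless for `x ∈ B` with the length `k`. -/
def coverUpTo (x k y : Term Γ .nat) : Formula Γ :=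
  .ex (sumT ⬝ y.weak ⬝ (coverBodyT ⬝ π.closed _ ⬝ x.weak ⬝ k.weak ⬝ v0) ≐ .zero)

@[simp] theorem coverAt_subst (x k q : Term Γ .nat) :
    (coverAt π x k q).subst s = coverAt π (x.subst s) (k.subst s) (q.subst s) := by
  simp [coverAt, Term.weak_subst_lift, Term.closed_subst]

@[simp] theorem coverUpTo_subst (x k y : Term Γ .nat) :
    (coverUpTo π x k y).subst s = coverUpTo π (x.subst s) (k.subst s) (y.subst s) := by
  simp [coverUpTo, Term.weak_subst_lift, Term.closed_subst]

@[simp] theorem coverAt_weak (x k q : Term Γ .nat) :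
    (coverAt π x k q).weak τ = coverAt π x.weak k.weak q.weak := by
  simp only [Formula.weak_eq_subst, coverAt_subst, Term.weak_eq_subst]

@[simp] theorem coverUpTo_weak (x k y : Term Γ .nat) :
    (coverUpTo π x k y).weak τ = coverUpTo π x.weak k.weak y.weak := by
  simp only [Formula.weak_eq_subst, coverUpTo_subst, Term.weak_eq_subst]

end

namespace World

variable {Γ Γ₀ : List Ty} (w : World Γ) {σ τ : Ty} (π : Term [] (.nat ⇒ .nat))

theorem coverAt_intro {x k q : Term Γ .nat} (N : w.M .nat)
    (h : w.ap (w.coverBody (w.cls (π.closed Γ)) (w.cls x) (w.cls k) N) (w.cls q) = 0) :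
    w.F (coverAt π x k q) := by
  obtain ⟨N, rfl⟩ := w.cls_surjective N
  refine w.ex_intro N ?_
  simp only [Formula.inst, Formula.subst_eq, Term.subst_app, Term.subst_of_var, Term.subst_zero, Term.weak_subst_cons, Term.closed_subst, coverBodyT_subst, Sub.cons_z, Term.subst_var, ← cls_eq_iff]
  exact h

theorem coverUpTo_intro {x k y : Term Γ .nat} (N : w.M .nat)
    (h : w.sum (w.cls y) (w.coverBody (w.cls (π.closed Γ)) (w.cls x) (w.cls k) N) = 0) :
    w.F (coverUpTo π x k y) := by
  obtain ⟨N, rfl⟩ := w.cls_surjective N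
  refine w.ex_intro N ?_
  simp only [Formula.inst, Formula.subst_eq, Term.subst_app, Term.subst_of_var, Term.subst_zero, Term.weak_subst_cons, Term.closed_subst, sumT_subst, coverBodyT_subst, Sub.cons_z, Term.subst_var, ← cls_eq_iff]
  exact h

/-- The body of `memBUnfolded`. -/
abbrev _root_.OpenInd.unfoldedAt (x k : Term Γ .nat) : Formula Γ :=
  .all (lenT ⬝ v0 ≐ k.weak ⟹
    .ex (.ex (prefixT ⬝ (concatT ⬝ x.weak.weak.weak ⬝ v2) ⬝ v1 ≐ π.closed _ ⬝ v0)))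

/-- Equality of numbers is decided in a world, which permits a case distinction on the length of
`q`. For the wrong length any bound works; otherwise the sum of the two witnesses does. -/
theorem coverAt_of_unfoldedAt {x k : Term Γ .nat} (h : w.F (unfoldedAt π x k)) (q : Term Γ .nat) :
    w.F (coverAt π x k q) := by
  by_cases hq : w.len (w.cls q) = w.cls k
  · have h := w.inst h q
    simp only [Formula.inst, Formula.subst_eq, Formula.subst_imp, Formula.subst_ex, Term.subst_app, Term.subst_of_var, Term.weak_subst_lift, Term.weak_subst_cons, Term.closed_subst, lenT_subst, prefixT_subst, concatT_subst, Sub.lift_z, Sub.lift_s, Sub.cons_z, Term.subst_var] at h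
    have h := w.mp h (w.cls_eq_iff.1 hq)
    refine ex_elim h fun w₁ hw₁ h₁ => ex_elim h₁ fun w₂ hw₂ h₂ => ?_
    rw [coverAt_weak, coverAt_weak]
    exact w₂.coverAt_intro π (w₂.cls v1 + w₂.cls v0) <| (w₂.coverBody_eq_zero_iff _).2
      fun _ => ⟨_, le_self_add, _, le_add_self, w₂.cls_eq_iff.2 h₂⟩
  · exact w.coverAt_intro π 0 <| (w.coverBody_eq_zero_iff _).2 fun h => (hq h).elim

theorem memBUnfolded_of_memB {t : Term Γ .nat} (h : w.F (memB π t)) : w.F (memBUnfolded π t) := by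
  refine memB_elim h fun w₁ _ h₁ => ?_
  rw [memBUnfolded_weak, memBUnfolded_weak]
  generalize t.weak.weak = t at *
  refine w₁.ex_intro v1 (w₁.all_intro fun w₂ hw₂ => w₂.imp_intro fun w₃ hw₃ h₃ => ?_)
  simp only [Formula.subst_eq, Formula.subst_ex, Term.subst_app, Term.subst_of_var, Term.weak_subst_lift, Term.weak_subst_cons, Term.closed_subst, lenT_subst, prefixT_subst, concatT_subst, Sub.lift_z, Sub.lift_s, Sub.cons_z, Term.subst_var] at h₃ ⊢
  have h₁ : w₃.cover (w₃.cls (π.closed _)) (w₃.cls t.weak) (w₃.cls v2) (w₃.cls v1) = 0 :=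
    w₃.cls_eq_iff.2 <| by
      simpa using hw₃ _ (hw₂ _ ((w₁.cls_eq_iff
        (a := coverT ⬝ π.closed _ ⬝ t ⬝ v1 ⬝ v0) (b := .zero)).1 h₁))
  obtain ⟨l, -, m, -, e'⟩ := w₃.exists_of_cover _ h₁ (q := w₃.cls v0) (w₃.cls_eq_iff.2 h₃)
  obtain ⟨l, rfl⟩ := w₃.cls_surjective l
  obtain ⟨m, rfl⟩ := w₃.cls_surjective m
  refine w₃.ex_intro l (w₃.ex_intro m ?_)
  simp only [Formula.inst, Formula.subst_eq, Term.subst_app, Term.subst_of_var, Term.weak_subst_lift, Term.weak_subst_cons, Term.closed_subst, prefixT_subst, concatT_subst, Sub.lift_z, Sub.cons_z, Term.subst_var, ← cls_eq_iff]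
  exact e'

/-- Collection of bounds: the induction on `y` adds the bound for the next string to the previous
one. The formulas have quantifiers, so this uses `induction` and not its quantifier-free version. -/
theorem coverUpTo_of_unfoldedAt {x k : Term Γ .nat} (h : w.F (unfoldedAt π x k))
    (y : Term Γ .nat) : w.F (coverUpTo π x k y) := by
  have e : ∀ {Γ : List Ty} (s : Sub [.nat, .nat] Γ),
      (unfoldedAt π v1 v0).subst s = unfoldedAt π (s _ (.s .z)) (s _ .z) := by
    intro Γ s
    simp only [Formula.subst_eq, Formula.subst_imp, Formula.subst_all, Formula.subst_ex, Term.subst_app, Term.subst_of_var, lenT_subst, prefixT_subst, concatT_subst, Term.closed_subst, Sub.lift_z, Sub.lift_s, Term.weak_var]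
  have := induction (Γ₀ := [.nat, .nat]) (unfoldedAt π v1 v0) (coverUpTo π v2 v1 v0)
    (fun w s hH => by
      rw [e] at hH
      rw [coverUpTo_subst]
      refine ex_elim (w.coverAt_of_unfoldedAt π hH .zero) fun w' hw' h' => ?_
      rw [coverUpTo_weak]
      refine w'.coverUpTo_intro π (w'.cls v0) ?_
      exact (w'.sum_zero _).trans (w'.cls_eq_iff.2 h'))
    (fun w s n hH ih => by
      rw [e] at hH
      simp only [coverUpTo_subst, Term.subst_of_var, Sub.cons_z, Sub.cons_s] at ih ⊢
      refine ex_elim ih fun w₁ hw₁ h₁ => ?_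
      have h₂ := hw₁ _ (w.coverAt_of_unfoldedAt π hH (.succ ⬝ n))
      rw [coverAt_weak] at h₂
      refine ex_elim h₂ fun w₂ hw₂ h₂ => ?_
      rw [coverUpTo_weak, coverUpTo_weak]
      have h₁ : w₂.F ((sumT ⬝ n.weak ⬝ (coverBodyT ⬝ π.closed _ ⬝ (s _ (.s .z)).weak ⬝
        (s _ .z).weak ⬝ v0) ≐ .zero).weak .nat) := hw₂ _ h₁
      simp only [Formula.weak_eq', Term.weak_app, sumT_weak, coverBodyT_weak, Term.weak_closed, Term.weak_var, Term.weak_zero] at h₁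
      have h₁ := w₂.cls_eq_iff.2 h₁
      have h₂ := w₂.cls_eq_iff.2 h₂
      simp only [Term.weak_app, Term.weak_succ, cls_app, ap_succ, S_eq_add_one, ap_coverBodyT] at h₂
      refine w₂.coverUpTo_intro π (w₂.cls v1 + w₂.cls v0) ?_
      simp only [Term.weak_app, Term.weak_succ, cls_app, ap_succ, S_eq_add_one, sum_add_one, add_eq_zero]
      exact ⟨w₂.sum_coverBody_mono _ le_self_add h₁,
        w₂.coverBody_mono _ le_add_self h₂⟩)
    w (Sub.cons k (Sub.cons x (Sub.empty _))) (by rwa [e]) y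
  rwa [coverUpTo_subst] at this

theorem memB_of_memBUnfolded {t : Term Γ .nat} (h : w.F (memBUnfolded π t)) : w.F (memB π t) := by
  refine ex_elim h fun w₁ _ h₁ => ?_
  rw [memB_weak]
  -- The summation bound is the largest code of a string of length k, as in `coverT`.
  have h₂ := w₁.coverUpTo_of_unfoldedAt π (x := t.weak) (k := v0) h₁
    (segT ⬝ (.combK .nat .nat ⬝ .one) ⬝ v0)
  refine ex_elim h₂ fun w₂ _ h₂ => ?_
  rw [memB_weak]
  refine w₂.memB_intro π (w₂.cls v1) (w₂.cls v0) ?_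
  rw [cover_eq]
  simpa [ones] using w₂.cls_eq_iff.2 h₂

end World

/-! ### The property of the decision function χ. -/

section

variable {Γ Δ : List Ty} {τ : Ty} (π : Term [] (.nat ⇒ .nat)) (s : Sub Γ Δ)

/-- The function `χ` into the bits decides `x ∈ B` up to `⟨⟩ ∈ B`. -/
def decides (χ : Term Γ (.nat ⇒ .nat)) : Formula Γ :=
  isBitFun χ ⋏ .all ((χ.weak ⬝ v0 ≐ .one ⟹ memB π v0) ⋏
    (χ.weak ⬝ v0 ≐ .zero ⟹ memB π v0 ⟹ memB π nilT))

@[simp] theorem decides_subst (χ : Term Γ (.nat ⇒ .nat)) :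
    (decides π χ).subst s = decides π (χ.subst s) := by
  simp [decides, Term.weak_subst_lift]

@[simp] theorem decides_weak (χ : Term Γ (.nat ⇒ .nat)) :
    (decides π χ).weak τ = decides π χ.weak := by
  simp only [Formula.weak_eq_subst, decides_subst, Term.weak_eq_subst]

theorem characteristic_eq : (characteristic π : Formula Γ) = .ex (decides π v0) := by
  rw [characteristic, nilMemB_inCtx]
  rfl

theorem decidability_eq : (decidability π : Formula Γ) =
    .all (memB π v0 ⋎ (memB π v0 ⟹ memB π nilT)) := by
  rw [decidability, nilMemB_inCtx]

end

/-! ### Membership in B along the stream α. -/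

namespace World

variable {Γ Γ₀ : List Ty} (w : World Γ) {σ τ : Ty} {π : Term [] (.nat ⇒ .nat)}

variable {w} in

theorem bitFun_cls {β : Term Γ (.nat ⇒ .nat)} (h : w.F (isBitFun β)) : w.BitFun (w.cls β) :=
  ⟨β, rfl, h⟩

/-- A function all of whose values are bits in every extension is a bit-stream. -/
theorem isBitFun_alpha (χ : Term Γ (.nat ⇒ .nat)) : w.F (isBitFun (alphaT ⬝ χ)) := by
  refine w.all_intro fun w' _ => ?_
  simp only [isBit, Term.weak_app, alphaT_weak, or_iff, ← cls_eq_iff, cls_app, ap_alphaT, ap_alpha]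
  simpa [IsBit] using w'.isBit_alphaBit (w'.cls χ.weak) (w'.rho (w'.cls χ.weak) (w'.cls v0))

variable {w} in
theorem decides_one {χ : Term Γ (.nat ⇒ .nat)} (h : w.F (decides π χ)) {x : Term Γ .nat}
    (hx : w.ap (w.cls χ) (w.cls x) = 1) : w.F (memB π x) := by
  have := (w.and_iff.1 (w.inst (w.and_iff.1 h).2 x)).1
  simp only [Formula.subst_eq, Formula.subst_imp, Term.subst_app, Term.subst_of_var, Term.subst_zero, Term.subst_succ, Term.weak_subst_cons, Sub.cons_z, Term.subst_var, memB_subst] at this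
  refine w.mp this (w.cls_eq_iff.1 ?_)
  simpa using hx

variable {w} in
theorem decides_zero {χ : Term Γ (.nat ⇒ .nat)} (h : w.F (decides π χ)) {x : Term Γ .nat}
    (hx : w.ap (w.cls χ) (w.cls x) = 0) (hB : w.F (memB π x)) : w.F (memB π nilT) := by
  have := (w.and_iff.1 (w.inst (w.and_iff.1 h).2 x)).2
  simp only [Formula.subst_eq, Formula.subst_imp, Term.subst_app, Term.subst_of_var, Term.subst_zero, Term.weak_subst_cons, Sub.cons_z, Term.subst_var, memB_subst] at this
  exact w.mp (w.mp this (w.cls_eq_iff.1 (by simpa using hx))) hB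

variable {w} in
theorem decides_bit {χ : Term Γ (.nat ⇒ .nat)} (h : w.F (decides π χ)) (x : Term Γ .nat) :
    w.ap (w.cls χ) (w.cls x) = 0 ∨ w.ap (w.cls χ) (w.cls x) = 1 :=
  (w.bitFun_cls (w.and_iff.1 h).1).isBit _

theorem memB_of_snoc {z : Term Γ .nat} (h₀ : w.F (memB π (snocT ⬝ z ⬝ .zero)))
    (h₁ : w.F (memB π (snocT ⬝ z ⬝ .one))) : w.F (memB π z) := by
  refine memB_elim h₀ fun w₁ hw₁ h₀ => ?_
  have h₁ := hw₁ _ h₁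
  rw [memB_weak, memB_weak] at h₁ ⊢
  refine memB_elim h₁ fun w₂ hw₂ h₁ => ?_
  rw [memB_weak, memB_weak]
  have h₀ := hw₂ _ ((w₁.cls_eq_iff (a := coverT ⬝ π.closed _ ⬝
    (snocT ⬝ z ⬝ .zero).weak.weak ⬝ v1 ⬝ v0) (b := .zero)).1 h₀)
  simp only [Formula.weak_eq', Term.weak_app, Term.weak_var, Term.weak_zero, Term.weak_closed, coverT_weak, snocT_weak, ← cls_eq_iff] at h₀
  simp only [Term.weak_app, Term.weak_zero, Term.weak_succ, snocT_weak] at h₁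
  -- The fresh variables `v3`, `v2` are length and bound of the first covering, `v1`, `v0` those of
  -- the second.
  refine w₂.memB_intro π _ _ (w₂.cover_of_cover_snoc _ (k₀ := w₂.cls v3) (N₀ := w₂.cls v2)
    (k₁ := w₂.cls v1) (N₁ := w₂.cls v0) ?_ ?_)
  · simpa using h₀
  · simpa using h₁

/-- The bit 1 is chosen only after χ has accepted the left child; the value 0 of χ there would force
the bit 0. -/
theorem memB_snoc_of_alpha {χ : Term Γ (.nat ⇒ .nat)} {n : Term Γ .nat} (h : w.F (decides π χ))
    (hn : w.F (alphaT ⬝ χ ⬝ n ≐ .one)) :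
    w.F (memB π (snocT ⬝ (segT ⬝ (alphaT ⬝ χ) ⬝ n) ⬝ .zero)) := by
  refine decides_one h ((decides_bit h _).resolve_left fun h₀ => ?_)
  have hn := w.cls_eq_iff.2 hn
  simp only [cls_app, ap_alphaT, ap_snocT, ap_segT, seg_alpha, ap_alpha, alphaBit, cls_zero, ap_succ] at h₀ hn
  rw [h₀, ite_zero] at hn
  exact w.zero_ne_S _ hn

/-- If χ rejects the left child, or accepts it and rejects the right one, then α moves to a rejected
string, and membership of that string gives S. If χ accepts both children, the parent is in B and
the induction hypothesis applies. -/
theorem memB_alpha_step {χ : Term Γ (.nat ⇒ .nat)} {n : Term Γ .nat} (h : w.F (decides π χ))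
    (ih : w.F (memB π (segT ⬝ (alphaT ⬝ χ) ⬝ n) ⟹ memB π nilT))
    (hB : w.F (memB π (segT ⬝ (alphaT ⬝ χ) ⬝ (.succ ⬝ n)))) : w.F (memB π nilT) := by
  have e : w.cls (segT ⬝ (alphaT ⬝ χ) ⬝ (.succ ⬝ n)) =
      w.snoc (w.cls (segT ⬝ (alphaT ⬝ χ) ⬝ n))
        (w.alphaBit (w.cls χ) (w.cls (segT ⬝ (alphaT ⬝ χ) ⬝ n))) := by
    simp [seg_alpha, rho_add_one]
  generalize (segT ⬝ (alphaT ⬝ χ) ⬝ n : Term Γ .nat) = z at ih e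
  rw [alphaBit] at e
  have c₀ : w.cls (snocT ⬝ z ⬝ .zero) = w.snoc (w.cls z) 0 := by simp
  have c₁ : w.cls (snocT ⬝ z ⬝ .one) = w.snoc (w.cls z) 1 := by simp
  rcases decides_bit h (snocT ⬝ z ⬝ .zero) with h₀ | h₀
  · refine decides_zero h h₀ (w.memB_congr ?_ hB)
    rw [c₀] at h₀ ⊢
    rw [e, h₀, ite_zero]
  · rcases decides_bit h (snocT ⬝ z ⬝ .one) with h₁ | h₁
    · refine decides_zero h h₁ (w.memB_congr ?_ hB)
      rw [c₀] at h₀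
      rw [c₁] at h₁ ⊢
      rw [e, h₀, h₁, ite_one, ite_zero]
    · exact w.mp ih (w.memB_of_snoc (decides_one h h₀) (decides_one h h₁))

/-- An enumerated string is in B with k = 0. The proof term fixes this numeral, so only the bound
stays quantified. -/
theorem exists_cover_of_memA {χ : Term Γ (.nat ⇒ .nat)} {l m : Term Γ .nat}
    (h : w.F (segT ⬝ (alphaT ⬝ χ) ⬝ l ≐ π.closed _ ⬝ m)) :
    w.F (.ex (coverT ⬝ π.closed _ ⬝ (segT ⬝ (alphaT ⬝ χ) ⬝ l).weak ⬝ .zero ⬝ v0 ≐ .zero)) := by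
  obtain ⟨N, hN⟩ := w.cls_surjective (w.cls l + w.cls m)
  refine w.ex_intro N ?_
  simp only [Formula.inst, Formula.subst_eq, Term.subst_app, Term.subst_of_var, Term.subst_zero, Term.weak_subst_cons, Term.closed_subst, coverT_subst, Sub.cons_z, Term.subst_var, ← cls_eq_iff]
  have h := w.cls_eq_iff.2 h
  simp only [cls_app, ap_coverT, hN, cls_zero] at h ⊢
  refine w.cover_zero_eq_zero _ ?_
  rw [← h, pref_of_len_le]
  simp [seg_alpha, len_rho]

/-- `β ∈ A`, with a bound for the length of the initial segment. -/
abbrev _root_.OpenInd.memABelow {Γ : List Ty} (π : Term [] (.nat ⇒ .nat)) (β : Term Γ (.nat ⇒ .nat))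
    (b : Term Γ .nat) : Formula Γ :=
  .ex (.ex (segT ⬝ β.weak.weak ⬝ (minT ⬝ b.weak.weak ⬝ v1) ≐ π.closed _ ⬝ v0))

theorem memABelow_of_cover {β : Term Γ (.nat ⇒ .nat)} {b : Term Γ .nat} (hβ : w.F (isBitFun β))
    {n k N : w.M .nat}
    (h : w.cover (w.cls (π.closed Γ)) (w.seg (w.cls β) n) k N = 0) (hb : w.cls b = n + k) :
    w.F (memABelow π β b) := by
  obtain ⟨l, m, e⟩ := w.exists_seg_of_cover _ (w.bitFun_cls hβ) h
  obtain ⟨l, rfl⟩ := w.cls_surjective l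
  obtain ⟨m, rfl⟩ := w.cls_surjective m
  refine w.ex_intro l (w.ex_intro m ?_)
  simp only [Formula.inst, Formula.subst_eq, Term.subst_app, Term.subst_of_var, Term.weak_subst_lift, Term.weak_subst_cons, Term.closed_subst, segT_subst, minT_subst, Sub.lift_z, Sub.lift_s, Sub.cons_z, Term.subst_var, ← cls_eq_iff, cls_app, ap_segT, ap_minT, hb]
  exact e

variable {w} in
theorem ex_cover_elim {x k : Term Γ .nat} {G : Formula Γ}
    (h : w.F (.ex (coverT ⬝ π.closed _ ⬝ x.weak ⬝ k.weak ⬝ v0 ≐ .zero)))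
    (h' : ∀ w' : World (.nat :: Γ), (∀ C, w.F C → w'.F (C.weak .nat)) →
      w'.cover (w'.cls (π.closed _)) (w'.cls x.weak) (w'.cls k.weak) (w'.cls v0) = 0 →
        w'.F (G.weak .nat)) : w.F G :=
  ex_elim h fun w' hw' h₁ => h' w' hw' (w'.cls_eq_iff.2 h₁)

end World

section

variable {Γ Δ : List Ty} {τ : Ty} (π : Term [] (.nat ⇒ .nat)) (s : Sub Γ Δ)

theorem Prv.memB_iff_memBUnfolded :
    Prv ([] : List (Formula Γ)) (.all (Formula.iff (memB π v0) (memBUnfolded π v0))) := by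
  refine prv_of_worlds fun w _ => w.all_intro fun w₁ _ => ?_
  exact w₁.and_iff.2 ⟨w₁.imp_intro fun w₂ _ h => w₂.memBUnfolded_of_memB π h,
    w₁.imp_intro fun w₂ _ h => w₂.memB_of_memBUnfolded π h⟩

theorem Prv.derives {Δ : List (Formula Γ)} {A : Formula Γ} (h : Prv Δ A)
    (C : Option SigmaSentence) (d : Bool) : ∃ p, Derives HAωAC C d Δ p A :=
  let ⟨p, hp⟩ := h
  ⟨p, hp.mono (fun _ _ => .base) C d⟩

/-! ### The decision function -/

/-- Excluded middle relative to S: the continuation is offered the right alternative, whose proof,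
once given `x ∈ B`, calls the continuation again with the left one. -/
theorem derives_decideTerm (T : Theory) (Δ : List (Formula Γ)) :
    Derives T (some (nilMemB π)) true Δ decideTerm (decidability π) :=
  .allI (.shift rfl (.impE (.hyp rfl) (.orI₂ (.impI (.impE (.hyp rfl) (.orI₁ (.hyp rfl)))))))

/-- The bit `y` tells whether `x ∈ B`, up to `⟨⟩ ∈ B`. -/
def decisionGraph (x y : Term Γ .nat) : Formula Γ :=
  (y ≐ .one ⋏ memB π x) ⋎ (y ≐ .zero ⋏ (memB π x ⟹ memB π nilT))

@[simp] theorem decisionGraph_subst (x y : Term Γ .nat) :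
    (decisionGraph π x y).subst s = decisionGraph π (x.subst s) (y.subst s) := by
  simp [decisionGraph]

@[simp] theorem decisionGraph_weak (x y : Term Γ .nat) :
    (decisionGraph π x y).weak τ = decisionGraph π x.weak y.weak := by
  simp only [Formula.weak_eq_subst, decisionGraph_subst, Term.weak_eq_subst]

/-- `⟨⟩ ∈ B` implies all equations. -/
def collapse : Formula Γ :=
  .all (.all (memB π nilT ⟹ v1 ≐ v0))

@[simp] theorem collapse_weak : (collapse π : Formula Γ).weak τ = collapse π := by
  simp [collapse, Formula.weak_eq_subst]

/-- Ex falso from S: the shift ignores its continuation, which has index 0, and returns the proof of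
S at index 1. Stated as a formula, this can serve as a hypothesis of control-free derivations. -/
theorem derives_collapse (T : Theory) (Δ : List (Formula Γ)) :
    ∃ p, Derives T (some (nilMemB π)) true Δ p (collapse π) := by
  refine ⟨_, .allI (.allI (.impI (.shift (p := .var 1) rfl ?_)))⟩
  rw [nilMemB_inCtx]
  exact .hyp rfl

end

namespace World

variable {Γ : List Ty} {w : World Γ} {π : Term [] (.nat ⇒ .nat)}

theorem eq_of_collapse (h : w.F (collapse π)) (hS : w.F (memB π nilT)) (a b : Term Γ .nat) :
    w.F (a ≐ b) := by
  have := w.inst h a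
  rw [Formula.inst, Formula.subst_all] at this
  have := w.inst this b
  rw [Formula.inst, Formula.subst_imp, Formula.subst_imp, memB_subst, memB_subst] at this
  have := w.mp this hS
  simpa using this

/-- Different bits would come from different alternatives; these together yield S, and `collapse`
equates the bits. -/
theorem decisionGraph_unique (h : w.F (collapse π)) {x a b : Term Γ .nat}
    (ha : w.F (decisionGraph π x a)) (hb : w.F (decisionGraph π x b)) : w.F (a ≐ b) := by
  simp only [decisionGraph, or_iff, and_iff, ← cls_eq_iff] at ha hb ⊢
  rcases ha with ⟨ha, ha'⟩ | ⟨ha, ha'⟩ <;> rcases hb with ⟨hb, hb'⟩ | ⟨hb, hb'⟩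
  · exact ha.trans hb.symm
  · exact w.cls_eq_iff.2 (eq_of_collapse h (w.mp hb' ha') _ _)
  · exact w.cls_eq_iff.2 (eq_of_collapse h (w.mp ha' hb') _ _)
  · exact ha.trans hb.symm

theorem existsUnique_of_decisionGraph (h : w.F (collapse π)) {x t : Term Γ .nat}
    (ht : w.F (isBit t)) (hx : w.F (decisionGraph π x t)) :
    w.F (.ex (isBit v0 ⋏ decisionGraph π x.weak v0 ⋏
      .all (isBit v0 ⟹ decisionGraph π x.weak.weak v0 ⟹ v0 ≐ v1))) := by
  refine w.ex_intro t ?_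
  simp only [Formula.inst, isBit, Formula.subst_and, Formula.subst_or, Formula.subst_imp,
    Formula.subst_eq, Formula.subst_all, decisionGraph_subst, Term.weak_subst_lift,
    Term.weak_subst_cons, Term.subst_var, Term.subst_of_var, Term.subst_app, Term.subst_succ,
    Term.subst_zero, Sub.lift_z, Sub.lift_s, Sub.cons_z]
  refine w.and_iff.2 ⟨ht, w.and_iff.2 ⟨hx, w.all_intro fun w₁ hw₁ =>
    w₁.imp_intro fun w₂ hw₂ _ => w₂.imp_intro fun w₃ hw₃ h₃ => ?_⟩⟩
  have h := hw₃ _ (hw₂ _ (hw₁ _ h))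
  have hx := hw₃ _ (hw₂ _ (hw₁ _ hx))
  rw [collapse_weak] at h
  rw [decisionGraph_weak] at hx
  exact decisionGraph_unique h h₃ hx

/-- Since 0 ≠ 1 in a consistent world, the value of χ determines which alternative of the graph
holds. -/
theorem decides_of_decisionGraph {χ : Term Γ (.nat ⇒ .nat)} (hχ : w.F (isBitFun χ))
    (h : w.F (.all (decisionGraph π v0 (χ.weak ⬝ v0)))) : w.F (decides π χ) := by
  refine w.and_iff.2 ⟨hχ, w.all_intro fun w₁ hw₁ => ?_⟩
  have h₁ : w₁.F (decisionGraph π v0 (χ.weak ⬝ v0)) := World.of_all hw₁ h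
  generalize χ.weak ⬝ v0 = y at h₁ ⊢
  have hne : ∀ w₂ : World (.nat :: Γ), w₂.F (y ≐ .zero) → ¬ w₂.F (y ≐ .one) := fun w₂ h₀ h₁ =>
    w₂.consistent (w₂.cls_eq_iff.1 ((w₂.cls_eq_iff.2 h₀).symm.trans (w₂.cls_eq_iff.2 h₁)))
  refine w₁.and_iff.2 ⟨w₁.imp_intro fun w₂ hw₂ h₂ => ?_, w₁.imp_intro fun w₂ hw₂ h₂ => ?_⟩
  · rcases w₂.or_iff.1 (hw₂ _ h₁) with h | h
    · exact (w₂.and_iff.1 h).2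
    · exact (hne _ (w₂.and_iff.1 h).1 h₂).elim
  · rcases w₂.or_iff.1 (hw₂ _ h₁) with h | h
    · exact (hne _ h₂ (w₂.and_iff.1 h).1).elim
    · exact (w₂.and_iff.1 h).2

end World

section

variable {Γ : List Ty} (π : Term [] (.nat ⇒ .nat))

theorem uniqueChoice_decisionGraph :
    (uniqueChoice (decisionGraph π v1 v0) : Formula Γ) =
      (.all (.ex (isBit v0 ⋏ decisionGraph π v0.weak v0 ⋏
        .all (isBit v0 ⟹ decisionGraph π v0.weak.weak v0 ⟹ v0 ≐ v1))) ⟹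
      .ex (isBitFun v0 ⋏ .all (decisionGraph π v0 (v0.weak ⬝ v0)))) := by
  rw [uniqueChoice, Formula.rename_eq_subst, decisionGraph_subst, decisionGraph_subst]
  rfl

/-- Choice and control enter only through the three hypotheses, so the rest can be argued in worlds.
-/
theorem prv_characteristic :
    Prv [uniqueChoice (decisionGraph π v1 v0), collapse π, decidability π]
      (characteristic π : Formula Γ) := by
  refine prv_of_worlds fun w hw => ?_
  have hc : w.F (uniqueChoice (decisionGraph π v1 v0)) := hw _ (by simp)
  have hk : w.F (collapse π) := hw _ (by simp)
  have hd : w.F (decidability π) := hw _ (by simp)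
  rw [uniqueChoice_decisionGraph] at hc
  rw [decidability_eq] at hd
  rw [characteristic_eq]
  have hE := w.mp hc ?_
  · refine World.ex_elim hE fun w₁ _ h => ?_
    rw [Formula.weak_eq_subst, Formula.subst_ex, decides_subst]
    refine w₁.ex_intro v0 ?_
    rw [Formula.inst, decides_subst]
    exact World.decides_of_decisionGraph (w₁.and_iff.1 h).1 (w₁.and_iff.1 h).2
  · refine w.all_intro fun w₁ hw₁ => ?_
    have hk := hw₁ _ hk
    rw [collapse_weak] at hk
    rcases w₁.or_iff.1 (World.of_all hw₁ hd) with h | h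
    · refine World.existsUnique_of_decisionGraph hk (t := .one) ?_ ?_
      · exact w₁.or_iff.2 (.inr (w₁.cls_eq_iff.1 rfl))
      · exact w₁.or_iff.2 (.inl (w₁.and_iff.2 ⟨w₁.cls_eq_iff.1 rfl, h⟩))
    · refine World.existsUnique_of_decisionGraph hk (t := .zero) ?_ ?_
      · exact w₁.or_iff.2 (.inl (w₁.cls_eq_iff.1 rfl))
      · exact w₁.or_iff.2 (.inr (w₁.and_iff.2 ⟨w₁.cls_eq_iff.1 rfl, h⟩))

theorem exists_derives_characteristic (Δ : List (Formula Γ)) :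
    ∃ p, Derives HAωAC (some (nilMemB π)) true Δ p (decidability π ⟹ characteristic π) := by
  obtain ⟨p, hp⟩ := (prv_characteristic (Γ := Γ) π).impI.impI.derives (some (nilMemB π)) true
  obtain ⟨p, hp⟩ := hp.weaken (Δ' := decidability π :: Δ) (by simp)
  obtain ⟨q, hq⟩ := derives_collapse π HAωAC (decidability π :: Δ)
  exact ⟨_, .impI (.impE (.impE hp hq) (.ax (.choice (decisionGraph π v1 v0))))⟩

end

/-! ### Derivations with prescribed proof terms. -/

section

variable {Γ : List Ty} {T : Theory} {C : Option SigmaSentence} {d : Bool}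
  (π : Term [] (.nat ⇒ .nat))

@[simp] theorem memABelow_weak {τ : Ty} (β : Term Γ (.nat ⇒ .nat)) (b : Term Γ .nat) :
    (memABelow π β b).weak τ = memABelow π β.weak b.weak := by
  simp only [Formula.weak_eq_subst, memABelow, Formula.subst_ex, Formula.subst_eq, Term.subst_app,
    Term.weak_subst_lift, segT_subst, minT_subst, Term.closed_subst, Term.subst_of_var, Sub.lift_z,
    Sub.lift_s, Term.weak_var]
  simp only [← Term.weak_eq_subst]

theorem memABelow_body_eq (β : Term Γ (.nat ⇒ .nat)) (b : Term Γ .nat) :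
    (Formula.ex (segT ⬝ β.weak.weak.weak ⬝ v1 ≐ π.closed _ ⬝ v0) :
        Formula (.nat :: .nat :: Γ)).inst (minT ⬝ b.weak ⬝ v0) =
      .ex (segT ⬝ β.weak.weak ⬝ (minT ⬝ b.weak.weak ⬝ v1) ≐ π.closed _ ⬝ v0) := by
  simp [Formula.inst, Term.weak_subst_lift]

/-- The bounded version already has the truncated length in place, so after the elimination the
hypothesis is literally the required instance. Hence a variable serves as p₈ and as p₁₂. -/
theorem derives_memA_of_memABelow {Δ : List (Formula Γ)} {p : PTerm Γ} {β : Term Γ (.nat ⇒ .nat)}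
    {b : Term Γ .nat} (h : Derives T C d Δ p (memABelow π β b)) :
    Derives T C d Δ (.exE (σ := .nat) p (.exI (minT ⬝ b.weak ⬝ v0) (.var 0))) (memA π β) := by
  refine .exE h ?_
  rw [memA_weak]
  refine .exI _ ?_
  rw [memABelow_body_eq]
  exact .hyp rfl

/-- The matrix of `lexLt β α`, for `α` defined by `alphaT`. -/
abbrev lexAlpha : Formula (.nat :: (.nat ⇒ .nat) :: (.nat ⇒ .nat) :: Γ) :=
  segT ⬝ v1 ⬝ v0 ≐ segT ⬝ (alphaT ⬝ v2) ⬝ v0 ⋏ v1 ⬝ v0 ≐ .zero ⋏ alphaT ⬝ v2 ⬝ v0 ≐ .one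

/-- The initial segment of length `n` of the stream defined by `alphaT`, followed by `0`. -/
abbrev branchT : Term (.nat :: (.nat ⇒ .nat) :: (.nat ⇒ .nat) :: Γ) .nat :=
  snocT ⬝ (segT ⬝ (alphaT ⬝ v2) ⬝ v0) ⬝ .zero

/-- The hypotheses under which `a₁` stands. -/
abbrev lexHyps (Δ : List (Formula ((.nat ⇒ .nat) :: Γ))) :
    List (Formula (.nat :: (.nat ⇒ .nat) :: (.nat ⇒ .nat) :: Γ)) :=
  lexAlpha :: (lexLt v0 (alphaT ⬝ v1) :: isBitFun v0 :: Δ.map (Formula.weak (.nat ⇒ .nat))).map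
    (Formula.weak .nat)

/-- The hypotheses under which `p₇` stands. -/
abbrev coverHyps (Δ : List (Formula ((.nat ⇒ .nat) :: Γ))) :
    List (Formula (.nat :: .nat :: (.nat ⇒ .nat) :: (.nat ⇒ .nat) :: Γ)) :=
  .ex (coverT ⬝ π.closed _ ⬝ branchT.weak.weak ⬝ v1 ⬝ v0 ≐ .zero) ::
    (lexHyps Δ).map (Formula.weak .nat)

theorem prv_memB_branch {Δ : List (Formula ((.nat ⇒ .nat) :: Γ))} (hΔ : decides π v0 ∈ Δ) :
    Prv (lexHyps Δ) (alphaT ⬝ v2 ⬝ v0 ≐ .one ⟹ memB π branchT) := by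
  refine prv_of_worlds fun w hw => w.imp_intro fun w' hw' h => ?_
  have hb : ((decides π v0).weak (.nat ⇒ .nat)).weak .nat ∈ lexHyps Δ := by
    simp only [lexHyps, List.map_cons, List.map_map, List.mem_cons, List.mem_map]
    exact .inr (.inr (.inr ⟨_, hΔ, rfl⟩))
  have hb := hw' _ (hw _ hb)
  rw [decides_weak, decides_weak] at hb
  exact World.memB_snoc_of_alpha _ hb h

/-- The first n + 1 bits of β are those of α up to n followed by 0, a string covered with length k.
The bound is thus (n + 1) + k. -/
theorem prv_memABelow_branch (Δ : List (Formula ((.nat ⇒ .nat) :: Γ))) :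
    Prv (coverHyps π Δ) (memABelow π v2 (.succ ⬝ (addT ⬝ v1 ⬝ v0))) := by
  refine prv_of_worlds fun w hw => ?_
  have hc := hw (.ex (coverT ⬝ π.closed _ ⬝ branchT.weak.weak ⬝ v1 ⬝ v0 ≐ .zero)) (by simp)
  have hl := hw (lexAlpha.weak .nat) (by simp)
  have hβ := hw (((isBitFun v0).weak .nat).weak .nat) (by simp)
  refine World.ex_cover_elim (x := branchT.weak) (k := v0) hc fun w' hw' hN => ?_
  have hl := hw' _ hl
  have hβ := hw' _ hβ
  simp only [isBitFun_weak, Term.weak_var] at hβ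
  simp only [Formula.weak_and, Formula.weak_eq', Term.weak_app, Term.weak_var, segT_weak,
    alphaT_weak, Term.weak_zero, World.and_iff, ← World.cls_eq_iff, World.cls_app,
    World.ap_segT, World.ap_alphaT, World.cls_zero] at hl
  simp only [Term.weak_app, Term.weak_var, segT_weak, alphaT_weak, snocT_weak, Term.weak_zero,
    World.cls_app, World.ap_segT, World.ap_alphaT, World.ap_snocT, World.cls_zero] at hN
  rw [memABelow_weak]
  refine w'.memABelow_of_cover (n := w'.cls v2 + 1) (k := w'.cls v1) (N := w'.cls v0) hβ ?_ ?_
  · simp only [Term.weak_var, World.seg_add_one, hl.1, hl.2.1]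
    exact hN
  · simp [add_right_comm]

theorem derives_below {P : Parts} {Δ : List (Formula [.nat ⇒ .nat, .nat ⇒ .nat])}
    (h₁ : Derives T C d (lexHyps Δ) P.a1 (alphaT ⬝ v2 ⬝ v0 ≐ .one ⟹ memB π branchT))
    (h₇ : Derives T C d (coverHyps π Δ) P.p7 (memABelow π v2 (.succ ⬝ (addT ⬝ v1 ⬝ v0))))
    (h₈ : P.p8 = .var 0) :
    Derives T C d Δ P.below (.all (isBitFun v0 ⟹ lexLt v0 (alphaT ⬝ v1) ⟹ memA π v0)) := by
  refine .allI (.impI (.impI (.exE (A := lexAlpha) ?_ ?_)))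
  · refine .hyp (congrArg some ?_)
    simp [lexLt]
  · rw [memA_weak]
    refine .exE (A := .ex (coverT ⬝ π.closed _ ⬝ branchT.weak.weak ⬝ v1 ⬝ v0 ≐ .zero))
      (.impE h₁ (.andE₂ (.andE₂ (.hyp rfl)))) ?_
    rw [memA_weak, h₈]
    have := derives_memA_of_memABelow π h₇
    have e : ((.succ ⬝ (addT ⬝ v1 ⬝ v0) :
        Term [.nat, .nat, .nat ⇒ .nat, .nat ⇒ .nat, .nat ⇒ .nat] .nat).weak : Term (.nat :: _) .nat) =
        .succ ⬝ (addT ⬝ v2 ⬝ v1) := by simp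
    rw [e] at this
    exact this

/-! ### Induction along the stream defined by `alphaT` -/

/-- `⟨⟩ ∈ B` follows if the initial segment of length `x` of the stream is in `B`. -/
abbrev branchStep (x : Term Γ .nat) (χ : Term Γ (.nat ⇒ .nat)) : Formula Γ :=
  memB π (segT ⬝ (alphaT ⬝ χ) ⬝ x) ⟹ memB π nilT

theorem prv_branchStep_zero {Δ : List (Formula Γ)} (χ : Term Γ (.nat ⇒ .nat)) :
    Prv Δ (branchStep π .zero χ) := by
  refine prv_of_worlds fun w _ => w.imp_intro fun w' _ h => w'.memB_congr ?_ h
  simp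

theorem prv_branchStep_succ {Δ : List (Formula Γ)} {χ : Term Γ (.nat ⇒ .nat)}
    (hΔ : decides π χ ∈ Δ) :
    Prv Δ (.all (branchStep π v0 χ.weak ⟹ branchStep π (.succ ⬝ v0) χ.weak)) := by
  refine prv_of_worlds fun w hw => w.all_intro fun w₁ hw₁ => w₁.imp_intro fun w₂ hw₂ ih =>
    w₂.imp_intro fun w₃ hw₃ h => ?_
  have hb := hw₃ _ (hw₂ _ (hw₁ _ (hw _ hΔ)))
  rw [decides_weak] at hb
  exact w₃.memB_alpha_step hb (hw₃ _ ih) h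

theorem prv_exists_cover {Δ : List (Formula Γ)} {χ : Term Γ (.nat ⇒ .nat)} {l m : Term Γ .nat}
    (hΔ : (segT ⬝ (alphaT ⬝ χ) ⬝ l ≐ π.closed _ ⬝ m) ∈ Δ) :
    Prv Δ (.ex (coverT ⬝ π.closed _ ⬝ (segT ⬝ (alphaT ⬝ χ) ⬝ l).weak ⬝ .zero ⬝ v0 ≐ .zero)) :=
  prv_of_worlds fun w hw => w.exists_cover_of_memA (hw _ hΔ)

/-- The induction axiom occurs as a constant of the proof term, so its instance is first brought
syntactically into the form displayed there. -/
theorem derives_nilMemB {Δ : List (Formula Γ)} {χ : Term Γ (.nat ⇒ .nat)} {l : Term Γ .nat}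
    {a₀ a₃ p : PTerm Γ} (hT : ∀ Γ A, HAω Γ A → T Γ A)
    (h₀ : Derives T C d Δ a₀ (branchStep π .zero χ))
    (h₃ : Derives T C d Δ a₃ (.all (branchStep π v0 χ.weak ⟹ branchStep π (.succ ⬝ v0) χ.weak)))
    (hp : Derives T C d Δ p
      (.ex (coverT ⬝ π.closed _ ⬝ (segT ⬝ (alphaT ⬝ χ) ⬝ l).weak ⬝ .zero ⬝ v0 ≐ .zero))) :
    Derives T C d Δ (.app (.allE (.app (.app (.ax (branchStep π .zero χ ⟹
      .all (branchStep π v0 χ.weak ⟹ branchStep π (.succ ⬝ v0) χ.weak) ⟹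
        .all (branchStep π v0 χ.weak))) a₀) a₃) l) (.exI (σ := .nat) .zero p)) (memB π nilT) := by
  have hI := HAω.induction (branchStep π v0 χ.weak)
  have e : ∀ {Δ : List Ty} (s : Sub Γ Δ) (a : Term Δ .nat),
      (branchStep π v0 χ.weak).subst (Sub.cons a s) = branchStep π a (χ.subst s) := by
    intro Δ s a
    simp
  rw [Formula.inst, e, e, Term.subst_var, ← Term.weak_eq_subst] at hI
  have h := (((Derives.ax (hT _ _ hI)).impE h₀).impE h₃).allE (C := C) (d := d) l
  rw [Formula.inst, e, Term.subst_var] at h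
  refine h.impE (.exI _ ?_)
  convert hp using 1
  simp [Formula.inst, Term.weak_subst_lift]

/-- The empty string is the initial segment of length 0 of every stream, so the covering applies
with n = 0. -/
theorem prv_memABelow_nil {Δ : List (Formula Γ)} {α : Term Γ (.nat ⇒ .nat)} {k : Term Γ .nat}
    (hα : isBitFun α ∈ Δ)
    (hΔ : (Formula.ex (coverT ⬝ π.closed _ ⬝ nilT ⬝ k.weak ⬝ v0 ≐ .zero)) ∈ Δ) :
    Prv Δ (memABelow π α k) := by
  refine prv_of_worlds fun w hw => ?_
  refine World.ex_cover_elim (x := nilT) (k := k) (hw _ hΔ) fun w' hw' hN => ?_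
  have hα := hw' _ (hw _ hα)
  rw [isBitFun_weak] at hα
  rw [memABelow_weak]
  refine w'.memABelow_of_cover (n := 0) (k := w'.cls k.weak) (N := w'.cls v0) hα ?_ (zero_add _).symm
  rw [World.seg_zero]
  exact hN

end

/-! ### The proof term -/

theorem progressive_inst {Γ : List Ty} (π : Term [] (.nat ⇒ .nat)) (α : Term Γ (.nat ⇒ .nat)) :
    (isBitFun v0 ⟹ .all (σ := .nat ⇒ .nat) (isBitFun v0 ⟹ lexLt v0 v1 ⟹ memA π v0) ⟹
      memA π v0 : Formula ((.nat ⇒ .nat) :: Γ)).inst α =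
    (isBitFun α ⟹ .all (isBitFun v0 ⟹ lexLt v0 α.weak ⟹ memA π v0) ⟹ memA π α) := by
  simp [Formula.inst]

/-- The lists `Δ₁`, …, `Δ₄` are the hypotheses in force inside the reset, after χ, after l and m,
and after k'. The parts left open are found for these by control-free derivability, except for the
choice step and the induction axiom. -/
theorem exists_parts (π : Term [] (.nat ⇒ .nat)) : ∃ P : Parts,
      Derives HAωAC (some (nilMemB π)) true [isBitFun v0, progressive π] P.aC
        (decidability π ⟹ characteristic π) ∧
      Derives HAωAC (some (nilMemB π)) false [] P.term (openInduction π) := by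
  let Δ₁ : List (Formula [.nat ⇒ .nat]) := [isBitFun v0, progressive π]
  let Δ₂ : List (Formula [.nat ⇒ .nat, .nat ⇒ .nat]) :=
    decides π v0 :: Δ₁.map (Formula.weak (.nat ⇒ .nat))
  let Δ₃ : List (Formula [.nat, .nat, .nat ⇒ .nat, .nat ⇒ .nat]) :=
    (segT ⬝ (alphaT ⬝ v2) ⬝ v1 ≐ π.closed _ ⬝ v0) ::
      (.ex (segT ⬝ (alphaT ⬝ v2) ⬝ v1 ≐ π.closed _ ⬝ v0) ::
        Δ₂.map (Formula.weak .nat)).map (Formula.weak .nat)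
  let Δ₄ : List (Formula [.nat, .nat ⇒ .nat]) :=
    .ex (coverT ⬝ π.closed _ ⬝ nilT ⬝ v1 ⬝ v0 ≐ .zero) :: Δ₁.map (Formula.weak .nat)
  have hb : decides π v2 ∈ Δ₃ := by simp [Δ₃, Δ₂]
  obtain ⟨aC, haC⟩ := exists_derives_characteristic π Δ₁
  obtain ⟨eα, heα⟩ := (prv_of_worlds (Δ := Δ₂) fun w _ =>
    w.isBitFun_alpha v0).derives (some (nilMemB π)) true
  obtain ⟨a1, ha1⟩ := (prv_memB_branch π (Δ := Δ₂) List.mem_cons_self).derives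
    (some (nilMemB π)) true
  obtain ⟨p7, hp7⟩ := (prv_memABelow_branch π Δ₂).derives (some (nilMemB π)) true
  obtain ⟨a0, ha0⟩ := (prv_branchStep_zero π (Δ := Δ₃) v2).derives (some (nilMemB π)) true
  obtain ⟨a3, ha3⟩ := (prv_branchStep_succ π hb).derives (some (nilMemB π)) true
  obtain ⟨p10, hp10⟩ := (prv_exists_cover π (Δ := Δ₃) List.mem_cons_self).derives
    (some (nilMemB π)) true
  -- p₁₁ stands outside the reset, hence the unmarked turnstile here.
  obtain ⟨p11, hp11⟩ := (prv_memABelow_nil π (Δ := Δ₄) (α := v1) (k := v0) (by simp [Δ₄, Δ₁])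
    (by simp [Δ₄])).derives (some (nilMemB π)) false
  refine ⟨⟨aC, eα, a1, p7, .var 0, .ax (branchStep π .zero v2 ⟹
    .all (branchStep π v0 v3 ⟹ branchStep π (.succ ⬝ v0) v3) ⟹ .all (branchStep π v0 v3)),
    a0, a3, p10, p11, .var 0⟩, haC, ?_⟩
  refine .impI (.allI (.impI ?_))
  rw [List.map_cons, List.map_nil, progressive_weak]
  refine .exE (A := .ex (coverT ⬝ π.closed _ ⬝ nilT ⬝ v1 ⬝ v0 ≐ .zero)) ?_ ?_
  · change Derives _ _ _ Δ₁ _ (memB π nilT)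
    rw [← nilMemB_inCtx]
    refine .reset rfl ?_
    rw [nilMemB_inCtx]
    have hC := haC.impE (derives_decideTerm π HAωAC Δ₁)
    rw [characteristic_eq] at hC
    refine .exE hC ?_
    rw [memB_weak]
    have hp : Derives HAωAC (some (nilMemB π)) true Δ₂ (.var 2) (progressive π) :=
      .hyp (by simp [Δ₂, Δ₁])
    have hp := hp.allE (alphaT ⬝ v0)
    rw [progressive_inst, Term.weak_app, alphaT_weak, Term.weak_var] at hp
    refine .exE ((hp.impE heα).impE (derives_below π ha1 hp7 rfl)) ?_
    rw [memB_weak]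
    refine .exE (.hyp rfl) ?_
    rw [memB_weak]
    exact derives_nilMemB π (fun _ _ => .base) ha0 ha3 hp10
  · rw [memA_weak]
    exact derives_memA_of_memABelow π hp11

end OpenInd

open OpenInd in
theorem mainTheorem5 (π : Term [] (.nat ⇒ .nat)) :
    (∃ p : PTerm [], Derives HAω none false [] p
      (.all (Formula.iff (memB π v0) (memBUnfolded π v0)))) ∧
    ∃ P : Parts,
      Derives HAωAC (some (nilMemB π)) true [isBitFun v0, progressive π] P.aC
        (decidability π ⟹ characteristic π) ∧
      Derives HAωAC (some (nilMemB π)) false [] P.term (openInduction π) :=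
  ⟨Prv.memB_iff_memBUnfolded π, exists_parts π⟩
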